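/- Let $K$ be a field of characteristic zero and let $\lambda=(\lambda_1\ge\dots\ge\lambda_d\ge 1)$ be a partition of $n$; let $m_j$ be the number of parts equal to $j$ and $p$ the largest part. Points of $\mathbb P^n$ are binary forms of degree $n$ up to scaling, and forms are paired by $\langle f,g\rangle=\sum_{i=0}^n\binom ni a_ib_i$ for $f=\sum_i\binom ni a_ix^iy^{n-i}$ and $g=\sum_i\binom ni b_iu^iv^{n-i}$. Let $\Delta_\lambda\subset\mathbb P^n$ be the multiple root locus, i.e. the Zariski closure of the set of products $\ell_1^{\lambda_1}\cdots\ell_d^{\lambda_d}$ of linear forms (this set is already closed if $K$ is algebraically closed). Let $(\Delta_\lambda)^\vee\subset\mathbb P^n$ be its dual variety, i.e. the (closure of the) projection to the second factor of the conormal variety, which is the Zariski closure of the set of pairs $(f,g)$ with $f$ a smooth point of $\Delta_\lambda$ and $g\perp T_f\Delta_\lambda$. Let $\mathcal J_\lambda$ be the free join of the varieties $\mathbb P^1\times\mathbb P^{\lambda_i-2}$ over all $i$ with $\lambda_i\neq 1$, where $\mathbb P^1\times\mathbb P^{\lambda_i-2}$ is embedded by $\mathcal O(n-\lambda_i+2,1)$.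 A point of $\mathcal J_\lambda$ is represented by points $(s_i,t_i)\in K^2$ and binary forms $g_i$ of degree $\lambda_i-2$, for all $i$ with $\lambda_i\ne1$; its homogeneous coordinates are the products $s_i^a\,t_i^{\,n-\lambda_i+2-a}c_{i,b}$, where the $c_{i,b}$ are the coefficients of $g_i$. Then: 1. $\dim(\Delta_\lambda)^\vee=n-m_1-1$ (with $\dim\emptyset=-1$). 2. The generalized additive decomposition $$\bigl((s_i:t_i),\,g_i\bigr)_{\lambda_i\neq1}\;\longmapsto\; g(u,v)=\sum_{i:\ \lambda_i\ne 1}(s_iu+t_iv)^{\,n-\lambda_i+2}\,g_i(u,v)$$ defines a rational map $\mathcal J_\lambda\dashrightarrow\mathbb P^n$ whose image has Zariski closure $(\Delta_\lambda)^\vee$, and which is finite-to-one: it has finite fibres over a dense Zariski open subset of $(\Delta_\lambda)^\vee$. 3. This rational map $\mathcal J_\lambda\dashrightarrow(\Delta_\lambda)^\vee$ has degree $m_2!\,m_3!\cdots m_p!$, i.e. the extension of function fields $K(\mathcal J_\lambda)\,/\,K((\Delta_\lambda)^\vee)$ has this degree. -/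

import Mathlib

open scoped LinearAlgebra.Projectivization

noncomputable section

namespace BinaryForms

open MvPolynomial

/-! ### Projective varieties over an infinite field, through their affine cones -/

section Projective

variable {K : Type*} [Field K] {σ τ : Type*}

/-- The affine cone over a subset of projective space; it always contains the origin. -/
def cone (X : Set (ℙ K (σ → K))) : Set (σ → K) :=
  {v | ∀ hv : v ≠ 0, Projectivization.mk K v hv ∈ X}

/-- The vanishing ideal of (the affine cone over) a subset of projective space. -/
def coneIdeal (X : Set (ℙ K (σ → K))) : Ideal (MvPolynomial σ K) :=
  vanishingIdeal K (cone X)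

/-- The homogeneous coordinate ring. -/
abbrev CoordRing (X : Set (ℙ K (σ → K))) : Type _ := MvPolynomial σ K ⧸ coneIdeal X

/-- The Zariski closure of a subset of projective space. -/
def zariskiClosure (X : Set (ℙ K (σ → K))) : Set (ℙ K (σ → K)) :=
  {p | ∀ F ∈ coneIdeal X, eval p.rep F = 0}

/-- The Zariski closure of a subset of a product of two projective spaces. -/
def zariskiClosureProd (S : Set (ℙ K (σ → K) × ℙ K (τ → K))) :
    Set (ℙ K (σ → K) × ℙ K (τ → K)) :=
  {pq | ∀ G : MvPolynomial (σ ⊕ τ) K,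
    (∀ (v : σ → K) (w : τ → K) (hv : v ≠ 0) (hw : w ≠ 0),
      (Projectivization.mk K v hv, Projectivization.mk K w hw) ∈ S → eval (Sum.elim v w) G = 0) →
    eval (Sum.elim pq.1.rep pq.2.rep) G = 0}

/-- `X` has dimension `k` as a projective variety: the affine cone over `X` has dimension `k + 1`,
where the dimension of the cone is the transcendence degree over `K` of its coordinate ring.
The empty variety (whose cone is the origin) has dimension `-1`. -/
def HasProjDim (X : Set (ℙ K (σ → K))) (k : ℤ) : Prop :=
  ∃ r : ℕ, Algebra.trdeg K (CoordRing X) = (r : Cardinal) ∧ (r : ℤ) = k + 1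

/-- The Zariski tangent space at `p` of the affine cone over `X`, i.e. the linear subspace of
`K^σ` whose projectivization is the embedded projective tangent space of `X` at `p`. -/
def tangentSpace [Fintype σ] (X : Set (ℙ K (σ → K))) (p : ℙ K (σ → K)) :
    Submodule K (σ → K) where
  carrier := {w | ∀ F ∈ coneIdeal X, ∑ i, w i * eval p.rep (pderiv i F) = 0}
  zero_mem' := by intro F _; simp
  add_mem' := by
    intro a b ha hb F hF
    simp only [Pi.add_apply, add_mul, Finset.sum_add_distrib, ha F hF, hb F hF, add_zero]
  smul_mem' := by
    intro c a ha F hF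
    simp only [Pi.smul_apply, smul_eq_mul, mul_assoc, ← Finset.mul_sum, ha F hF, mul_zero]

/-- `p` is a smooth point of the (irreducible) variety `X`: the tangent space at `p` has the
dimension of `X`. -/
def IsSmoothPoint [Fintype σ] (X : Set (ℙ K (σ → K))) (p : ℙ K (σ → K)) : Prop :=
  p ∈ X ∧ (Module.finrank K (tangentSpace X p) : Cardinal) = Algebra.trdeg K (CoordRing X)

/-- The rational map with coordinates `φ` (forms of one and the same degree) is defined at `p`
and takes the value `q` there. -/
def RatMapsTo (φ : τ → MvPolynomial σ K) (p : ℙ K (σ → K)) (q : ℙ K (τ → K)) : Prop :=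
  ∃ h : (fun k => eval p.rep (φ k)) ≠ 0, Projectivization.mk K _ h = q

/-- The image of (the domain of definition in `X` of) a rational map. -/
def ratImage (X : Set (ℙ K (σ → K))) (φ : τ → MvPolynomial σ K) : Set (ℙ K (τ → K)) :=
  {q | ∃ p ∈ X, RatMapsTo φ p q}

/-- The fibre over `q` of a rational map on `X`. -/
def ratFibre (X : Set (ℙ K (σ → K))) (φ : τ → MvPolynomial σ K) (q : ℙ K (τ → K)) :
    Set (ℙ K (σ → K)) :=
  {p | p ∈ X ∧ RatMapsTo φ p q}

section Degree

variable (X : Set (ℙ K (σ → K))) [(coneIdeal X).IsPrime]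

/-- The function field of the affine cone over an irreducible projective variety. -/
abbrev ConeField : Type _ := FractionRing (CoordRing X)

/-- A polynomial, as a function on the affine cone. -/
def toConeField (F : MvPolynomial σ K) : ConeField X :=
  algebraMap (CoordRing X) (ConeField X) (Ideal.Quotient.mk (coneIdeal X) F)

/-- The subfield of the function field of the cone generated over `K` by the ratios `φ k / φ l`. -/
def ratioField (φ : τ → MvPolynomial σ K) : IntermediateField K (ConeField X) :=
  IntermediateField.adjoin K {z | ∃ k l, z = toConeField X (φ k) / toConeField X (φ l)}

/-- The function field `K(X)` of the irreducible projective variety `X`: it is generated by the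
ratios of the homogeneous coordinates. -/
def functionField : IntermediateField K (ConeField X) := ratioField X (fun i : σ => MvPolynomial.X i)

/-- The degree of the rational map given by `φ` from `X` onto the closure `Y` of its image: the
degree `[K(X) : K(Y)]`, where `K(Y)` is embedded in `K(X)` by pulling back functions, i.e. as the
field generated by the ratios of the coordinates of the map. It is `0` if this extension
is infinite. -/
def ratDegree (φ : τ → MvPolynomial σ K) : ℕ :=
  IntermediateField.relfinrank (ratioField X φ) (functionField X)

end Degree

/-- The free (abstract) join of the subvarieties `X i` of the projective spaces `ℙ (K^(τ i))`: it
lives in the projective space of the direct sum of the `K^(τ i)`, and it consists of the points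
all of whose components lie in the respective cones. -/
def freeJoin {ι : Type*} {τ : ι → Type*} (X : ∀ i, Set (ℙ K (τ i → K))) :
    Set (ℙ K ((Σ i, τ i) → K)) :=
  {p | ∀ i, (fun j => p.rep ⟨i, j⟩) ∈ cone (X i)}

end Projective

/-- The product `ℙ¹ × ℙ^k`, embedded in projective space by the line bundle `𝒪(e, 1)`, i.e. by all
monomials of bidegree `(e, 1)`. -/
def segreVeronese (K : Type*) [Field K] (e k : ℕ) : Set (ℙ K (Fin (e + 1) × Fin (k + 1) → K)) :=
  {p | ∃ (s t : K) (c : Fin (k + 1) → K)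
    (h : (fun ab : Fin (e + 1) × Fin (k + 1) => s ^ (ab.1 : ℕ) * t ^ (e - ab.1) * c ab.2) ≠ 0),
    p = Projectivization.mk K _ h}

/-! ### Multiple root loci and their duals -/

section Loci

variable {K : Type*} [Field K]

/-- The binary form `∑ (n choose i) a_i x^i y^(n-i)` with coordinates `a`. -/
def binaryForm (n : ℕ) (a : Fin (n + 1) → K) : MvPolynomial (Fin 2) K :=
  ∑ i : Fin (n + 1), C ((n.choose i : K) * a i) * X 0 ^ (i : ℕ) * X 1 ^ (n - i)

/-- The pairing `⟨f, g⟩ = (1/n!) g(∂/∂x, ∂/∂y) f` between binary forms of degree `n`, in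
coordinates. -/
def pairing (n : ℕ) (a b : Fin (n + 1) → K) : K :=
  ∑ i : Fin (n + 1), (n.choose i : K) * a i * b i

variable (K)

/-- The multiple root locus `Δ_λ ⊆ ℙⁿ`: the Zariski closure of the set of products
`∏ ℓ_i ^ λ_i` of linear forms. (This set is itself closed when `K` is algebraically closed.) -/
def multipleRootLocus (n : ℕ) {d : ℕ} (lam : Fin d → ℕ) : Set (ℙ K (Fin (n + 1) → K)) :=
  zariskiClosure {p | ∃ (a : Fin (n + 1) → K) (ha : a ≠ 0) (α β : Fin d → K),
    p = Projectivization.mk K a ha ∧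
    binaryForm n a = ∏ i, (C (α i) * X 0 + C (β i) * X 1) ^ lam i}

variable {K} in
/-- The conormal variety of `X ⊆ ℙⁿ`: the closure of the set of pairs `(f, g)` with `f` a smooth
point of `X` and `g` orthogonal to the tangent space at `f`. -/
def conormalVariety (n : ℕ) (X : Set (ℙ K (Fin (n + 1) → K))) :
    Set (ℙ K (Fin (n + 1) → K) × ℙ K (Fin (n + 1) → K)) :=
  zariskiClosureProd {fg | IsSmoothPoint X fg.1 ∧
    ∀ w ∈ tangentSpace X fg.1, pairing n w fg.2.rep = 0}

variable {K} in
/-- The dual variety: the projection of the conormal variety to the second factor. (It is closed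
when `K` is algebraically closed; in general we take the closure.) -/
def dualVariety (n : ℕ) (X : Set (ℙ K (Fin (n + 1) → K))) : Set (ℙ K (Fin (n + 1) → K)) :=
  zariskiClosure (Prod.snd '' conormalVariety n X)

/-- The indices of the parts of `λ` that are different from `1`. -/
abbrev BigPart {d : ℕ} (lam : Fin d → ℕ) : Type := {i : Fin d // lam i ≠ 1}

/-- Index set of the coordinates of the ambient space of `𝒥_λ`: the `i`-th block has the
coordinates `s^a t^(n - λ_i + 2 - a) c_b` of bidegree `(n - λ_i + 2, 1)` on `ℙ¹ × ℙ^(λ_i - 2)`. -/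
abbrev JIndex (n : ℕ) {d : ℕ} (lam : Fin d → ℕ) : Type :=
  Σ i : BigPart lam, Fin (n - lam i + 2 + 1) × Fin (lam i - 2 + 1)

/-- The parameter space `𝒥_λ`: the free join of the `ℙ¹ × ℙ^(λ_i - 2)` with `λ_i ≠ 1`. -/
def paramSpace (n : ℕ) {d : ℕ} (lam : Fin d → ℕ) : Set (ℙ K (JIndex n lam → K)) :=
  freeJoin (fun i : BigPart lam => segreVeronese K (n - lam i + 2) (lam i - 2))

variable {K} in
/-- The coordinate vector of the point of (the cone over) `𝒥_λ` given by the points `(s_i, t_i)`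
and the forms `g_i = binaryForm (λ_i - 2) (c i)`. -/
def paramPoint (n : ℕ) {d : ℕ} (lam : Fin d → ℕ) (s t : BigPart lam → K)
    (c : ∀ i : BigPart lam, Fin (lam i - 2 + 1) → K) : JIndex n lam → K :=
  fun j => s j.1 ^ (j.2.1 : ℕ) * t j.1 ^ (n - lam j.1 + 2 - j.2.1) * c j.1 j.2.2

/-- The coordinates of the rational map `𝒥_λ ⇢ ℙⁿ` that sends the point with components
`((s_i : t_i), g_i)` to `g = ∑ (s_i u + t_i v) ^ (n - λ_i + 2) g_i`. They are linear forms: the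
`k`-th one is the coefficient of `u^k v^(n-k)` in `g`, divided by `n choose k`. -/
def paramMap (n : ℕ) {d : ℕ} (lam : Fin d → ℕ) (k : Fin (n + 1)) :
    MvPolynomial (JIndex n lam) K :=
  C ((n.choose k : K)⁻¹) * ∑ j : JIndex n lam,
    if (j.2.1 : ℕ) + (j.2.2 : ℕ) = k then
      C (((n - lam j.1 + 2).choose j.2.1 : K) * ((lam j.1 - 2).choose j.2.2 : K)) * X j
    else 0

/-! The parameter space is irreducible. -/

theorem cone_paramSpace (n : ℕ) {d : ℕ} (lam : Fin d → ℕ) :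
    cone (paramSpace K n lam) = {v | ∃ s t c, v = paramPoint n lam s t c} := by
  ext v
  constructor
  · intro hv
    by_cases h0 : v = 0
    · refine ⟨0, 0, fun _ => 0, ?_⟩
      subst h0; funext j; simp [paramPoint]
    have h1 := hv h0
    obtain ⟨r, hr⟩ := Projectivization.exists_smul_eq_mk_rep K v h0
    have key : ∀ i : BigPart lam, ∃ (s t : K) (c : Fin (lam i - 2 + 1) → K),
        ∀ ab : Fin (n - lam i + 2 + 1) × Fin (lam i - 2 + 1),
          v ⟨i, ab⟩ = s ^ (ab.1 : ℕ) * t ^ (n - lam i + 2 - ab.1) * c ab.2 := by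
      intro i
      have h2 := h1 i
      rw [← hr] at h2
      by_cases hz : (fun ab => (r • v) ⟨i, ab⟩) = 0
      · refine ⟨0, 0, 0, fun ab => ?_⟩
        have := congrFun hz ab
        simp only [Pi.smul_apply, Pi.zero_apply, smul_eq_zero_iff_eq] at this
        simp [this]
      · obtain ⟨s, t, c, h, hp⟩ := h2 hz
        rw [Projectivization.mk_eq_mk_iff] at hp
        obtain ⟨a, ha⟩ := hp
        refine ⟨s, t, fun b => ((r⁻¹ * a : Kˣ) : K) * c b, fun ab => ?_⟩
        have := congrFun ha ab
        simp only [Pi.smul_apply, Units.smul_def, smul_eq_mul] at this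
        have hr0 : (r : K) ≠ 0 := r.ne_zero
        have h3 : v ⟨i, ab⟩ = (r : K)⁻¹ * ((r : K) * v ⟨i, ab⟩) := by field_simp
        rw [h3, ← this]
        push_cast
        ring
    choose s t c h using key
    exact ⟨s, t, c, funext fun j => h j.1 j.2⟩
  · rintro ⟨s, t, c, rfl⟩ h0 i hz
    obtain ⟨r, hr⟩ := Projectivization.exists_smul_eq_mk_rep K _ h0
    have e : (fun j => (Projectivization.mk K _ h0).rep ⟨i, j⟩) =
        fun ab : Fin (n - lam i + 2 + 1) × Fin (lam i - 2 + 1) =>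
          s i ^ (ab.1 : ℕ) * t i ^ (n - lam i + 2 - ab.1) * ((r : K) * c i ab.2) := by
      funext ab
      rw [← hr]
      simp only [paramPoint, Pi.smul_apply, Units.smul_def, smul_eq_mul]
      ring
    refine ⟨s i, t i, fun b => (r : K) * c i b, ?_, ?_⟩
    · exact e ▸ hz
    · congr 1

instance coneIdeal_paramSpace_isPrime [CharZero K] (n : ℕ) {d : ℕ} (lam : Fin d → ℕ) :
    (coneIdeal (paramSpace K n lam)).IsPrime := by
  let P := BigPart lam ⊕ BigPart lam ⊕ (Σ i : BigPart lam, Fin (lam i - 2 + 1))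
  let ψ : MvPolynomial (JIndex n lam) K →ₐ[K] MvPolynomial P K :=
    aeval fun j => X (Sum.inl j.1) ^ (j.2.1 : ℕ) * X (Sum.inr (Sum.inl j.1)) ^
      (n - lam j.1 + 2 - j.2.1) * X (Sum.inr (Sum.inr ⟨j.1, j.2.2⟩))
  have hψ : ∀ (F : MvPolynomial (JIndex n lam) K) (z : P → K), eval z (ψ F) =
      aeval (paramPoint n lam (fun i => z (Sum.inl i)) (fun i => z (Sum.inr (Sum.inl i)))
        (fun i b => z (Sum.inr (Sum.inr ⟨i, b⟩)))) F := by
    intro F z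
    have : (aeval z).comp ψ = aeval (paramPoint n lam (fun i => z (Sum.inl i))
        (fun i => z (Sum.inr (Sum.inl i))) (fun i b => z (Sum.inr (Sum.inr ⟨i, b⟩)))) := by
      ext j
      simp [ψ, paramPoint]
    rw [← this]
    simp [aeval_eq_eval]
  have hI : coneIdeal (paramSpace K n lam) = RingHom.ker ψ := by
    ext F
    rw [coneIdeal, mem_vanishingIdeal_iff, cone_paramSpace, RingHom.mem_ker]
    constructor
    · intro h
      apply MvPolynomial.funext
      intro z
      rw [hψ, map_zero]
      exact h _ ⟨_, _, _, rfl⟩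
    · rintro h v ⟨s, t, c, rfl⟩
      have := hψ F (Sum.elim s (Sum.elim t fun p => c p.1 p.2))
      rw [h, map_zero] at this
      exact this.symm
  rw [hI]
  exact RingHom.ker_isPrime ψ

end Loci

end BinaryForms

end

open BinaryForms

/-!
Dehomogenize by `y = 1`, so that a form `g` of degree `n` becomes the linear functional
`f ↦ ⟨f, g⟩` on the polynomials of degree at most `n`. The tangent space of `Δ_λ` at a general point
`f = a ∏ (X - z_i) ^ λ_i` consists of the multiples, of degree at most `n`, of the cofactor
`∏ (X - z_i) ^ (λ_i - 1)` (`toPoly_pderiv_productCoord`, `exists_smooth`, `eq_zero_of_nodal`).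
By Hermite interpolation a functional annihilates these multiples if and only if it is a combination
`p ↦ ∑ c_{i,j} p⁽ʲ⁾(z_i)`, where `λ_i ≠ 1` and `j < λ_i - 1` (`exists_functional_eq_sum`). The
vector of moments of such a functional is exactly a generalized additive decomposition, since the
functionals supported at `z_i` correspond to the forms `(z_i u + v) ^ (n - λ_i + 2) g_i`
(`aeval_paramMap_block`). So a polynomial vanishes on the dual variety if and only if it vanishes
on the generic moments, which is also the condition for vanishing on the image of the rational map
(`mem_coneIdeal_ratImage`, `mem_coneIdeal_dualVariety`).

One inclusion between the two closures has to deal with special smooth points `f`: a covector at `f`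
that annihilates the tangent space is the gradient at `f` of an equation `F` of `Δ_λ`, and at a
general point of `Δ_λ` the gradient of `F` is a vector of moments. Hence the equations of the image
of the rational map, composed with the gradient of `F`, vanish on all of `Δ_λ`, and in particular
at `f` (`mem_zariskiClosure_ratImage`).

A derivation turns a functional of order `r_i = λ_i - 1` at the node `x_i` into one of
order `r_i + 1` at the same node (`derivation_moment`), and since `∑ (r_i + 1) ≤ n`,
such functionals are determined by their moments. So a derivation that kills the moments kills the
nodes and the coefficients; therefore the parameters are separable algebraic over the moments
(`isSeparable_of_moment_mem`). This gives the dimension and the finiteness of the general fibre.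

The degree is the number of conjugates of the generic parameters over the field generated by the
ratios of the moments. If a conjugate has nodes `x'_i`, then the tangent directions of both
decompositions coincide; by duality `(X - x_i) ^ (r_i + 1)` divides `∏ (X - x'_i) ^ (r_i + 1)`
(`pow_dvd_of_moment_eq`), so the conjugate permutes the nodes and preserves the orders. Conversely
every such permutation is induced by an automorphism (`permEmb`), and there are `∏ m_j!`
of them, the product being over `j ≥ 2`.
-/

noncomputable section

namespace BinaryForms

/-! ### Functionals supported at finitely many nodes, and their moments -/

open Polynomial in
/-- The linear functional on univariate polynomials whose value at `X ^ k` is `b k` for `k ≤ n`,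
and `0` for `k > n`. -/
def contraction {L : Type*} [Field L] {n : ℕ} (b : Fin (n + 1) → L) : L[X] →ₗ[L] L :=
  ∑ k : Fin (n + 1), b k • Polynomial.lcoeff L k

/-- The `k`-th moment of the functional `p ↦ ∑ i, ∑ j < r i, c i j * p⁽ʲ⁾(x i)`, that is, its value
at `X ^ k`. -/
def moment {A I : Type*} [CommRing A] [Fintype I] (r : I → ℕ) (x : I → A) (c : I → ℕ → A)
    (k : ℕ) : A :=
  ∑ i, ∑ j ∈ Finset.range (r i), c i j * (k.descFactorial j * x i ^ (k - j))

section Moments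

variable {A I : Type*} [CommRing A] [Fintype I]

theorem moment_congr {r : I → ℕ} {x : I → A} {c c' : I → ℕ → A}
    (h : ∀ i, ∀ j < r i, c i j = c' i j) (k : ℕ) : moment r x c k = moment r x c' k :=
  Finset.sum_congr rfl fun i _ => Finset.sum_congr rfl fun j hj => by
    rw [h i j (Finset.mem_range.1 hj)]

theorem map_moment {B : Type*} [CommRing B] (f : A →+* B) (r : I → ℕ) (x : I → A)
    (c : I → ℕ → A) (k : ℕ) :
    f (moment r x c k) = moment r (fun i => f (x i)) (fun i j => f (c i j)) k := by
  simp [moment, map_sum]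

theorem moment_zero (r : I → ℕ) (x : I → A) (c : I → ℕ → A) (hr : ∀ i, 1 ≤ r i) :
    moment r x c 0 = ∑ i, c i 0 := by
  refine Finset.sum_congr rfl fun i _ => ?_
  rw [Finset.sum_eq_single_of_mem 0 (Finset.mem_range.2 (hr i))]
  · simp
  · intro j _ hj
    obtain ⟨j, rfl⟩ := Nat.exists_eq_succ_of_ne_zero hj
    simp

theorem moment_mul_left (r : I → ℕ) (x : I → A) (c : I → ℕ → A) (a : A) (k : ℕ) :
    moment r x (fun i j => a * c i j) k = a * moment r x c k := by
  simp [moment, Finset.mul_sum, mul_assoc]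

theorem moment_add (r : I → ℕ) (x : I → A) (c c' : I → ℕ → A) (k : ℕ) :
    moment r x (fun i j => c i j + c' i j) k = moment r x c k + moment r x c' k := by
  simp [moment, Finset.sum_add_distrib, add_mul]

theorem moment_reindex (r : I → ℕ) (x : I → A) (c : I → ℕ → A) (π : Equiv.Perm I)
    (hπ : ∀ i, r (π i) = r i) (k : ℕ) :
    moment r (fun i => x (π i)) (fun i => c (π i)) k = moment r x c k := by
  conv_rhs => rw [moment, ← Equiv.sum_comp π]
  simp [moment, hπ]

theorem moment_succ (r : I → ℕ) (x : I → A) (c : I → ℕ → A) (k : ℕ) :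
    moment (fun i => r i + 1) x (fun i j => if j < r i then c i j else 0) k = moment r x c k := by
  refine Finset.sum_congr rfl fun i _ => ?_
  rw [Finset.sum_range_succ]
  simp only [lt_irrefl, if_false, zero_mul, add_zero]
  exact Finset.sum_congr rfl fun j hj => by rw [if_pos (Finset.mem_range.1 hj)]

/-- The derivative of a functional of order `r i` at `x i` is a functional of order `r i + 1` at
`x i`: the derivative of `x i` moves the coefficient of `p⁽ʲ⁾(x i)`
to that of `p⁽ʲ⁺¹⁾(x i)`. -/
theorem derivation_moment {R : Type*} [CommRing R] [Algebra R A] (D : Derivation R A A)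
    (r : I → ℕ) (x : I → A) (c : I → ℕ → A) (k : ℕ) :
    D (moment r x c k) = moment (fun i => r i + 1) x
      (fun i j => (if j < r i then D (c i j) else 0) +
        (if j = 0 then 0 else c i (j - 1) * D (x i))) k := by
  rw [moment_add, moment_succ, moment, moment, moment, ← Finset.sum_add_distrib, map_sum]
  refine Finset.sum_congr rfl fun i _ => ?_
  rw [Finset.sum_range_succ' (n := r i)]
  simp only [if_true, zero_mul, add_zero, Nat.succ_ne_zero, if_false, Nat.add_sub_cancel]
  rw [map_sum, ← Finset.sum_add_distrib]
  refine Finset.sum_congr rfl fun j _ => ?_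
  rw [Derivation.leibniz, Derivation.leibniz, Derivation.leibniz_pow, Derivation.map_natCast,
    Nat.descFactorial_succ, Nat.sub_sub]
  simp only [smul_eq_mul, nsmul_eq_mul]
  push_cast
  ring

end Moments

section Hermite

open Polynomial

variable {L I : Type*} [Field L] [Fintype I]

theorem contraction_apply {n : ℕ} (b : Fin (n + 1) → L) (p : L[X]) :
    contraction b p = ∑ k : Fin (n + 1), p.coeff k * b k := by
  simp [contraction, mul_comm]

theorem sum_derivative_eval_X_pow (r : I → ℕ) (x : I → L) (c : I → ℕ → L) (k : ℕ) :
    ∑ i, ∑ j ∈ Finset.range (r i), c i j * (derivative^[j] (X ^ k : L[X])).eval (x i) =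
      moment r x c k := by
  simp [moment, iterate_derivative_X_pow_eq_natCast_mul]

theorem contraction_moment {n : ℕ} (r : I → ℕ) (x : I → L) (c : I → ℕ → L) {p : L[X]}
    (hp : p.natDegree ≤ n) :
    contraction (fun k : Fin (n + 1) => moment r x c k) p =
      ∑ i, ∑ j ∈ Finset.range (r i), c i j * (derivative^[j] p).eval (x i) := by
  rw [contraction_apply, Fin.sum_univ_eq_sum_range (fun k => p.coeff k * moment r x c k)]
  conv_rhs => rw [p.as_sum_range' (n + 1) (by omega)]
  simp only [iterate_derivative_sum, eval_finsetSum, Finset.mul_sum]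
  simp_rw [Finset.sum_comm (t := Finset.range (n + 1))]
  refine Finset.sum_congr rfl fun k _ => ?_
  rw [← sum_derivative_eval_X_pow, Finset.mul_sum]
  refine Finset.sum_congr rfl fun i _ => ?_
  rw [Finset.mul_sum]
  refine Finset.sum_congr rfl fun j _ => ?_
  rw [← C_mul_X_pow_eq_monomial, iterate_derivative_C_mul, eval_C_mul]
  ring

variable [CharZero L]

theorem pow_dvd_iff_derivative_eval (p : L[X]) (a : L) (r : ℕ) :
    (X - C a) ^ r ∣ p ↔ ∀ j < r, (derivative^[j] p).eval a = 0 := by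
  rcases eq_or_ne p 0 with rfl | hp
  · simp
  rcases r with _ | r
  · simp
  rw [← le_rootMultiplicity_iff hp, Nat.succ_le_iff,
    lt_rootMultiplicity_iff_isRoot_iterate_derivative hp]
  simp [IsRoot]

theorem prod_dvd_of_derivative_eval {x : I → L} (hx : Function.Injective x) (r : I → ℕ) (p : L[X])
    (h : ∀ i, ∀ j < r i, (derivative^[j] p).eval (x i) = 0) :
    ∏ i, (X - C (x i)) ^ r i ∣ p :=
  Finset.prod_dvd_of_coprime
    (fun _ _ _ _ hij => (IsCoprime.pow (pairwise_coprime_X_sub_C hx hij)))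
    fun i _ => (pow_dvd_iff_derivative_eval p _ _).2 (h i)

theorem natDegree_prod_X_sub_C_pow {J R : Type*} [CommRing R] [Nontrivial R] [Fintype J]
    (x : J → R) (r : J → ℕ) :
    (∏ i, (X - C (x i)) ^ r i).natDegree = ∑ i, r i := by
  rw [natDegree_prod_of_monic _ _ fun i _ => (monic_X_sub_C _).pow _]
  exact Finset.sum_congr rfl fun i _ => by rw [(monic_X_sub_C (x i)).natDegree_pow]; simp

theorem monic_prod_X_sub_C_pow {J R : Type*} [CommRing R] [Fintype J] (x : J → R) (r : J → ℕ) :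
    (∏ i, (X - C (x i)) ^ r i).Monic :=
  monic_prod_of_monic _ _ fun _ _ => (monic_X_sub_C _).pow _

/-- Hermite interpolation: a polynomial of degree less than `∑ r i` is determined by its first
`r i` derivatives at the distinct nodes `x i`, and these can be prescribed. -/
theorem exists_hermiteEquiv {x : I → L} (hx : Function.Injective x) (r : I → ℕ) :
    ∃ e : degreeLT L (∑ i, r i) ≃ₗ[L] ((Σ i, Fin (r i)) → L),
      ∀ p ij, e p ij = (derivative^[(ij.2 : ℕ)] (p : L[X])).eval (x ij.1) := by
  let f : degreeLT L (∑ i, r i) →ₗ[L] ((Σ i, Fin (r i)) → L) :=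
    LinearMap.pi fun ij => (leval (x ij.1)).comp
      ((derivative ^ (ij.2 : ℕ) : L[X] →ₗ[L] L[X]).comp (Submodule.subtype _))
  have hf : ∀ p ij, f p ij = (derivative^[(ij.2 : ℕ)] (p : L[X])).eval (x ij.1) := by
    intro p ij
    simp [f, Module.End.pow_apply, leval]
  have hinj : Function.Injective f := by
    rw [injective_iff_map_eq_zero]
    rintro ⟨p, hp⟩ h0
    have hd : ∏ i, (X - C (x i)) ^ r i ∣ p := by
      refine prod_dvd_of_derivative_eval hx r p fun i j hj => ?_
      rw [← hf ⟨p, hp⟩ ⟨i, ⟨j, hj⟩⟩, h0]; rfl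
    have : p = 0 := by
      refine eq_zero_of_dvd_of_degree_lt hd ?_
      rw [degree_eq_natDegree (monic_prod_X_sub_C_pow x r).ne_zero, natDegree_prod_X_sub_C_pow]
      exact mem_degreeLT.1 hp
    exact Subtype.ext this
  have hfr : Module.finrank L (degreeLT L (∑ i, r i)) =
      Module.finrank L ((Σ i, Fin (r i)) → L) := by
    rw [(degreeLTEquiv L _).finrank_eq]
    simp
  have : FiniteDimensional L (degreeLT L (∑ i, r i)) :=
    Module.Finite.equiv (degreeLTEquiv L _).symm
  exact ⟨LinearEquiv.ofInjectiveOfFinrankEq f hinj hfr, fun p ij => hf p ij⟩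

theorem exists_hermite_interpolation {x : I → L} (hx : Function.Injective x) (r : I → ℕ)
    (v : I → ℕ → L) : ∃ p : L[X], p.degree < (∑ i, r i : ℕ) ∧
      ∀ i, ∀ j < r i, (derivative^[j] p).eval (x i) = v i j := by
  obtain ⟨e, he⟩ := exists_hermiteEquiv hx r
  refine ⟨e.symm fun ij => v ij.1 ij.2, mem_degreeLT.1 (e.symm _).2, fun i j hj => ?_⟩
  rw [← he (e.symm fun ij => v ij.1 ij.2) ⟨i, ⟨j, hj⟩⟩, e.apply_symm_apply]

/-- A functional that vanishes on the multiples of `∏ (X - x i) ^ r i` is a combination of the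
evaluations of the first `r i` derivatives at the `x i`. -/
theorem exists_functional_eq_sum {x : I → L} (hx : Function.Injective x) (r : I → ℕ) {n : ℕ}
    (Λ : L[X] →ₗ[L] L)
    (hΛ : ∀ q : L[X], ((∏ i, (X - C (x i)) ^ r i) * q).natDegree ≤ n →
      Λ ((∏ i, (X - C (x i)) ^ r i) * q) = 0) :
    ∃ c : I → ℕ → L, ∀ p : L[X], p.natDegree ≤ n →
      Λ p = ∑ i, ∑ j ∈ Finset.range (r i), c i j * (derivative^[j] p).eval (x i) := by
  classical
  obtain ⟨e, he⟩ := exists_hermiteEquiv hx r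
  set h := ∏ i, (X - C (x i)) ^ r i with hh
  have hm : h.Monic := monic_prod_X_sub_C_pow x r
  have hdeg : h.natDegree = ∑ i, r i := natDegree_prod_X_sub_C_pow x r
  let M : ((Σ i, Fin (r i)) → L) →ₗ[L] L := Λ.comp ((Submodule.subtype _).comp e.symm.toLinearMap)
  refine ⟨fun i j => if hj : j < r i then M (Pi.single ⟨i, ⟨j, hj⟩⟩ 1) else 0, fun p hp => ?_⟩
  have hmod : p %ₘ h ∈ degreeLT L (∑ i, r i) := by
    rw [mem_degreeLT, ← hdeg, ← degree_eq_natDegree hm.ne_zero]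
    exact degree_modByMonic_lt _ hm
  have hpq : p = p %ₘ h + h * (p /ₘ h) := (modByMonic_add_div p h).symm
  have hq : (h * (p /ₘ h)).natDegree ≤ n := by
    by_cases hz : p /ₘ h = 0
    · simp [hz]
    rw [hm.natDegree_mul' hz, natDegree_divByMonic _ hm]
    have : h.natDegree ≤ p.natDegree := by
      by_contra hlt
      exact hz ((divByMonic_eq_zero_iff hm).2 (degree_lt_degree (by omega)))
    omega
  have h1 : Λ p = M (e ⟨_, hmod⟩) := by
    conv_lhs => rw [hpq]
    rw [map_add, hΛ _ hq, add_zero]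
    simp [M]
  have h2 : ∀ i, ∀ j < r i, (derivative^[j] p).eval (x i) =
      (derivative^[j] (p %ₘ h)).eval (x i) := by
    intro i j hj
    conv_lhs => rw [hpq]
    have h4 : (derivative^[j] (h * (p /ₘ h))).eval (x i) = 0 := by
      have hd : (X - C (x i)) ^ r i ∣ h :=
        Finset.dvd_prod_of_mem (fun i => (X - C (x i)) ^ r i) (Finset.mem_univ i)
      exact (pow_dvd_iff_derivative_eval _ _ _).1 (hd.mul_right (p /ₘ h)) j hj
    rw [iterate_map_add, eval_add, h4, add_zero]
  rw [h1]
  have h3 : e ⟨_, hmod⟩ = ∑ ij : (Σ i, Fin (r i)),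
      (derivative^[(ij.2 : ℕ)] p).eval (x ij.1) • Pi.single ij (1 : L) := by
    ext ij
    rw [he, Finset.sum_apply, Finset.sum_eq_single ij]
    · simp [h2 ij.1 ij.2 ij.2.2]
    · intro b _ hb
      simp [hb.symm]
    · simp
  rw [h3, map_sum, Fintype.sum_sigma]
  refine Finset.sum_congr rfl fun i _ => ?_
  rw [← Fin.sum_univ_eq_sum_range (fun j => (if hj : j < r i then M (Pi.single ⟨i, ⟨j, hj⟩⟩ 1)
    else 0) * (derivative^[j] p).eval (x i))]
  refine Finset.sum_congr rfl fun j _ => ?_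
  simp [mul_comm]

/-- At distinct nodes, the coefficients of a functional are determined by its moments. -/
theorem coeff_eq_of_moment_eq {x : I → L} (hx : Function.Injective x) {r : I → ℕ} {n : ℕ}
    (hr : ∑ i, r i ≤ n + 1) {c c' : I → ℕ → L}
    (h : ∀ k ≤ n, moment r x c k = moment r x c' k) (i : I) (j : ℕ) (hj : j < r i) :
    c i j = c' i j := by
  classical
  obtain ⟨p, hp, hv⟩ := exists_hermite_interpolation hx r
    (fun i' j' => if i' = i ∧ j' = j then 1 else 0)
  have hpn : p.natDegree ≤ n := by
    by_cases h0 : p = 0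
    · simp [h0]
    have := (natDegree_lt_iff_degree_lt h0).2 hp
    omega
  have key : ∀ c : I → ℕ → L, contraction (fun k : Fin (n + 1) => moment r x c k) p = c i j := by
    intro c
    rw [contraction_moment r x c hpn, Finset.sum_eq_single i]
    · rw [Finset.sum_eq_single_of_mem j (Finset.mem_range.2 hj)]
      · simp [hv i j hj]
      · intro j' hj' hne
        simp [hv i j' (Finset.mem_range.1 hj'), hne]
    · intro i' _ hne
      refine Finset.sum_eq_zero fun j' hj' => ?_
      simp [hv i' j' (Finset.mem_range.1 hj'), hne]
    · simp
  rw [← key c, ← key c']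
  congr 2
  funext k
  exact h k (by omega)

end Hermite

/-! ### Derivations and conjugates of functionals -/

section Derivations

theorem derivation_aeval {R A N σ : Type*} [CommRing R] [CommRing A] [Algebra R A]
    [AddCommGroup N] [Module A N] [Module R N] [IsScalarTower R A N] [Fintype σ]
    (D : Derivation R A N) (f : σ → A) (F : MvPolynomial σ R) :
    D (MvPolynomial.aeval f F) =
      ∑ k, MvPolynomial.aeval f (MvPolynomial.pderiv k F) • D (f k) := by
  classical
  induction F using MvPolynomial.induction_on with
  | C a => simp
  | add p q hp hq => simp [hp, hq, add_smul, Finset.sum_add_distrib]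
  | mul_X p i hp =>
    simp only [map_mul, MvPolynomial.aeval_X, Derivation.leibniz, hp, MvPolynomial.pderiv_X,
      smul_eq_mul, map_add, add_smul, Finset.sum_add_distrib, Finset.smul_sum, mul_smul]
    congr 1
    rw [Finset.sum_eq_single i]
    · simp
    · intro j _ hj
      simp [hj.symm]
    · simp

/-- Derivations extend uniquely along formally étale extensions; here only existence is needed. -/
theorem exists_derivation_extension {K P Ω : Type*} [CommRing K] [CommRing P] [CommRing Ω]
    [Algebra K P] [Algebra K Ω] [Algebra P Ω] [IsScalarTower K P Ω] [Algebra.FormallyEtale P Ω]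
    (D₀ : Derivation K P Ω) : ∃ D : Derivation K Ω Ω, ∀ p, D (algebraMap P Ω p) = D₀ p := by
  let φ : TensorProduct P Ω (Ω[P⁄K]) →ₗ[Ω] Ω :=
    (TensorProduct.AlgebraTensorModule.lift
      ((LinearMap.lsmul Ω (Ω[P⁄K] →ₗ[P] Ω)).flip D₀.liftKaehlerDifferential))
  let e := KaehlerDifferential.tensorKaehlerEquivOfFormallyEtale K P Ω
  refine ⟨(φ.comp e.symm.toLinearMap).compDer (KaehlerDifferential.D K Ω), fun p => ?_⟩
  have : e.symm (KaehlerDifferential.D K Ω (algebraMap P Ω p)) =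
      1 ⊗ₜ KaehlerDifferential.D K P p :=
    KaehlerDifferential.tensorKaehlerEquivOfFormallyEtale_symm_D_algebraMap K P Ω p
  simp [this, φ]

theorem derivation_eq_zero_of_adjoin {F L : Type*} [Field F] [Field L] [Algebra F L] {S : Set L}
    (hS : IntermediateField.adjoin F S = ⊤) (D : Derivation F L L) (h : ∀ s ∈ S, D s = 0) :
    D = 0 := by
  ext z
  have hz : z ∈ IntermediateField.adjoin F S := hS ▸ IntermediateField.mem_top
  induction hz using IntermediateField.adjoin_induction with
  | mem s hs => exact h s hs
  | algebraMap a => simp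
  | add a b _ _ ha hb => simp [show D a = 0 from ha, show D b = 0 from hb]
  | inv a _ ha => simp [Derivation.leibniz_inv, show D a = 0 from ha]
  | mul a b _ _ ha hb =>
    simp [Derivation.leibniz, show D a = 0 from ha, show D b = 0 from hb]

end Derivations

section Conjugates

open Polynomial

variable {I : Type*} [Fintype I]

/-- A field generated by the nodes and coefficients of a functional is separable (and algebraic)
over any subfield that contains sufficiently many moments, because a derivation that kills the
moments kills the nodes and the coefficients. -/
theorem isSeparable_of_moment_mem {F L : Type*} [Field F] [Field L] [CharZero L] [Algebra F L]
    {n : ℕ} {r : I → ℕ} (hr : ∑ i, (r i + 1) ≤ n + 1) (hr1 : ∀ i, 1 ≤ r i) {x : I → L}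
    (hx : Function.Injective x) {c : I → ℕ → L} (hc : ∀ i, c i (r i - 1) ≠ 0)
    (hγ : ∀ k ≤ n, ∃ a, algebraMap F L a = moment r x c k)
    (hgen : IntermediateField.adjoin F (Set.range x ∪ {z | ∃ i, ∃ j < r i, z = c i j}) = ⊤) :
    Algebra.IsSeparable F L := by
  classical
  have hfin : (Set.range x ∪ {z | ∃ i, ∃ j < r i, z = c i j}).Finite := by
    refine (Set.finite_range x).union ?_
    refine (Set.finite_range fun ij : Σ i, Fin (r i) => c ij.1 ij.2).subset ?_
    rintro _ ⟨i, j, hj, rfl⟩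
    exact ⟨⟨i, ⟨j, hj⟩⟩, rfl⟩
  have : Algebra.EssFiniteType F L := by
    rw [← IntermediateField.fg_top_iff]
    exact ⟨hfin.toFinset, by simpa using hgen⟩
  rw [← Algebra.FormallyUnramified.iff_isSeparable, Algebra.formallyUnramified_iff]
  refine ⟨fun a b => ?_⟩
  rw [← sub_eq_zero, ← Module.forall_dual_apply_eq_zero_iff L]
  intro φ
  have hD : ∀ D : Derivation F L L, D = 0 := by
    intro D
    have key : ∀ k ≤ n, moment (fun i => r i + 1) x
        (fun i j => (if j < r i then D (c i j) else 0) +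
          (if j = 0 then 0 else c i (j - 1) * D (x i))) k =
        moment (fun i => r i + 1) x (fun _ _ => 0) k := by
      intro k hk
      obtain ⟨a, ha⟩ := hγ k hk
      rw [← derivation_moment, ← ha]
      simp [moment]
    have key2 := coeff_eq_of_moment_eq hx hr key
    have hDx : ∀ i, D (x i) = 0 := by
      intro i
      have h := key2 i (r i) (Nat.lt_succ_self _)
      have h1 := hr1 i
      simpa [show r i ≠ 0 by omega, hc i] using h
    refine derivation_eq_zero_of_adjoin hgen D ?_
    rintro s (⟨i, rfl⟩ | ⟨i, j, hj, rfl⟩)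
    · exact hDx i
    · have h := key2 i j (by omega)
      simpa [hj, hDx] using h
  have h0 : φ.compDer (KaehlerDifferential.D F L) = 0 := hD _
  have h1 : φ = 0 := by
    apply Derivation.liftKaehlerDifferential_unique
    rw [h0]
    ext; simp
  simp [h1]

/-- If the functionals with nodes `x` and coefficients `c` move in all directions while they keep
being functionals with nodes `x'`, then the tangent directions of the first kind
are among those of the second kind. By duality this is a divisibility. -/
theorem pow_dvd_of_moment_eq {K Ω : Type*} [Field K] [Field Ω] [CharZero Ω] [Algebra K Ω]
    {n : ℕ} {r : I → ℕ} (hr : ∑ i, (r i + 1) ≤ n) (hr1 : ∀ i, 1 ≤ r i) {x x' : I → Ω}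
    {c c' : I → ℕ → Ω} (hc : ∀ i, c i (r i - 1) ≠ 0)
    (h : ∀ k ≤ n, moment r x c k = moment r x' c' k)
    (hD : ∀ (a : I → Ω) (b : I → ℕ → Ω), ∃ D : Derivation K Ω Ω, (∀ i, D (x i) = a i) ∧
      ∀ i, ∀ j < r i, D (c i j) = b i j) (i : I) :
    (X - C (x i)) ^ (r i + 1) ∣ ∏ i, (X - C (x' i)) ^ (r i + 1) := by
  classical
  rw [pow_dvd_iff_derivative_eval]
  intro j hj
  set P := ∏ i, (X - C (x' i)) ^ (r i + 1) with hP
  have hPn : P.natDegree ≤ n := (natDegree_prod_X_sub_C_pow x' _).trans_le hr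
  let t : I → ℕ → Ω := fun i' j' => if i' = i ∧ j' = j then 1 else 0
  -- the derivation is chosen so that the derivative of the functional is `p ↦ p⁽ʲ⁾(x i)`
  obtain ⟨D, hDx, hDc⟩ := hD (fun i => t i (r i) / c i (r i - 1))
    (fun i j => t i j - if j = 0 then 0 else c i (j - 1) * (t i (r i) / c i (r i - 1)))
  have h1 : ∀ k ≤ n, moment (fun i => r i + 1) x t k = moment (fun i => r i + 1) x'
      (fun i j => (if j < r i then D (c' i j) else 0) +
        (if j = 0 then 0 else c' i (j - 1) * D (x' i))) k := by
    intro k hk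
    rw [← derivation_moment, ← h k hk, derivation_moment]
    refine moment_congr (fun i' j' hj' => ?_) k
    rcases Nat.lt_succ_iff_lt_or_eq.1 hj' with hlt | rfl
    · simp [hlt, hDc i' j' hlt, hDx]
    · have := hr1 i'
      simp [show r i' ≠ 0 by omega, hDx, mul_div_cancel₀ _ (hc i')]
  have h2 := contraction_moment (fun i => r i + 1) x t hPn
  have h3 := contraction_moment (fun i => r i + 1) x'
      (fun i j => (if j < r i then D (c' i j) else 0) +
        (if j = 0 then 0 else c' i (j - 1) * D (x' i))) hPn
  have h4 : (fun k : Fin (n + 1) => moment (fun i => r i + 1) x t k) = fun k : Fin (n + 1) =>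
      moment (fun i => r i + 1) x' (fun i j => (if j < r i then D (c' i j) else 0) +
        (if j = 0 then 0 else c' i (j - 1) * D (x' i))) k := by
    funext k; exact h1 k (by omega)
  rw [h4, h3] at h2
  have h5 : ∑ i', ∑ j' ∈ Finset.range (r i' + 1), t i' j' * (derivative^[j'] P).eval (x i') =
      (derivative^[j] P).eval (x i) := by
    rw [Finset.sum_eq_single i]
    · rw [Finset.sum_eq_single_of_mem j (Finset.mem_range.2 hj)]
      · simp [t]
      · intro j' _ hne
        simp [t, hne]
    · intro i' _ hne
      exact Finset.sum_eq_zero fun j' _ => by simp [t, hne]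
    · simp
  rw [← h5, ← h2]
  refine Finset.sum_eq_zero fun i' _ => Finset.sum_eq_zero fun j' hj' => ?_
  rw [(pow_dvd_iff_derivative_eval P (x' i') (r i' + 1)).1
    (Finset.dvd_prod_of_mem _ (Finset.mem_univ i')) j' (Finset.mem_range.1 hj'), mul_zero]

/-- Every node of the first family occurs in the second one with at least the same multiplicity;
the multiplicities agree since they have the same sum. -/
theorem exists_perm_of_pow_dvd {Ω : Type*} [Field Ω] {s : I → ℕ} (hs : ∀ i, 1 ≤ s i)
    {x x' : I → Ω} (hx : Function.Injective x) (hx' : Function.Injective x')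
    (h : ∀ i, (X - C (x i)) ^ s i ∣ ∏ i, (X - C (x' i)) ^ s i) :
    ∃ π : Equiv.Perm I, (∀ i, x' i = x (π i)) ∧ ∀ i, s (π i) = s i := by
  classical
  have h1 : ∀ i, ∃ i', x' i' = x i ∧ s i ≤ s i' := by
    intro i
    have h2 : ∃ i', x' i' = x i := by
      have h3 : (∏ i, (X - C (x' i)) ^ s i).eval (x i) = 0 := by
        refine eval_eq_zero_of_dvd_of_eval_eq_zero (h i) ?_
        have := hs i
        simp [show s i ≠ 0 by omega]
      rw [eval_prod, Finset.prod_eq_zero_iff] at h3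
      obtain ⟨i', _, h4⟩ := h3
      have := hs i'
      simp [show s i' ≠ 0 by omega, sub_eq_zero] at h4
      exact ⟨i', h4.symm⟩
    obtain ⟨i', hi'⟩ := h2
    refine ⟨i', hi', ?_⟩
    have h5 := h i
    rw [← hi', ← Finset.mul_prod_erase _ _ (Finset.mem_univ i')] at h5
    have h6 : (X - C (x' i')) ^ s i ∣ (X - C (x' i')) ^ s i' := by
      refine IsCoprime.dvd_of_dvd_mul_right (IsCoprime.prod_right fun j hj => ?_) h5
      exact (pairwise_coprime_X_sub_C hx' (Finset.ne_of_mem_erase hj).symm).pow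
    exact (pow_dvd_pow_iff (X_sub_C_ne_zero _) (not_isUnit_X_sub_C _)).1 h6
  choose ρ hρ hρs using h1
  have hinj : Function.Injective ρ := fun i j hij => hx (by rw [← hρ, ← hρ, hij])
  let e : Equiv.Perm I := Equiv.ofBijective ρ (Finite.injective_iff_bijective.1 hinj)
  have he : ∀ i, s i = s (e i) := by
    have hsum : ∑ i, s i = ∑ i, s (e i) := (Equiv.sum_comp e s).symm
    intro i
    exact (Finset.sum_eq_sum_iff_of_le fun i _ => hρs i).1 hsum i (Finset.mem_univ i)
  refine ⟨e.symm, fun i => ?_, fun i => ?_⟩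
  · rw [← hρ (e.symm i)]
    exact congrArg x' (e.apply_symm_apply i).symm
  · rw [he, e.apply_symm_apply]

end Conjugates

/-! ### Nodal polynomials -/

section Nodal

open Polynomial

variable {K : Type*} [Field K] {d : ℕ}

/-- The polynomial `∏ (X - x j)` (for `none`), and its quotients by the factors `X - x i`. -/
def nodal (x : Fin d → K) : Option (Fin d) → K[X]
  | none => ∏ j, (X - C (x j))
  | some i => ∏ j ∈ Finset.univ.erase i, (X - C (x j))

theorem eval_nodal_none (x : Fin d → K) (i : Fin d) : (nodal x none).eval (x i) = 0 := by
  rw [nodal, eval_prod]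
  exact Finset.prod_eq_zero (Finset.mem_univ i) (by simp)

theorem eval_nodal_of_ne (x : Fin d → K) {i j : Fin d} (h : i ≠ j) :
    (nodal x (some i)).eval (x j) = 0 := by
  rw [nodal, eval_prod]
  exact Finset.prod_eq_zero (Finset.mem_erase.2 ⟨h.symm, Finset.mem_univ j⟩) (by simp)

theorem eval_nodal_self {x : Fin d → K} (hx : Function.Injective x) (i : Fin d) :
    (nodal x (some i)).eval (x i) ≠ 0 := by
  rw [nodal, eval_prod, Finset.prod_ne_zero_iff]
  intro j hj
  simpa [sub_eq_zero] using fun h => (Finset.ne_of_mem_erase hj) (hx h).symm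

theorem monic_nodal (x : Fin d → K) (o : Option (Fin d)) : (nodal x o).Monic := by
  cases o <;> exact monic_prod_of_monic _ _ fun j _ => monic_X_sub_C _

theorem nodal_linearIndependent {x : Fin d → K} (hx : Function.Injective x) :
    LinearIndependent K (nodal x) := by
  rw [Fintype.linearIndependent_iff]
  intro g hg
  rw [Fintype.sum_option] at hg
  have h1 : ∀ i, g (some i) = 0 := by
    intro i
    have h2 := congrArg (Polynomial.eval (x i)) hg
    rw [eval_add, eval_smul, eval_nodal_none, smul_zero, zero_add, eval_finsetSum,
      Finset.sum_eq_single i] at h2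
    · rw [eval_smul, smul_eq_mul, eval_zero] at h2
      exact (mul_eq_zero.1 h2).resolve_right (eval_nodal_self hx i)
    · intro j _ hj
      rw [eval_smul, eval_nodal_of_ne x hj, smul_zero]
    · simp
  rintro (_ | i)
  · simp only [h1, zero_smul, Finset.sum_const_zero, add_zero] at hg
    exact (smul_eq_zero.1 hg).resolve_right (monic_nodal x none).ne_zero
  · exact h1 i

/-- The nodal polynomials span the polynomials of degree at most `d`. -/
theorem eq_zero_of_nodal {x : Fin d → K} (hx : Function.Injective x) (Λ : K[X] →ₗ[K] K)
    (hΛ : ∀ o, Λ (nodal x o) = 0) {q : K[X]} (hq : q.natDegree ≤ d) : Λ q = 0 := by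
  have hm := monic_nodal x none
  have hd : (nodal x none).natDegree = d := by
    rw [nodal, natDegree_prod_of_monic _ _ fun j _ => monic_X_sub_C _]
    simp
  have h1 : q %ₘ nodal x none = ∑ i, (q.eval (x i) / (nodal x (some i)).eval (x i)) •
      nodal x (some i) := by
    refine eq_of_degrees_lt_of_eval_index_eq (v := x) Finset.univ hx.injOn ?_ ?_ fun i _ => ?_
    · rw [Finset.card_univ, Fintype.card_fin]
      conv_rhs => rw [← hd]
      rw [← degree_eq_natDegree hm.ne_zero]
      exact degree_modByMonic_lt _ hm
    · rw [← mem_degreeLT]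
      refine Submodule.sum_mem _ fun i _ => Submodule.smul_mem _ _ (mem_degreeLT.2 ?_)
      rw [degree_eq_natDegree (monic_nodal x _).ne_zero, Nat.cast_lt, nodal,
        natDegree_prod_of_monic _ _ fun j _ => monic_X_sub_C _]
      simp only [natDegree_X_sub_C, Finset.sum_const, smul_eq_mul, mul_one]
      exact Finset.card_erase_lt_of_mem (Finset.mem_univ i)
    · have h2 : (q %ₘ nodal x none).eval (x i) = q.eval (x i) := by
        conv_rhs => rw [← modByMonic_add_div q (nodal x none)]
        rw [eval_add, eval_mul, eval_nodal_none, zero_mul, add_zero]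
      rw [h2, eval_finsetSum, Finset.sum_eq_single i]
      · rw [eval_smul, smul_eq_mul, div_mul_cancel₀ _ (eval_nodal_self hx i)]
      · intro j _ hj
        rw [eval_smul, eval_nodal_of_ne x hj, smul_zero]
      · simp
  have h3 : q /ₘ nodal x none = C ((q /ₘ nodal x none).coeff 0) :=
    eq_C_of_natDegree_le_zero (by rw [natDegree_divByMonic _ hm, hd]; omega)
  rw [← modByMonic_add_div q (nodal x none), h1, h3, mul_comm, C_mul', map_add, map_sum, map_smul,
    hΛ, smul_zero, add_zero]
  exact Finset.sum_eq_zero fun i _ => by rw [map_smul, hΛ, smul_zero]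

end Nodal

open MvPolynomial

/-! ### Cones, tangent spaces and generic smoothness -/

section Cones

variable {K : Type*} [Field K] {σ τ : Type*}

theorem zero_mem_cone (X : Set (ℙ K (σ → K))) : (0 : σ → K) ∈ cone X :=
  fun h => absurd rfl h

theorem mk_mem_iff_mem_cone {X : Set (ℙ K (σ → K))} {v : σ → K} (hv : v ≠ 0) :
    Projectivization.mk K v hv ∈ X ↔ v ∈ cone X :=
  ⟨fun h _ => h, fun h => h hv⟩

theorem rep_mem_cone {X : Set (ℙ K (σ → K))} {p : ℙ K (σ → K)} : p.rep ∈ cone X ↔ p ∈ X := by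
  rw [← mk_mem_iff_mem_cone p.rep_nonzero, p.mk_rep]

theorem mk_smul_eq {v : σ → K} (hv : v ≠ 0) {a : K} (ha : a ≠ 0) :
    Projectivization.mk K (a • v) (smul_ne_zero ha hv) = Projectivization.mk K v hv :=
  (Projectivization.mk_eq_mk_iff' K _ _ _ _).2 ⟨a, rfl⟩

theorem smul_mem_cone {X : Set (ℙ K (σ → K))} {v : σ → K} (hv : v ∈ cone X) (a : K) :
    a • v ∈ cone X := by
  intro h
  have ha : a ≠ 0 := fun h0 => h (by simp [h0])
  have hv0 : v ≠ 0 := fun h0 => h (by simp [h0])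
  rw [mk_smul_eq hv0 ha]
  exact hv hv0

theorem mk_rep_smul (p : ℙ K (σ → K)) {v : σ → K} {hv : v ≠ 0}
    (h : Projectivization.mk K v hv = p) : ∃ a : K, a ≠ 0 ∧ v = a • p.rep := by
  subst h
  obtain ⟨a, ha⟩ := Projectivization.exists_smul_eq_mk_rep K v hv
  refine ⟨(a⁻¹ : Kˣ), Units.ne_zero _, ?_⟩
  rw [← ha, ← Units.smul_def, smul_smul]
  simp

theorem mem_coneIdeal {X : Set (ℙ K (σ → K))} {F : MvPolynomial σ K} :
    F ∈ coneIdeal X ↔ ∀ v ∈ cone X, eval v F = 0 := by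
  rw [coneIdeal, mem_vanishingIdeal_iff]
  simp [aeval_eq_eval]

theorem coneIdeal_anti {X Y : Set (ℙ K (σ → K))} (h : X ⊆ Y) : coneIdeal Y ≤ coneIdeal X :=
  fun _ hF => mem_coneIdeal.2 fun v hv => mem_coneIdeal.1 hF v fun h0 => h (hv h0)

/-- The polynomial `F (a • X)`. -/
def dilate (a : K) (F : MvPolynomial σ K) : MvPolynomial σ K :=
  aeval (fun k => C a * X k) F

theorem eval_dilate (a : K) (F : MvPolynomial σ K) (v : σ → K) :
    eval v (dilate a F) = eval (a • v) F := by
  have h : (aeval v : MvPolynomial σ K →ₐ[K] K).comp (aeval fun k => C a * X k) =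
      aeval (a • v) := by
    ext k
    simp
  simpa [aeval_eq_eval, dilate] using DFunLike.congr_fun h F

theorem dilate_mem_coneIdeal {X : Set (ℙ K (σ → K))} {F : MvPolynomial σ K}
    (hF : F ∈ coneIdeal X) (a : K) : dilate a F ∈ coneIdeal X :=
  mem_coneIdeal.2 fun v hv => by
    rw [eval_dilate]
    exact mem_coneIdeal.1 hF _ (smul_mem_cone hv a)

theorem subset_zariskiClosure (X : Set (ℙ K (σ → K))) : X ⊆ zariskiClosure X :=
  fun _ hp _ hF => mem_coneIdeal.1 hF _ (rep_mem_cone.2 hp)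

theorem coneIdeal_le_of_subset_zariskiClosure {X Y : Set (ℙ K (σ → K))}
    (h : X ⊆ zariskiClosure Y) : coneIdeal Y ≤ coneIdeal X := by
  intro F hF
  refine mem_coneIdeal.2 fun v hv => ?_
  by_cases h0 : v = 0
  · exact h0 ▸ mem_coneIdeal.1 hF 0 (zero_mem_cone Y)
  obtain ⟨a, -, ha⟩ := mk_rep_smul _ (rfl : Projectivization.mk K v h0 = _)
  rw [ha, ← eval_dilate]
  exact h (hv h0) _ (dilate_mem_coneIdeal hF a)

theorem coneIdeal_zariskiClosure (X : Set (ℙ K (σ → K))) :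
    coneIdeal (zariskiClosure X) = coneIdeal X :=
  le_antisymm (coneIdeal_anti (subset_zariskiClosure X))
    (coneIdeal_le_of_subset_zariskiClosure subset_rfl)

theorem zariskiClosure_eq_of_coneIdeal_eq {X Y : Set (ℙ K (σ → K))}
    (h : coneIdeal X = coneIdeal Y) : zariskiClosure X = zariskiClosure Y := by
  simp only [zariskiClosure, h]

theorem zariskiClosure_image_snd (S : Set (ℙ K (σ → K) × ℙ K (τ → K))) :
    zariskiClosure (Prod.snd '' zariskiClosureProd S) = zariskiClosure (Prod.snd '' S) := by
  apply zariskiClosure_eq_of_coneIdeal_eq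
  apply le_antisymm
  · refine coneIdeal_anti (Set.image_mono fun pq hpq G hG => ?_)
    refine hG _ _ pq.1.rep_nonzero pq.2.rep_nonzero ?_
    simpa using hpq
  · refine coneIdeal_le_of_subset_zariskiClosure ?_
    rintro _ ⟨pq, hpq, rfl⟩ F hF
    have := hpq (rename Sum.inr F) fun v w hv hw hS => by
      rw [eval_rename]
      exact mem_coneIdeal.1 hF w fun _ => ⟨_, hS, rfl⟩
    rwa [eval_rename] at this

theorem eq_zero_of_eval_ne_zero [Infinite K] {F G : MvPolynomial σ K} (hG : G ≠ 0)
    (h : ∀ v, eval v G ≠ 0 → eval v F = 0) : F = 0 := by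
  have : G * F = 0 := by
    apply MvPolynomial.funext
    intro v
    rw [map_mul, map_zero]
    by_cases hv : eval v G = 0
    · rw [hv, zero_mul]
    · rw [h v hv, mul_zero]
  exact (mul_eq_zero.1 this).resolve_left hG

/-- A variable outside the range of `b` does not occur in the coefficients. -/
theorem pderiv_eval₂_rename {t : Type*} (b : t → σ) (k j : σ) (hj : j ∉ Set.range b)
    (Q : Polynomial (MvPolynomial t K)) :
    pderiv j (Q.eval₂ (rename b : MvPolynomial t K →ₐ[K] MvPolynomial σ K).toRingHom (X k)) =
      Q.derivative.eval₂ (rename b : MvPolynomial t K →ₐ[K] MvPolynomial σ K).toRingHom (X k) *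
        pderiv j (X k) := by
  classical
  induction Q using Polynomial.induction_on' with
  | add p q hp hq =>
    rw [Polynomial.eval₂_add, map_add, hp, hq, Polynomial.derivative_add, Polynomial.eval₂_add,
      add_mul]
  | monomial m q =>
    have h0 : pderiv j (rename b q) = 0 := by
      refine pderiv_eq_zero_of_notMem_vars fun h => hj ?_
      have h2 := vars_rename b q h
      rw [Finset.mem_image] at h2
      obtain ⟨i, -, hi⟩ := h2
      exact ⟨i, hi⟩
    rw [Polynomial.derivative_monomial, Polynomial.eval₂_monomial, Polynomial.eval₂_monomial]
    simp only [AlgHom.toRingHom_eq_coe, RingHom.coe_coe, Derivation.leibniz, h0,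
      Derivation.leibniz_pow, map_mul, map_natCast, smul_eq_mul,
      nsmul_eq_mul]
    ring

end Cones

section Tangent

variable {K : Type*} [Field K] {σ : Type*} [Fintype σ]

theorem mem_tangentSpace_iff {X : Set (ℙ K (σ → K))} {p : ℙ K (σ → K)} {w : σ → K} :
    w ∈ tangentSpace X p ↔ ∀ F ∈ coneIdeal X, ∑ i, w i * eval p.rep (pderiv i F) = 0 :=
  Iff.rfl

theorem pderiv_dilate (a : K) (F : MvPolynomial σ K) (i : σ) :
    pderiv i (dilate a F) = C a * dilate a (pderiv i F) := by
  classical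
  rw [dilate, derivation_aeval, Finset.sum_eq_single i]
  · simp [dilate, mul_comm]
  · intro j _ hj
    simp [pderiv_X, hj]
  · simp

/-- The tangent space can be computed from any representative of the point. -/
theorem mem_tangentSpace_mk {X : Set (ℙ K (σ → K))} {v : σ → K} (hv : v ≠ 0) {w : σ → K} :
    w ∈ tangentSpace X (Projectivization.mk K v hv) ↔
      ∀ F ∈ coneIdeal X, ∑ i, w i * eval v (pderiv i F) = 0 := by
  obtain ⟨a, ha0, ha⟩ := mk_rep_smul _ (rfl : Projectivization.mk K v hv = _)
  rw [mem_tangentSpace_iff]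
  have key : ∀ (b : K) (F : MvPolynomial σ K) (u : σ → K),
      ∑ i, w i * eval u (pderiv i (dilate b F)) = b * ∑ i, w i * eval (b • u) (pderiv i F) := by
    intro b F u
    rw [Finset.mul_sum]
    refine Finset.sum_congr rfl fun i _ => ?_
    rw [pderiv_dilate, map_mul, eval_C, eval_dilate]
    ring
  constructor
  · intro h F hF
    have := h _ (dilate_mem_coneIdeal hF a)
    rw [key, ← ha] at this
    exact (mul_eq_zero.1 this).resolve_left ha0
  · intro h F hF
    have := h _ (dilate_mem_coneIdeal hF a⁻¹)
    rw [key, ha, smul_smul, inv_mul_cancel₀ ha0, one_smul] at this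
    exact (mul_eq_zero.1 this).resolve_left (inv_ne_zero ha0)

/-- A covector that annihilates the tangent space is the differential of an equation. -/
theorem exists_gradient_eq {X : Set (ℙ K (σ → K))} {p : ℙ K (σ → K)} {u : σ → K}
    (hu : ∀ w ∈ tangentSpace X p, ∑ i, w i * u i = 0) :
    ∃ F ∈ coneIdeal X, ∀ i, eval p.rep (pderiv i F) = u i := by
  classical
  let g : MvPolynomial σ K →ₗ[K] (σ → K) :=
    LinearMap.pi fun i => (aeval p.rep : MvPolynomial σ K →ₐ[K] K).toLinearMap.comp
      (pderiv i : Derivation K (MvPolynomial σ K) (MvPolynomial σ K)).toLinearMap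
  have hg : ∀ F i, g F i = eval p.rep (pderiv i F) := by
    intro F i
    simp [g, aeval_eq_eval]
  let N : Submodule K (σ → K) := ((coneIdeal X).restrictScalars K).map g
  by_contra hcon
  have huN : u ∉ N := by
    rintro ⟨F, hF, hFu⟩
    exact hcon ⟨F, hF, fun i => by rw [← hg, hFu]⟩
  obtain ⟨f, hf, hN⟩ := Submodule.exists_le_ker_of_notMem huN
  have hfv : ∀ v : σ → K, f v = ∑ i, f (Pi.single i 1) * v i := by
    intro v
    conv_lhs => rw [← Finset.univ_sum_single v, map_sum]
    refine Finset.sum_congr rfl fun i _ => ?_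
    rw [show (Pi.single i (v i) : σ → K) = v i • Pi.single i 1 by
      rw [← Pi.single_smul, smul_eq_mul, mul_one], map_smul, smul_eq_mul, mul_comm]
  apply hf
  rw [hfv]
  refine hu _ (mem_tangentSpace_iff.2 fun F hF => ?_)
  have h1 : f (g F) = 0 := hN ⟨F, hF, rfl⟩
  rw [hfv] at h1
  simpa [hg] using h1

/-- Generic smoothness in characteristic zero: away from a hypersurface that does not contain the
cone, the tangent spaces are not larger than the dimension. If `B` is a set of coordinates that
form a transcendence basis, then the minimal polynomial of any other coordinate over `B` is an
equation, and its differential shows that a tangent vector is determined by its components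
in `B`. -/
theorem exists_finrank_tangentSpace_le [CharZero K] (X : Set (ℙ K (σ → K)))
    [(coneIdeal X).IsPrime] : ∃ U ∉ coneIdeal X, ∀ (v : σ → K) (hv : v ≠ 0), eval v U ≠ 0 →
      (Module.finrank K (tangentSpace X (Projectivization.mk K v hv)) : Cardinal) ≤
        Algebra.trdeg K (CoordRing X) := by
  classical
  let y : σ → CoordRing X := fun k => Ideal.Quotient.mk (coneIdeal X) (MvPolynomial.X k)
  have hy : ∀ F : MvPolynomial σ K, aeval y F = Ideal.Quotient.mk (coneIdeal X) F := by
    intro F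
    have : aeval y = Ideal.Quotient.mkₐ K (coneIdeal X) := by ext k; simp [y]
    rw [this]; rfl
  have htop : Algebra.adjoin K (Set.range y) = ⊤ := by
    rw [Algebra.adjoin_range_eq_range_aeval, AlgHom.range_eq_top]
    intro a
    obtain ⟨F, rfl⟩ := Ideal.Quotient.mk_surjective a
    exact ⟨F, hy F⟩
  have halg : Algebra.IsAlgebraic (Algebra.adjoin K (Set.range y)) (CoordRing X) := by
    refine ⟨fun a => ?_⟩
    have ha : a ∈ Algebra.adjoin K (Set.range y) := htop ▸ Algebra.mem_top
    exact isAlgebraic_algebraMap (⟨a, ha⟩ : Algebra.adjoin K (Set.range y))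
  obtain ⟨t, hty, ht⟩ := exists_isTranscendenceBasis_subset (R := K) (Set.range y)
  choose b hb using fun s : t => hty s.2
  have hbinj : Function.Injective b := fun s s' h => Subtype.ext (by rw [← hb s, ← hb s', h])
  have hfint : Finite t := Finite.of_injective b hbinj
  have := Fintype.ofFinite t
  have hind : AlgebraicIndependent K (Subtype.val : t → CoordRing X) := ht.1
  -- the equation of minimal degree in the coordinate `k` over the transcendence basis
  have hG : ∀ k : {k // k ∉ Set.range b}, ∃ G ∈ coneIdeal X, pderiv k.1 G ∉ coneIdeal X ∧
      ∀ j, j ∉ Set.range b → j ≠ k.1 → pderiv j G = 0 := by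
    rintro ⟨k, hk⟩
    let ev : Polynomial (MvPolynomial t K) →+* CoordRing X := Polynomial.eval₂RingHom
      (aeval (Subtype.val : t → CoordRing X) : MvPolynomial t K →ₐ[K] _).toRingHom (y k)
    let Φ : Polynomial (MvPolynomial t K) →+* MvPolynomial σ K := Polynomial.eval₂RingHom
      (rename b : MvPolynomial t K →ₐ[K] MvPolynomial σ K).toRingHom (MvPolynomial.X k)
    have hΦ : ∀ Q, Φ Q ∈ coneIdeal X ↔ ev Q = 0 := by
      intro Q
      rw [← Ideal.Quotient.eq_zero_iff_mem, ← RingHom.comp_apply]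
      have : (Ideal.Quotient.mk (coneIdeal X)).comp Φ = ev := by
        ext
        · simp [Φ, ev, ← hy]
        · simp [Φ, ev, ← hy, hb]
        · simp [Φ, ev, y]
      rw [this]
    have hex : {Q : Polynomial (MvPolynomial t K) | Q ≠ 0 ∧ ev Q = 0}.Nonempty := by
      have h1 : IsAlgebraic (Algebra.adjoin K (Set.range (Subtype.val : t → CoordRing X))) (y k) :=
        ht.isAlgebraic.isAlgebraic _
      obtain ⟨Q, hQ0, hQ⟩ := h1
      refine ⟨Q.map (hind.aevalEquiv.symm : _ →+* _), ?_, ?_⟩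
      · exact (Polynomial.map_ne_zero_iff hind.aevalEquiv.symm.injective).2 hQ0
      · rw [← hQ, Polynomial.aeval_def]
        simp only [ev, Polynomial.coe_eval₂RingHom, Polynomial.eval₂_map]
        congr 1
        ext a
        obtain ⟨q, rfl⟩ := hind.aevalEquiv.surjective a
        simp
    obtain ⟨Q, ⟨hQ0, hQ⟩, hmin⟩ := (measure Polynomial.natDegree).wf.has_min _ hex
    have hdeg : Q.natDegree ≠ 0 := by
      intro h0
      rw [Polynomial.eq_C_of_natDegree_eq_zero h0] at hQ hQ0
      apply hQ0
      have : Q.coeff 0 = 0 := by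
        apply hind
        rw [map_zero]
        simpa [ev] using hQ
      rw [this, map_zero]
    have hder0 : Q.derivative ≠ 0 := fun h0 =>
      hdeg (Polynomial.derivative_eq_zero.1 h0)
    have hder : ev Q.derivative ≠ 0 := fun h0 =>
      hmin _ ⟨hder0, h0⟩ (Polynomial.natDegree_derivative_lt hdeg)
    refine ⟨Φ Q, (hΦ Q).2 hQ, ?_, fun j hj hjk => ?_⟩
    · have := pderiv_eval₂_rename (K := K) b k k hk Q
      rw [pderiv_X_self, mul_one] at this
      exact fun h => hder ((hΦ _).1 ((show pderiv k (Φ Q) = Φ Q.derivative from this) ▸ h))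
    · have := pderiv_eval₂_rename (K := K) b k j hj Q
      rw [pderiv_X_of_ne hjk.symm, mul_zero] at this
      exact this
  choose G hGI hGd hGj using hG
  refine ⟨∏ k, pderiv k.1 (G k), ?_, fun v hv hU => ?_⟩
  · rw [Ideal.IsPrime.prod_mem_iff]
    rintro ⟨k, -, hk⟩
    exact hGd k hk
  rw [map_prod, Finset.prod_ne_zero_iff] at hU
  let res : tangentSpace X (Projectivization.mk K v hv) →ₗ[K] (t → K) :=
    (LinearMap.funLeft K K b).comp (Submodule.subtype _)
  have hres : Function.Injective res := by
    rw [injective_iff_map_eq_zero]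
    rintro ⟨w, hw⟩ h0
    have hwb : ∀ s, w (b s) = 0 := fun s => congrFun h0 s
    refine Subtype.ext (funext fun k => ?_)
    by_cases hk : k ∈ Set.range b
    · obtain ⟨s, rfl⟩ := hk
      exact hwb s
    · have h1 := (mem_tangentSpace_mk hv).1 hw _ (hGI ⟨k, hk⟩)
      rw [Finset.sum_eq_single k] at h1
      · exact (mul_eq_zero.1 h1).resolve_right (hU ⟨k, hk⟩ (Finset.mem_univ _))
      · intro j _ hjk
        by_cases hj : j ∈ Set.range b
        · obtain ⟨s, rfl⟩ := hj
          rw [hwb, zero_mul]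
        · rw [hGj ⟨k, hk⟩ j hj hjk, map_zero, mul_zero]
      · simp
  have h1 := LinearMap.finrank_le_finrank_of_injective hres
  rw [Module.finrank_fintype_fun_eq_card] at h1
  rw [← ht.cardinalMk_eq_trdeg, Cardinal.mk_fintype]
  exact_mod_cast h1

end Tangent

/-! ### The parameter space and the generic moments -/

theorem eval_aeval {K σ τ : Type*} [CommRing K] (f : σ → MvPolynomial τ K) (v : τ → K)
    (F : MvPolynomial σ K) : eval v (aeval f F) = eval (fun k => eval v (f k)) F := by
  have h := DFunLike.congr_fun (comp_aeval (R := K) f (aeval v : MvPolynomial τ K →ₐ[K] K)) F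
  simpa [aeval_eq_eval] using h

section BlockCoeff

/-- Vandermonde's identity, shifted by `j`. -/
theorem sum_choose_mul_choose (e m j k : ℕ) (hjm : j ≤ m) (hjk : j ≤ k) :
    ∑ b ∈ Finset.range (m + 1), (if j ≤ b ∧ b ≤ k then e.choose (k - b) * (m - j).choose (b - j)
      else 0) = (e + m - j).choose (k - j) := by
  have h1 : ∑ b ∈ Finset.range (m + 1), (if j ≤ b ∧ b ≤ k then
      e.choose (k - b) * (m - j).choose (b - j) else 0) =
      ∑ b ∈ Finset.range (m + k + 1), (if j ≤ b ∧ b ≤ k then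
      e.choose (k - b) * (m - j).choose (b - j) else 0) := by
    refine Finset.sum_subset (Finset.range_mono (by omega)) fun b _ hb => ?_
    rw [Finset.mem_range, not_lt] at hb
    rw [Nat.choose_eq_zero_of_lt (show m - j < b - j by omega), mul_zero, ite_self]
  have h2 : ∑ b ∈ Finset.Ico j (k + 1), e.choose (k - b) * (m - j).choose (b - j) =
      ∑ b ∈ Finset.range (m + k + 1), (if j ≤ b ∧ b ≤ k then
      e.choose (k - b) * (m - j).choose (b - j) else 0) := by
    rw [← Finset.sum_filter]
    refine Finset.sum_congr ?_ fun _ _ => rfl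
    ext b
    simp only [Finset.mem_Ico, Finset.mem_filter, Finset.mem_range]
    omega
  rw [h1, ← h2, Finset.sum_Ico_eq_sum_range, show e + m - j = (m - j) + e by omega,
    Nat.add_choose_eq, Finset.Nat.sum_antidiagonal_eq_sum_range_succ_mk,
    show k + 1 - j = (k - j).succ by omega]
  refine Finset.sum_congr rfl fun i _ => ?_
  rw [mul_comm, Nat.add_sub_cancel_left, Nat.sub_add_eq]

variable {K A : Type*} [Field K] [CommRing A] [Algebra K A]

/-- If `c j` is the coefficient of `p ↦ p⁽ʲ⁾(x)` in a functional, then the form whose coordinate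
vector is the vector of moments of that functional equals `(x u + v) ^ (n - m) * g`, where `g` is
the form of degree `m` that has this element as its `b`-th coordinate. -/
def blockCoeff (K : Type*) {A : Type*} [Field K] [CommRing A] [Algebra K A] (n m b : ℕ) (x : A)
    (c : ℕ → A) : A :=
  algebraMap K A (m.choose b : K)⁻¹ * ∑ j ∈ Finset.range (b + 1),
    ((m - j).choose (b - j) * n.descFactorial j : ℕ) * x ^ (b - j) * c j

theorem blockCoeff_mul_left (n m b : ℕ) (x a : A) (c : ℕ → A) :
    blockCoeff K n m b x (fun j => a * c j) = a * blockCoeff K n m b x c := by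
  simp only [blockCoeff, Finset.mul_sum]
  exact Finset.sum_congr rfl fun j _ => by ring

theorem map_blockCoeff {B : Type*} [CommRing B] [Algebra K B] (f : A →ₐ[K] B) (n m b : ℕ) (x : A)
    (c : ℕ → A) : f (blockCoeff K n m b x c) = blockCoeff K n m b (f x) fun j => f (c j) := by
  simp [blockCoeff, map_sum]

theorem blockCoeff_congr {n m b : ℕ} {x : A} {c c' : ℕ → A} (h : ∀ j ≤ b, c j = c' j) :
    blockCoeff K n m b x c = blockCoeff K n m b x c' := by
  unfold blockCoeff
  congr 1
  refine Finset.sum_congr rfl fun j hj => ?_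
  rw [h j (Nat.lt_succ_iff.1 (Finset.mem_range.1 hj))]

theorem blockCoeff_mem {L : Type*} [Field L] [Algebra K L] (S : IntermediateField K L)
    {n m b : ℕ} {x : L} (hx : x ∈ S) {c : ℕ → L} (hc : ∀ j ≤ b, c j ∈ S) :
    blockCoeff K n m b x c ∈ S := by
  refine S.mul_mem (S.algebraMap_mem _) (S.sum_mem fun j hj => ?_)
  exact S.mul_mem (S.mul_mem (natCast_mem S _) (pow_mem hx _))
    (hc j (Nat.lt_succ_iff.1 (Finset.mem_range.1 hj)))

variable [CharZero K]

theorem choose_mul_blockCoeff {n m b : ℕ} (hb : b ≤ m) (x : A) (c : ℕ → A) :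
    (m.choose b : A) * blockCoeff K n m b x c = ∑ j ∈ Finset.range (b + 1),
      ((m - j).choose (b - j) * n.descFactorial j : ℕ) * x ^ (b - j) * c j := by
  have h : (m.choose b : K) ≠ 0 := Nat.cast_ne_zero.2 (Nat.choose_pos hb).ne'
  rw [blockCoeff, ← mul_assoc, ← map_natCast (algebraMap K A), ← map_mul, mul_inv_cancel₀ h,
    map_one, one_mul]

theorem sum_blockCoeff_eq (e m k : ℕ) (x : A) (c : ℕ → A) :
    ∑ a ∈ Finset.range (e + 1), ∑ b ∈ Finset.range (m + 1), (if a + b = k then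
      (e.choose a * m.choose b : A) * (x ^ a * blockCoeff K (e + m) m b x c) else 0) =
    ((e + m).choose k : A) * ∑ j ∈ Finset.range (m + 1),
      c j * (k.descFactorial j * x ^ (k - j)) := by
  have h1 : ∀ b ∈ Finset.range (m + 1), ∑ a ∈ Finset.range (e + 1), (if a + b = k then
      (e.choose a * m.choose b : A) * (x ^ a * blockCoeff K (e + m) m b x c) else 0) =
      ∑ j ∈ Finset.range (m + 1), (if j ≤ b ∧ b ≤ k then e.choose (k - b) * (m - j).choose (b - j)
        else 0 : ℕ) * ((e + m).descFactorial j * x ^ (k - j) * c j) := by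
    intro b hb
    have hbm : b ≤ m := Nat.lt_succ_iff.1 (Finset.mem_range.1 hb)
    by_cases hbk : b ≤ k
    · have h2 : ∑ a ∈ Finset.range (e + 1), (if a + b = k then
          (e.choose a * m.choose b : A) * (x ^ a * blockCoeff K (e + m) m b x c) else 0) =
          (e.choose (k - b) : A) * x ^ (k - b) *
            ((m.choose b : A) * blockCoeff K (e + m) m b x c) := by
        by_cases hke : k - b ≤ e
        · rw [Finset.sum_eq_single_of_mem (k - b) (Finset.mem_range.2 (by omega)),
            if_pos (by omega)]
          · ring
          · intro a _ ha
            rw [if_neg (by omega)]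
        · rw [Nat.choose_eq_zero_of_lt (show e < k - b by omega), Finset.sum_eq_zero]
          · simp
          · intro a ha
            rw [Finset.mem_range] at ha
            rw [if_neg (by omega)]
      rw [h2, choose_mul_blockCoeff hbm, Finset.mul_sum]
      have h3 : ∀ j ∈ Finset.range (m + 1), j ∉ Finset.range (b + 1) →
          ((if j ≤ b ∧ b ≤ k then e.choose (k - b) * (m - j).choose (b - j) else 0 : ℕ) : A) *
          ((e + m).descFactorial j * x ^ (k - j) * c j) = 0 := by
        intro j _ hj
        rw [Finset.mem_range, not_lt] at hj
        rw [if_neg (by omega), Nat.cast_zero, zero_mul]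
      rw [← Finset.sum_subset (Finset.range_mono (by omega)) h3]
      refine Finset.sum_congr rfl fun j hj => ?_
      have hj' : j ≤ b := Nat.lt_succ_iff.1 (Finset.mem_range.1 hj)
      rw [if_pos ⟨hj', hbk⟩, show k - j = (k - b) + (b - j) by omega, pow_add]
      push_cast
      ring
    · rw [Finset.sum_eq_zero, Finset.sum_eq_zero]
      · intro j _
        rw [if_neg (by omega), Nat.cast_zero, zero_mul]
      · intro a _
        rw [if_neg (by omega)]
  rw [Finset.sum_comm, Finset.sum_congr rfl h1, Finset.sum_comm, Finset.mul_sum]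
  refine Finset.sum_congr rfl fun j hj => ?_
  have hjm : j ≤ m := Nat.lt_succ_iff.1 (Finset.mem_range.1 hj)
  rw [← Finset.sum_mul, ← Nat.cast_sum]
  by_cases hjk : j ≤ k
  · rw [sum_choose_mul_choose e m j k hjm hjk]
    have h4 : ((e + m - j).choose (k - j) * (e + m).descFactorial j : ℕ) =
        (e + m).choose k * k.descFactorial j := by
      rw [Nat.descFactorial_eq_factorial_mul_choose, Nat.descFactorial_eq_factorial_mul_choose]
      have := Nat.choose_mul (n := e + m) (k := k) (s := j) hjk
      calc _ = j.factorial * ((e + m).choose j * (e + m - j).choose (k - j)) := by ring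
        _ = _ := by rw [← this]; ring
    have h5 : (((e + m - j).choose (k - j) : ℕ) : A) * ((e + m).descFactorial j : ℕ) =
        ((e + m).choose k : ℕ) * (k.descFactorial j : ℕ) := by exact_mod_cast congrArg _ h4
    calc _ = ((((e + m - j).choose (k - j) : ℕ) : A) * ((e + m).descFactorial j : ℕ)) *
          (x ^ (k - j) * c j) := by ring
      _ = _ := by rw [h5]; ring
  · rw [Nat.descFactorial_eq_zero_iff_lt.2 (show k < j by omega), Finset.sum_eq_zero]
    · simp
    · intro b _
      rw [if_neg (by omega)]

theorem blockCoeff_self_eq {n m b : ℕ} (hbm : b ≤ m) (x : A) (c : ℕ → A) :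
    (m.choose b : A) * blockCoeff K n m b x c = n.descFactorial b * c b +
      ∑ j ∈ Finset.range b,
        ((m - j).choose (b - j) * n.descFactorial j : ℕ) * x ^ (b - j) * c j := by
  rw [choose_mul_blockCoeff hbm, Finset.sum_range_succ, add_comm]
  simp

/-- Every coordinate vector of a form arises, since `blockCoeff` is triangular in `c`. -/
theorem exists_blockCoeff_eq {n m : ℕ} (hmn : m ≤ n) (x : K) (v : ℕ → K) (N : ℕ) (hN : N ≤ m + 1) :
    ∃ c : ℕ → K, ∀ b < N, blockCoeff K n m b x c = v b := by
  induction N with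
  | zero => exact ⟨0, by simp⟩
  | succ N ih =>
    obtain ⟨c, hc⟩ := ih (by omega)
    have h0 : (n.descFactorial N : K) ≠ 0 := by
      rw [Nat.cast_ne_zero, Ne, Nat.descFactorial_eq_zero_iff_lt]
      omega
    have h1 : (m.choose N : K) ≠ 0 := Nat.cast_ne_zero.2 (Nat.choose_pos (by omega)).ne'
    refine ⟨Function.update c N (((m.choose N : K) * v N - ∑ j ∈ Finset.range N,
      ((m - j).choose (N - j) * n.descFactorial j : ℕ) * x ^ (N - j) * c j) / n.descFactorial N),
      fun b hb => ?_⟩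
    rcases Nat.lt_succ_iff_lt_or_eq.1 hb with hlt | rfl
    · rw [← hc b hlt]
      exact blockCoeff_congr fun j hj => Function.update_of_ne (by omega) _ _
    · apply mul_left_cancel₀ h1
      rw [blockCoeff_self_eq (by omega), Function.update_self, mul_div_cancel₀ _ h0,
        sub_add_eq_add_sub, sub_eq_iff_eq_add]
      congr 1
      refine Finset.sum_congr rfl fun j hj => ?_
      rw [Function.update_of_ne (Finset.mem_range.1 hj).ne]

theorem mem_of_blockCoeff_mem {L : Type*} [Field L] [Algebra K L] (S : IntermediateField K L)
    {n m : ℕ} (hmn : m ≤ n) {x : L} (hx : x ∈ S) {c : ℕ → L}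
    (h : ∀ b ≤ m, blockCoeff K n m b x c ∈ S) (b : ℕ) (hb : b ≤ m) : c b ∈ S := by
  have : CharZero L := charZero_of_injective_algebraMap (algebraMap K L).injective
  induction b using Nat.strong_induction_on with
  | _ b ih =>
    have h0 : (n.descFactorial b : L) ≠ 0 := by
      rw [Nat.cast_ne_zero, Ne, Nat.descFactorial_eq_zero_iff_lt]
      omega
    have h1 : c b = ((m.choose b : L) * blockCoeff K n m b x c - ∑ j ∈ Finset.range b,
        ((m - j).choose (b - j) * n.descFactorial j : ℕ) * x ^ (b - j) * c j) /
          n.descFactorial b := by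
      rw [blockCoeff_self_eq hb, eq_div_iff h0]
      ring
    rw [h1]
    refine S.div_mem (S.sub_mem (S.mul_mem (natCast_mem S _) (h b hb)) (S.sum_mem fun j hj => ?_))
      (natCast_mem S _)
    have hjb := Finset.mem_range.1 hj
    exact S.mul_mem (S.mul_mem (natCast_mem S _) (pow_mem hx _)) (ih j hjb (by omega))

end BlockCoeff

section ParamSpace

/-- The number of derivatives at the node that belongs to a part `λ_i ≠ 1`, which is
`λ_i - 1`. -/
abbrev order {d : ℕ} (lam : Fin d → ℕ) (i : BigPart lam) : ℕ := lam i - 2 + 1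

/-- The affine parameters: a node and `λ_i - 1` coefficients for every part `λ_i ≠ 1`. -/
abbrev ParamIndex {d : ℕ} (lam : Fin d → ℕ) : Type :=
  BigPart lam ⊕ (Σ i : BigPart lam, Fin (order lam i))

variable (K : Type*) [Field K] (n : ℕ) {d : ℕ} (lam : Fin d → ℕ)

/-- The generic node. -/
def node (i : BigPart lam) : MvPolynomial (ParamIndex lam) K := X (Sum.inl i)

/-- The generic coefficient. -/
def nodeCoeff (i : BigPart lam) (j : ℕ) : MvPolynomial (ParamIndex lam) K :=
  if h : j < order lam i then X (Sum.inr ⟨i, ⟨j, h⟩⟩) else 0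

/-- The moments of the generic functional. -/
def genericMoment (k : ℕ) : MvPolynomial (ParamIndex lam) K :=
  moment (order lam) (node K lam) (nodeCoeff K lam) k

/-- The coordinates of the generic point of the parameter space, in the chart in which all
`t i` are `1`. -/
def genericPoint (j : JIndex n lam) : MvPolynomial (ParamIndex lam) K :=
  node K lam j.1 ^ (j.2.1 : ℕ) *
    blockCoeff K n (lam j.1 - 2) j.2.2 (node K lam j.1) (nodeCoeff K lam j.1)

variable {K n lam}

theorem two_le_of_bigPart (hpos : ∀ i, 1 ≤ lam i) (i : BigPart lam) : 2 ≤ lam i := by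
  have := hpos i.1
  have := i.2
  omega

theorem le_of_sum_eq (hsum : ∑ i, lam i = n) (i : Fin d) : lam i ≤ n :=
  hsum ▸ Finset.single_le_sum (fun _ _ => Nat.zero_le _) (Finset.mem_univ i)

theorem sum_order_add_card (hpos : ∀ i, 1 ≤ lam i) (hsum : ∑ i, lam i = n) :
    ∑ i : BigPart lam, (order lam i + 1) + (Finset.univ.filter fun i => lam i = 1).card = n := by
  have h1 : ∑ i : BigPart lam, (order lam i + 1) = ∑ i with lam i ≠ 1, lam i := by
    rw [Finset.sum_subtype (p := fun i => lam i ≠ 1) _ (by simp) lam]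
    refine Finset.sum_congr rfl fun i _ => ?_
    have := two_le_of_bigPart hpos i
    simp only [order]
    omega
  have h2 : (Finset.univ.filter fun i => lam i = 1).card = ∑ i with lam i = 1, lam i := by
    rw [Finset.card_eq_sum_ones]
    refine Finset.sum_congr rfl fun i hi => ?_
    rw [(Finset.mem_filter.1 hi).2]
  rw [h1, h2, add_comm, Finset.sum_filter_add_sum_filter_not, hsum]

theorem aeval_paramMap {A : Type*} [CommRing A] [Algebra K A] (y : JIndex n lam → A)
    (k : Fin (n + 1)) : aeval y (paramMap K n lam k) = algebraMap K A (n.choose k : K)⁻¹ *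
      ∑ i : BigPart lam, ∑ a : Fin (n - lam i + 2 + 1), ∑ b : Fin (lam i - 2 + 1),
        if (a : ℕ) + b = k then
          ((n - lam i + 2).choose a * (lam i - 2).choose b : A) * y ⟨i, (a, b)⟩ else 0 := by
  rw [paramMap, map_mul, algHom_C, map_sum, Fintype.sum_sigma]
  congr 1
  refine Finset.sum_congr rfl fun i _ => ?_
  rw [Fintype.sum_prod_type]
  refine Finset.sum_congr rfl fun a _ => Finset.sum_congr rfl fun b _ => ?_
  split_ifs <;> simp

/-- The parameters with node `x i` and coefficients `c i j`. -/
def paramValue {A : Type*} (x : BigPart lam → A) (c : BigPart lam → ℕ → A) : ParamIndex lam → A :=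
  Sum.elim x fun ij => c ij.1 ij.2

theorem aeval_node {A : Type*} [CommRing A] [Algebra K A] (x : BigPart lam → A)
    (c : BigPart lam → ℕ → A) (i : BigPart lam) : aeval (paramValue x c) (node K lam i) = x i := by
  simp [paramValue, node]

theorem aeval_nodeCoeff {A : Type*} [CommRing A] [Algebra K A] (x : BigPart lam → A)
    (c : BigPart lam → ℕ → A) (i : BigPart lam) {j : ℕ} (hj : j < order lam i) :
    aeval (paramValue x c) (nodeCoeff K lam i j) = c i j := by
  simp [paramValue, nodeCoeff, hj]

theorem eval_paramMap_smul (a : K) (v : JIndex n lam → K) (k : Fin (n + 1)) :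
    eval (a • v) (paramMap K n lam k) = a * eval v (paramMap K n lam k) := by
  have h := fun v : JIndex n lam → K => aeval_paramMap (K := K) v k
  simp only [aeval_eq_eval] at h
  rw [h, h]
  simp only [Finset.mul_sum, Pi.smul_apply, smul_eq_mul, mul_ite, mul_zero]
  refine Finset.sum_congr rfl fun i _ => Finset.sum_congr rfl fun a _ =>
    Finset.sum_congr rfl fun b _ => ?_
  split_ifs <;> ring

theorem aeval_genericMoment {A : Type*} [CommRing A] [Algebra K A] (x : BigPart lam → A)
    (c : BigPart lam → ℕ → A) (k : ℕ) :
    aeval (paramValue x c) (genericMoment K lam k) = moment (order lam) x c k := by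
  have := map_moment (aeval (paramValue x c) : MvPolynomial (ParamIndex lam) K →ₐ[K] A).toRingHom
    (order lam) (node K lam) (nodeCoeff K lam) k
  refine this.trans ?_
  simp only [AlgHom.toRingHom_eq_coe, RingHom.coe_coe, aeval_node]
  exact moment_congr (fun i j hj => aeval_nodeCoeff x c i hj) k

theorem aeval_genericPoint (x : BigPart lam → K) (c : BigPart lam → ℕ → K) (j : JIndex n lam) :
    aeval (paramValue x c) (genericPoint K n lam j) =
      paramPoint n lam x 1 (fun i b => blockCoeff K n (lam i - 2) b (x i) (c i)) j := by
  rw [genericPoint, map_mul, map_pow, map_blockCoeff, aeval_node, paramPoint]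
  simp only [Pi.one_apply, one_pow, mul_one]
  congr 1
  exact blockCoeff_congr fun i hi => aeval_nodeCoeff x c _ (lt_of_le_of_lt hi j.2.2.2)

variable [CharZero K]

/-- In the chart `t = 1`, the decomposition with the forms `blockCoeff` is the vector of moments. -/
theorem aeval_paramMap_block {A : Type*} [CommRing A] [Algebra K A] (hpos : ∀ i, 1 ≤ lam i)
    (hsum : ∑ i, lam i = n) (x : BigPart lam → A) (c : BigPart lam → ℕ → A) (k : Fin (n + 1)) :
    aeval (fun j : JIndex n lam => x j.1 ^ (j.2.1 : ℕ) *
      blockCoeff K n (lam j.1 - 2) j.2.2 (x j.1) (c j.1)) (paramMap K n lam k) =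
      moment (order lam) x c k := by
  have hk : (n.choose k : K) ≠ 0 := Nat.cast_ne_zero.2 (Nat.choose_pos (by omega)).ne'
  rw [aeval_paramMap]
  have h1 : ∀ i : BigPart lam, ∑ a : Fin (n - lam i + 2 + 1), ∑ b : Fin (lam i - 2 + 1),
        (if (a : ℕ) + b = k then ((n - lam i + 2).choose a * (lam i - 2).choose b : A) *
          (x i ^ (a : ℕ) * blockCoeff K n (lam i - 2) b (x i) (c i)) else 0) =
        (n.choose k : A) * ∑ j ∈ Finset.range (order lam i),
          c i j * ((k : ℕ).descFactorial j * x i ^ (k - j)) := by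
    intro i
    have h2 := two_le_of_bigPart hpos i
    have h3 := le_of_sum_eq hsum i
    have h4 : n - lam i + 2 + (lam i - 2) = n := by omega
    have h5 := sum_blockCoeff_eq (K := K) (n - lam i + 2) (lam i - 2) k (x i) (c i)
    rw [h4] at h5
    rw [← h5, ← Fin.sum_univ_eq_sum_range (fun a => ∑ b ∈ Finset.range (lam i - 2 + 1),
      if a + b = k then ((n - lam i + 2).choose a * (lam i - 2).choose b : A) *
          (x i ^ a * blockCoeff K n (lam i - 2) b (x i) (c i)) else 0)]
    refine Finset.sum_congr rfl fun a _ => ?_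
    rw [← Fin.sum_univ_eq_sum_range (fun b => 
      if a + b = k then ((n - lam i + 2).choose a * (lam i - 2).choose b : A) *
          (x i ^ (a : ℕ) * blockCoeff K n (lam i - 2) b (x i) (c i)) else 0)]
  simp only [h1]
  rw [← Finset.mul_sum, ← mul_assoc, ← map_natCast (algebraMap K A), ← map_mul,
    inv_mul_cancel₀ hk, map_one, one_mul, moment]

theorem aeval_genericPoint_paramMap (hpos : ∀ i, 1 ≤ lam i) (hsum : ∑ i, lam i = n)
    (k : Fin (n + 1)) :
    aeval (genericPoint K n lam) (paramMap K n lam k) = genericMoment K lam k :=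
  aeval_paramMap_block hpos hsum _ _ k

/-- Points with all `t i ≠ 0` are multiples, block by block, of points of the chart `t = 1`, and the
other points are limits of these. -/
theorem eval_eq_zero_of_aeval_genericPoint (hsum : ∑ i, lam i = n)
    {F : MvPolynomial (JIndex n lam) K} (hF : aeval (genericPoint K n lam) F = 0)
    (s t : BigPart lam → K) (c : ∀ i : BigPart lam, Fin (lam i - 2 + 1) → K) :
    eval (paramPoint n lam s t c) F = 0 := by
  -- the chart is dense: the value is a polynomial in `t`
  let H : MvPolynomial (BigPart lam) K := aeval (fun j : JIndex n lam =>
    C (s j.1 ^ (j.2.1 : ℕ)) * X j.1 ^ (n - lam j.1 + 2 - j.2.1) * C (c j.1 j.2.2)) F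
  have hH : ∀ t, eval t H = eval (paramPoint n lam s t c) F := by
    intro t
    have h : (aeval t : MvPolynomial (BigPart lam) K →ₐ[K] K).comp (aeval fun j : JIndex n lam =>
        C (s j.1 ^ (j.2.1 : ℕ)) * X j.1 ^ (n - lam j.1 + 2 - j.2.1) * C (c j.1 j.2.2)) =
        aeval (paramPoint n lam s t c) := by
      ext j
      simp [paramPoint]
    simpa [aeval_eq_eval, H] using DFunLike.congr_fun h F
  rw [← hH]
  suffices H = 0 by rw [this, map_zero]
  refine eq_zero_of_eval_ne_zero (G := ∏ i, X i) (Finset.prod_ne_zero_iff.2 fun i _ => X_ne_zero i)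
    fun t ht => ?_
  rw [map_prod, Finset.prod_ne_zero_iff] at ht
  have ht' : ∀ i, t i ≠ 0 := fun i => by simpa using ht i (Finset.mem_univ i)
  rw [hH]
  have hex : ∀ i : BigPart lam, ∃ c' : ℕ → K, ∀ b : Fin (lam i - 2 + 1),
      blockCoeff K n (lam i - 2) b (s i / t i) c' = t i ^ (n - lam i + 2) * c i b := by
    intro i
    obtain ⟨c', hc'⟩ := exists_blockCoeff_eq (n := n) (m := lam i - 2)
      ((Nat.sub_le _ _).trans (le_of_sum_eq hsum i)) (s i / t i)
      (fun b => if h : b < lam i - 2 + 1 then t i ^ (n - lam i + 2) * c i ⟨b, h⟩ else 0) _ le_rfl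
    refine ⟨c', fun b => ?_⟩
    rw [hc' b b.2, dif_pos b.2]
  choose c' hc' using hex
  have hp : paramPoint n lam s t c = fun j =>
      aeval (paramValue (fun i => s i / t i) c') (genericPoint K n lam j) := by
    funext j
    rw [aeval_genericPoint]
    simp only [paramPoint, hc', Pi.one_apply, one_pow, mul_one, div_pow]
    have : t j.1 ^ (n - lam j.1 + 2) = t j.1 ^ (n - lam j.1 + 2 - j.2.1) * t j.1 ^ (j.2.1 : ℕ) := by
      rw [← pow_add, Nat.sub_add_cancel (by omega)]
    rw [this]
    have := pow_ne_zero (j.2.1 : ℕ) (ht' j.1)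
    field_simp
  rw [hp]
  simp only [aeval_eq_eval]
  rw [← eval_aeval, hF, map_zero]

/-- The ideal of the parameter space is the ideal of its generic point. -/
theorem mem_coneIdeal_paramSpace (hsum : ∑ i, lam i = n)
    {F : MvPolynomial (JIndex n lam) K} :
    F ∈ coneIdeal (paramSpace K n lam) ↔ aeval (genericPoint K n lam) F = 0 := by
  rw [mem_coneIdeal, cone_paramSpace]
  constructor
  · intro h
    apply MvPolynomial.funext
    intro z
    let x : BigPart lam → K := fun i => z (Sum.inl i)
    let c : BigPart lam → ℕ → K := fun i j =>
      if h : j < order lam i then z (Sum.inr ⟨i, ⟨j, h⟩⟩) else 0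
    have hz : z = paramValue x c := by
      funext i
      rcases i with i | i
      · rfl
      · have h1 : c i.1 i.2 = z (Sum.inr i) := dif_pos i.2.2
        exact h1.symm
    rw [eval_aeval, map_zero, hz]
    have h1 := fun j : JIndex n lam => aeval_genericPoint x c j
    simp only [aeval_eq_eval] at h1
    simp only [h1]
    exact h _ ⟨_, _, _, rfl⟩
  · rintro h v ⟨s, t, c, rfl⟩
    exact eval_eq_zero_of_aeval_genericPoint hsum h s t c

theorem aeval_comp_paramMap (hpos : ∀ i, 1 ≤ lam i) (hsum : ∑ i, lam i = n)
    (F : MvPolynomial (Fin (n + 1)) K) :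
    aeval (genericPoint K n lam) (aeval (paramMap K n lam) F) =
      aeval (fun k : Fin (n + 1) => genericMoment K lam k) F := by
  have h := DFunLike.congr_fun (comp_aeval (R := K) (paramMap K n lam)
    (aeval (genericPoint K n lam))) F
  rw [AlgHom.comp_apply] at h
  rw [h]
  simp only [aeval_genericPoint_paramMap hpos hsum]

/-- The ideal of the image of the rational map is the ideal of relations between the generic
moments. -/
theorem mem_coneIdeal_ratImage (hpos : ∀ i, 1 ≤ lam i) (hsum : ∑ i, lam i = n)
    {F : MvPolynomial (Fin (n + 1)) K} :
    F ∈ coneIdeal (ratImage (paramSpace K n lam) (paramMap K n lam)) ↔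
      aeval (fun k : Fin (n + 1) => genericMoment K lam k) F = 0 := by
  rw [← aeval_comp_paramMap hpos hsum, ← mem_coneIdeal_paramSpace hsum, mem_coneIdeal,
    mem_coneIdeal]
  constructor
  · intro h v hv
    rw [eval_aeval]
    apply h
    intro h0
    have hv0 : v ≠ 0 := by
      rintro rfl
      apply h0
      funext k
      have := eval_paramMap_smul (K := K) (n := n) (lam := lam) 0 0 k
      simpa using this
    obtain ⟨a, ha0, ha⟩ := mk_rep_smul _ (rfl : Projectivization.mk K v hv0 = _)
    refine ⟨Projectivization.mk K v hv0, hv hv0, ?_⟩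
    have h1 : (fun k => eval v (paramMap K n lam k)) =
        a • fun k => eval (Projectivization.mk K v hv0).rep (paramMap K n lam k) := by
      conv_lhs => rw [ha]
      funext k
      rw [eval_paramMap_smul]
      rfl
    refine ⟨fun h2 => h0 (by rw [h1, h2, smul_zero]), ?_⟩
    rw [Projectivization.mk_eq_mk_iff']
    exact ⟨a⁻¹, by rw [h1, smul_smul, inv_mul_cancel₀ ha0, one_smul]⟩
  · intro h v hv
    by_cases hv0 : v = 0
    · have := h 0 (zero_mem_cone _)
      rw [eval_aeval] at this
      have h0 : (fun k => eval (0 : JIndex n lam → K) (paramMap K n lam k)) = v := by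
        funext k
        have := eval_paramMap_smul (K := K) (n := n) (lam := lam) 0 0 k
        simpa [hv0] using this
      rwa [h0] at this
    · obtain ⟨p, hp, hne, hpv⟩ := hv hv0
      obtain ⟨a, ha⟩ := (Projectivization.mk_eq_mk_iff' K _ _ hv0 hne).1 hpv.symm
      have := h (a • p.rep) (smul_mem_cone (rep_mem_cone.2 hp) a)
      rw [eval_aeval] at this
      rw [← ha]
      simp only [eval_paramMap_smul] at this
      exact this

end ParamSpace

/-! ### The degree of the parametrization -/

section GenericField

variable (K : Type*) [Field K] {n d : ℕ} (lam : Fin d → ℕ)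

/-- The field of rational functions in the parameters. -/
abbrev ParamField : Type _ := FractionRing (MvPolynomial (ParamIndex lam) K)

/-- The generic node as a rational function. -/
def fieldNode (i : BigPart lam) : ParamField K lam :=
  algebraMap _ _ (node K lam i)

/-- The generic coefficient as a rational function. -/
def fieldCoeff (i : BigPart lam) (j : ℕ) : ParamField K lam :=
  algebraMap _ _ (nodeCoeff K lam i j)

/-- The generic moment as a rational function. -/
def fieldMoment (k : ℕ) : ParamField K lam :=
  algebraMap _ _ (genericMoment K lam k)

variable {K lam}

theorem fieldMoment_eq (k : ℕ) :
    fieldMoment K lam k = moment (order lam) (fieldNode K lam) (fieldCoeff K lam) k :=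
  map_moment _ _ _ _ _

theorem fieldNode_injective : Function.Injective (fieldNode K lam) := by
  intro i j h
  have h1 := IsFractionRing.injective (MvPolynomial (ParamIndex lam) K) (ParamField K lam) h
  exact Sum.inl_injective (X_injective h1)

theorem nodeCoeff_ne_zero (i : BigPart lam) {j : ℕ} (hj : j < order lam i) :
    nodeCoeff K lam i j ≠ 0 := by
  rw [nodeCoeff, dif_pos hj]
  exact X_ne_zero _

theorem fieldCoeff_ne_zero (i : BigPart lam) {j : ℕ} (hj : j < order lam i) :
    fieldCoeff K lam i j ≠ 0 := fun h =>
  nodeCoeff_ne_zero i hj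
    (IsFractionRing.injective (MvPolynomial (ParamIndex lam) K) (ParamField K lam)
      (h.trans (map_zero _).symm))

theorem order_pos (i : BigPart lam) : 1 ≤ order lam i := Nat.succ_le_succ (Nat.zero_le _)

theorem genericMoment_zero_ne_zero [CharZero K] [Nonempty (BigPart lam)] :
    genericMoment K lam 0 ≠ 0 := by
  intro h
  have h1 := aeval_genericMoment (K := K) (fun _ : BigPart lam => (0 : K)) (fun _ _ => 1) 0
  rw [h, map_zero, moment_zero _ _ _ order_pos] at h1
  simp only [Finset.sum_const, Finset.card_univ, nsmul_eq_mul, mul_one] at h1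
  exact Fintype.card_ne_zero (Nat.cast_eq_zero.1 h1.symm)

theorem fieldMoment_zero_ne_zero [CharZero K] [Nonempty (BigPart lam)] :
    fieldMoment K lam 0 ≠ 0 := fun h =>
  genericMoment_zero_ne_zero (K := K) (lam := lam)
    (IsFractionRing.injective (MvPolynomial (ParamIndex lam) K) (ParamField K lam)
      (h.trans (map_zero _).symm))

/-- The nodes and the coefficients generate the field of parameters. -/
theorem eq_top_of_fieldNode_mem {F : Type*} [Field F] [Algebra K F] [Algebra F (ParamField K lam)]
    [IsScalarTower K F (ParamField K lam)] (S : IntermediateField F (ParamField K lam))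
    (hx : ∀ i, fieldNode K lam i ∈ S) (hc : ∀ i, ∀ j < order lam i, fieldCoeff K lam i j ∈ S) :
    S = ⊤ := by
  rw [eq_top_iff]
  rintro z -
  have key : ∀ p : MvPolynomial (ParamIndex lam) K, algebraMap _ (ParamField K lam) p ∈ S := by
    intro p
    induction p using MvPolynomial.induction_on with
    | C a =>
      rw [← algebraMap_eq, ← IsScalarTower.algebraMap_apply K _ (ParamField K lam),
        IsScalarTower.algebraMap_apply K F (ParamField K lam)]
      exact S.algebraMap_mem _
    | add p q hp hq => rw [map_add]; exact S.add_mem hp hq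
    | mul_X p i hp =>
      rw [map_mul]
      refine S.mul_mem hp ?_
      rcases i with i | ⟨i, j⟩
      · exact hx i
      · have := hc i j j.2
        rwa [fieldCoeff, nodeCoeff, dif_pos j.2] at this
  obtain ⟨a, b, -, rfl⟩ := IsFractionRing.div_surjective (A := MvPolynomial (ParamIndex lam) K) z
  exact S.div_mem (key a) (key b)

variable [CharZero K]

/-- The parameters are algebraic over every subdomain that contains the moments. -/
theorem isAlgebraic_of_moment_mem (hpos : ∀ i, 1 ≤ lam i) (hsum : ∑ i, lam i = n)
    {A : Type*} [CommRing A] [IsDomain A] [Algebra K A] [Algebra A (ParamField K lam)]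
    [IsScalarTower K A (ParamField K lam)] [FaithfulSMul A (ParamField K lam)]
    (h : ∀ k ≤ n, ∃ a, algebraMap A (ParamField K lam) a = fieldMoment K lam k) :
    Algebra.IsAlgebraic A (ParamField K lam) := by
  let _ : Algebra (FractionRing A) (ParamField K lam) := FractionRing.liftAlgebra A _
  have : IsScalarTower A (FractionRing A) (ParamField K lam) :=
    FractionRing.isScalarTower_liftAlgebra A _
  have : IsScalarTower K (FractionRing A) (ParamField K lam) := by
    refine IsScalarTower.of_algebraMap_eq fun a => ?_
    rw [IsScalarTower.algebraMap_apply K A (ParamField K lam),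
      IsScalarTower.algebraMap_apply K A (FractionRing A),
      ← IsScalarTower.algebraMap_apply A (FractionRing A) (ParamField K lam)]
  rw [IsFractionRing.comap_isAlgebraic_iff (K := FractionRing A)]
  have hs := sum_order_add_card hpos hsum
  have : Algebra.IsSeparable (FractionRing A) (ParamField K lam) := by
    refine isSeparable_of_moment_mem (n := n) (r := order lam) (x := fieldNode K lam)
      (c := fieldCoeff K lam) (by omega) order_pos fieldNode_injective
      (fun i => fieldCoeff_ne_zero i (by have := order_pos i; omega)) ?_ ?_
    · intro k hk
      obtain ⟨a, ha⟩ := h k hk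
      refine ⟨algebraMap A _ a, ?_⟩
      rw [← IsScalarTower.algebraMap_apply, ha, fieldMoment_eq]
    · refine eq_top_of_fieldNode_mem (K := K) _ (fun i => ?_) fun i j hj => ?_
      · exact IntermediateField.subset_adjoin _ _ (Or.inl ⟨i, rfl⟩)
      · exact IntermediateField.subset_adjoin _ _ (Or.inr ⟨i, j, hj, rfl⟩)
  infer_instance

end GenericField

section Degree

variable {K : Type*} [Field K] {n d : ℕ} {lam : Fin d → ℕ}

/-- The permutation of the parameters that is induced by a permutation of the parts. -/
def paramPerm (π : Equiv.Perm (BigPart lam)) (h : ∀ i, order lam (π i) = order lam i) :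
    Equiv.Perm (ParamIndex lam) :=
  Equiv.sumCongr π (Equiv.sigmaCongr π fun i => finCongr (h i).symm)

theorem algHom_rename_injective (π : Equiv.Perm (BigPart lam))
    (h : ∀ i, order lam (π i) = order lam i) :
    Function.Injective ((Algebra.algHom K (MvPolynomial (ParamIndex lam) K)
      (ParamField K lam)).comp (rename (paramPerm π h))) := by
  rw [AlgHom.coe_comp]
  exact (IsFractionRing.injective (MvPolynomial (ParamIndex lam) K) (ParamField K lam)).comp
    (rename_injective _ (paramPerm π h).injective)

/-- The automorphism of the field of parameters that permutes the parts. -/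
def permAut (π : Equiv.Perm (BigPart lam)) (h : ∀ i, order lam (π i) = order lam i) :
    ParamField K lam →ₐ[K] ParamField K lam :=
  IsFractionRing.liftAlgHom (algHom_rename_injective (K := K) π h)

theorem permAut_algebraMap (π : Equiv.Perm (BigPart lam))
    (h : ∀ i, order lam (π i) = order lam i) (p : MvPolynomial (ParamIndex lam) K) :
    permAut π h (algebraMap _ (ParamField K lam) p) =
      algebraMap _ _ (rename (paramPerm π h) p) := by
  rw [permAut, IsFractionRing.liftAlgHom_apply, IsFractionRing.lift_algebraMap]
  rfl

theorem permAut_fieldNode (π : Equiv.Perm (BigPart lam))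
    (h : ∀ i, order lam (π i) = order lam i) (i : BigPart lam) :
    permAut (K := K) π h (fieldNode K lam i) = fieldNode K lam (π i) := by
  rw [fieldNode, permAut_algebraMap, node, rename_X]
  rfl

theorem permAut_fieldCoeff (π : Equiv.Perm (BigPart lam))
    (h : ∀ i, order lam (π i) = order lam i) (i : BigPart lam) (j : ℕ) :
    permAut (K := K) π h (fieldCoeff K lam i j) = fieldCoeff K lam (π i) j := by
  rw [fieldCoeff, permAut_algebraMap, fieldCoeff]
  by_cases hj : j < order lam i
  · rw [nodeCoeff, nodeCoeff, dif_pos hj, dif_pos ((h i).symm ▸ hj), rename_X]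
    rfl
  · rw [nodeCoeff, nodeCoeff, dif_neg hj, dif_neg ((h i).symm ▸ hj), map_zero]

theorem permAut_fieldMoment (π : Equiv.Perm (BigPart lam))
    (h : ∀ i, order lam (π i) = order lam i) (k : ℕ) :
    permAut (K := K) π h (fieldMoment K lam k) = fieldMoment K lam k := by
  have h1 := map_moment (permAut (K := K) π h).toRingHom (order lam) (fieldNode K lam)
    (fieldCoeff K lam) k
  rw [fieldMoment_eq]
  refine h1.trans ?_
  simp only [AlgHom.toRingHom_eq_coe, RingHom.coe_coe, permAut_fieldNode, permAut_fieldCoeff]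
  exact moment_reindex _ _ _ π h k

variable (K n lam)

/-- The field generated by the ratios of the moments. -/
def momentField : IntermediateField K (ParamField K lam) :=
  IntermediateField.adjoin K
    {z | ∃ k l : Fin (n + 1), z = fieldMoment K lam k / fieldMoment K lam l}

/-- The nodes and the normalized coefficients. -/
def normalizedParams : Set (ParamField K lam) :=
  Set.range (fieldNode K lam) ∪
    {z | ∃ i, ∃ j < order lam i, z = fieldCoeff K lam i j / fieldMoment K lam 0}

/-- The field generated by the nodes and the normalized coefficients, as an extension of the field
generated by the ratios of the moments. -/
abbrev normalizedField : IntermediateField (momentField K n lam) (ParamField K lam) :=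
  IntermediateField.adjoin (momentField K n lam) (normalizedParams K lam)

variable {K n lam}

theorem moment_normalized (k : ℕ) :
    moment (order lam) (fieldNode K lam)
      (fun i j => fieldCoeff K lam i j / fieldMoment K lam 0) k =
      fieldMoment K lam k / fieldMoment K lam 0 := by
  simp only [div_eq_inv_mul]
  rw [moment_mul_left, ← fieldMoment_eq]

theorem div_mem_momentField (k : ℕ) (hk : k ≤ n) :
    fieldMoment K lam k / fieldMoment K lam 0 ∈ momentField K n lam :=
  IntermediateField.subset_adjoin _ _ ⟨⟨k, by omega⟩, 0, rfl⟩

theorem adjoin_eq_top {F L : Type*} [Field F] [Field L] [Algebra F L] (S : Set L) :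
    IntermediateField.adjoin F (Subtype.val ⁻¹' S : Set (IntermediateField.adjoin F S)) = ⊤ := by
  apply IntermediateField.lift_injective
  rw [IntermediateField.lift_adjoin, IntermediateField.lift_top]
  congr 1
  ext z
  constructor
  · rintro ⟨y, hy, rfl⟩
    exact hy
  · exact fun hz => ⟨⟨z, IntermediateField.subset_adjoin F S hz⟩, hz, rfl⟩

/-- The generic node, as an element of the field generated by the normalized parameters. -/
def subNode (i : BigPart lam) :
    normalizedField K n lam :=
  ⟨fieldNode K lam i, IntermediateField.subset_adjoin _ _ (Or.inl ⟨i, rfl⟩)⟩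

/-- The normalized generic coefficient, as an element of the field generated by the normalized
parameters. -/
def subCoeff (i : BigPart lam) (j : ℕ) :
    normalizedField K n lam :=
  if hj : j < order lam i then ⟨fieldCoeff K lam i j / fieldMoment K lam 0,
    IntermediateField.subset_adjoin _ _ (Or.inr ⟨i, j, hj, rfl⟩)⟩ else 0

theorem coe_subCoeff (i : BigPart lam) {j : ℕ} (hj : j < order lam i) :
    (subCoeff (K := K) (n := n) i j : ParamField K lam) =
      fieldCoeff K lam i j / fieldMoment K lam 0 := by
  rw [subCoeff, dif_pos hj]

theorem coe_moment_sub (k : ℕ) :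
    ((moment (order lam) subNode subCoeff k : normalizedField K n lam) : ParamField K lam) =
      fieldMoment K lam k / fieldMoment K lam 0 := by
  rw [← moment_normalized]
  have := map_moment (algebraMap (normalizedField K n lam) (ParamField K lam)) (order lam)
    subNode subCoeff k
  refine this.trans ?_
  exact moment_congr (fun i j hj => coe_subCoeff i hj) k

theorem moment_sub (k : ℕ) (hk : k ≤ n) :
    algebraMap (momentField K n lam) _ ⟨_, div_mem_momentField k hk⟩ =
      moment (order lam) (subNode (K := K) (n := n)) subCoeff k :=
  Subtype.ext (coe_moment_sub k).symm

theorem adjoin_sub_eq_top : IntermediateField.adjoin (momentField K n lam)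
    (Set.range subNode ∪
      {z : normalizedField K n lam | ∃ i, ∃ j < order lam i, z = subCoeff i j}) = ⊤ := by
  rw [← adjoin_eq_top (F := momentField K n lam) (normalizedParams K lam)]
  congr 1
  ext z
  constructor
  · rintro (⟨i, rfl⟩ | ⟨i, j, hj, rfl⟩)
    · exact Or.inl ⟨i, rfl⟩
    · exact Or.inr ⟨i, j, hj, coe_subCoeff i hj⟩
  · rintro (⟨i, hi⟩ | ⟨i, j, hj, hz⟩)
    · exact Or.inl ⟨i, Subtype.ext hi⟩
    · exact Or.inr ⟨i, j, hj, Subtype.ext (hz.trans (coe_subCoeff i hj).symm)⟩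

/-- The embedding over the field of moment ratios that permutes the summands. -/
def permEmb (π : Equiv.Perm (BigPart lam)) (h : ∀ i, order lam (π i) = order lam i) :
    normalizedField K n lam
      →ₐ[momentField K n lam] AlgebraicClosure (ParamField K lam) where
  toRingHom := ((algebraMap (ParamField K lam) (AlgebraicClosure (ParamField K lam))).comp
    (permAut (K := K) π h).toRingHom).comp (algebraMap (normalizedField K n lam) (ParamField K lam))
  commutes' := by
    intro z
    have hz : permAut π h (z : ParamField K lam) = z := by
      obtain ⟨z, hz⟩ := z
      induction hz using IntermediateField.adjoin_induction with
      | mem s hs =>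
        obtain ⟨k, l, rfl⟩ := hs
        simp [permAut_fieldMoment]
      | algebraMap a => exact (permAut π h).commutes a
      | add a b _ _ ha hb => simpa using congrArg₂ (· + ·) ha hb
      | inv a _ ha => simpa using congrArg (·⁻¹) ha
      | mul a b _ _ ha hb => simpa using congrArg₂ (· * ·) ha hb
    exact congrArg (algebraMap (ParamField K lam) (AlgebraicClosure (ParamField K lam))) hz

theorem permEmb_apply (π : Equiv.Perm (BigPart lam)) (h : ∀ i, order lam (π i) = order lam i)
    (z : normalizedField K n lam) :
    permEmb π h z = algebraMap (ParamField K lam) (AlgebraicClosure (ParamField K lam))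
      (permAut π h (z : ParamField K lam)) := rfl

variable (K n lam)

/-- The generic point of the parameter space over the field of parameters. -/
def fieldPoint (j : JIndex n lam) : ParamField K lam :=
  algebraMap _ _ (genericPoint K n lam j)

variable {K n lam}

theorem fieldPoint_eq (j : JIndex n lam) :
    fieldPoint K n lam j = fieldNode K lam j.1 ^ (j.2.1 : ℕ) *
      blockCoeff K n (lam j.1 - 2) j.2.2 (fieldNode K lam j.1) (fieldCoeff K lam j.1) := by
  rw [fieldPoint, genericPoint, map_mul, map_pow]
  congr 1
  exact map_blockCoeff (Algebra.algHom K (MvPolynomial (ParamIndex lam) K) (ParamField K lam)) _ _ _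
    _ _

theorem fieldPoint_zero (i : BigPart lam) :
    fieldPoint K n lam ⟨i, (0, 0)⟩ = fieldCoeff K lam i 0 := by
  simp [fieldPoint_eq, blockCoeff]

theorem fieldPoint_one (i : BigPart lam) :
    fieldPoint K n lam ⟨i, (1, 0)⟩ = fieldNode K lam i * fieldCoeff K lam i 0 := by
  have : ((1 : Fin (n - lam i + 2 + 1)) : ℕ) = 1 := by simp
  simp [fieldPoint_eq, blockCoeff]

variable [CharZero K]

/-- Derivations of the algebraic closure of the field of parameters can be prescribed on the
parameters. -/
theorem exists_derivation_algebraicClosure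
    (a : BigPart lam → AlgebraicClosure (ParamField K lam))
    (b : BigPart lam → ℕ → AlgebraicClosure (ParamField K lam)) :
    ∃ D : Derivation K (AlgebraicClosure (ParamField K lam)) (AlgebraicClosure (ParamField K lam)),
      (∀ i, D (algebraMap _ _ (fieldNode K lam i)) = a i) ∧
      ∀ i, ∀ j < order lam i, D (algebraMap _ _ (fieldCoeff K lam i j)) = b i j := by
  have : Algebra.FormallyEtale (MvPolynomial (ParamIndex lam) K) (ParamField K lam) :=
    .of_isLocalization (nonZeroDivisors _)
  have : Algebra.FormallyEtale (ParamField K lam) (AlgebraicClosure (ParamField K lam)) :=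
    .of_isSeparable _ _
  have : Algebra.FormallyEtale (MvPolynomial (ParamIndex lam) K)
      (AlgebraicClosure (ParamField K lam)) := .comp _ (ParamField K lam) _
  obtain ⟨D, hD⟩ := exists_derivation_extension
    (mkDerivation K (paramValue a b) : Derivation K (MvPolynomial (ParamIndex lam) K)
      (AlgebraicClosure (ParamField K lam)))
  refine ⟨D, fun i => ?_, fun i j hj => ?_⟩
  · rw [fieldNode, ← IsScalarTower.algebraMap_apply, hD, node, mkDerivation_X]
    rfl
  · rw [fieldCoeff, ← IsScalarTower.algebraMap_apply, hD, nodeCoeff, dif_pos hj, mkDerivation_X]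
    rfl

/-- Every conjugate of the generic decomposition is obtained by a permutation of the summands. -/
theorem exists_perm_of_algHom [Nonempty (BigPart lam)] (hpos : ∀ i, 1 ≤ lam i)
    (hsum : ∑ i, lam i = n)
    (σ : normalizedField K n lam
      →ₐ[momentField K n lam] AlgebraicClosure (ParamField K lam)) :
    ∃ π : Equiv.Perm (BigPart lam), (∀ i, order lam (π i) = order lam i) ∧
      (∀ i, σ (subNode i) = algebraMap _ _ (fieldNode K lam (π i))) ∧
      ∀ i, ∀ j < order lam i, σ (subCoeff i j) =
        algebraMap _ _ (fieldCoeff K lam (π i) j / fieldMoment K lam 0) := by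
  let em := algebraMap (ParamField K lam) (AlgebraicClosure (ParamField K lam))
  have hs := sum_order_add_card hpos hsum
  have h0 : em (fieldMoment K lam 0) ≠ 0 := by
    rw [Ne, map_eq_zero]
    exact fieldMoment_zero_ne_zero
  have hσ : ∀ k ≤ n, moment (order lam) (fun i => σ (subNode i)) (fun i j => σ (subCoeff i j)) k =
      em (fieldMoment K lam k / fieldMoment K lam 0) := by
    intro k hk
    refine (map_moment σ.toRingHom (order lam) subNode subCoeff k).symm.trans ?_
    rw [← moment_sub k hk]
    exact σ.commutes _
  have h1 : ∀ k ≤ n, moment (order lam) (fun i => em (fieldNode K lam i))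
      (fun i j => em (fieldCoeff K lam i j)) k = moment (order lam) (fun i => σ (subNode i))
      (fun i j => em (fieldMoment K lam 0) * σ (subCoeff i j)) k := by
    intro k hk
    rw [moment_mul_left, hσ k hk, ← map_moment em, ← fieldMoment_eq, map_div₀,
      mul_div_cancel₀ _ h0]
  have hinj : Function.Injective fun i => em (fieldNode K lam i) :=
    em.injective.comp fieldNode_injective
  have hinj' : Function.Injective fun i => σ (subNode i) := fun i j hij =>
    fieldNode_injective (congrArg Subtype.val (σ.toRingHom.injective hij))
  have h2 := pow_dvd_of_moment_eq (K := K) (n := n) (r := order lam) (by omega) order_pos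
    (fun i => (map_ne_zero em).2 (fieldCoeff_ne_zero i (by have := order_pos i; omega))) h1
    exists_derivation_algebraicClosure
  obtain ⟨π, hπ, hπo⟩ := exists_perm_of_pow_dvd (s := fun i => order lam i + 1)
    (fun i => by omega) hinj hinj' h2
  have hπo' : ∀ i, order lam (π i) = order lam i := fun i => Nat.succ_injective (hπo i)
  refine ⟨π, hπo', hπ, fun i j hj => ?_⟩
  refine coeff_eq_of_moment_eq hinj' (r := order lam) (n := n) (c := fun i j => σ (subCoeff i j))
    (c' := fun i j => em (fieldCoeff K lam (π i) j / fieldMoment K lam 0)) ?_ ?_ i j hj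
  · rw [Finset.sum_add_distrib] at hs
    omega
  · intro k hk
    rw [hσ k hk, ← moment_normalized, map_moment em]
    have h3 : (fun i => σ (subNode i)) = fun i => em (fieldNode K lam (π i)) := funext hπ
    rw [h3]
    exact (moment_reindex (order lam) (fun i => em (fieldNode K lam i))
      (fun i j => em (fieldCoeff K lam i j / fieldMoment K lam 0)) π hπo' k).symm

/-- The degree is the number of conjugates, and these are the permutations of the summands. -/
theorem finrank_normalizedField [Nonempty (BigPart lam)] (hpos : ∀ i, 1 ≤ lam i)
    (hsum : ∑ i, lam i = n) :
    Module.finrank (momentField K n lam)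
      (normalizedField K n lam) =
      Nat.card {π : Equiv.Perm (BigPart lam) // ∀ i, order lam (π i) = order lam i} := by
  have hs := sum_order_add_card hpos hsum
  have hsep : Algebra.IsSeparable (momentField K n lam)
      (normalizedField K n lam) := by
    refine isSeparable_of_moment_mem (n := n) (r := order lam) (x := subNode)
      (c := subCoeff) (by omega) order_pos (fun i j hij => fieldNode_injective
        (congrArg Subtype.val hij)) (fun i h0 => ?_) (fun k hk => ⟨_, moment_sub k hk⟩)
      adjoin_sub_eq_top
    have hi : order lam i - 1 < order lam i := by have := order_pos i; omega
    have h1 := coe_subCoeff (K := K) (n := n) i hi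
    rw [h0] at h1
    exact div_ne_zero (fieldCoeff_ne_zero i hi) fieldMoment_zero_ne_zero h1.symm
  have halg : Algebra.IsAlgebraic (momentField K n lam) (normalizedField K n lam) :=
    hsep.isAlgebraic
  rw [← Field.finSepDegree_eq_finrank_of_isSeparable,
    Field.finSepDegree_eq_of_isAlgClosed _ _ (AlgebraicClosure (ParamField K lam))]
  symm
  refine Nat.card_eq_of_bijective (fun π => permEmb π.1 π.2) ⟨fun π π' h => ?_, fun σ => ?_⟩
  · refine Subtype.ext (Equiv.ext fun i => fieldNode_injective (K := K) ?_)
    have h1 := DFunLike.congr_fun h (subNode i)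
    simp only [permEmb_apply] at h1
    have h2 := (algebraMap (ParamField K lam) (AlgebraicClosure (ParamField K lam))).injective h1
    rwa [subNode, permAut_fieldNode, permAut_fieldNode] at h2
  · obtain ⟨π, hπo, hπ, hπc⟩ := exists_perm_of_algHom hpos hsum σ
    refine ⟨⟨π, hπo⟩, IntermediateField.adjoin_algHom_ext _ ?_⟩
    rintro z (⟨i, rfl⟩ | ⟨i, j, hj, rfl⟩)
    · refine Eq.trans ?_ (hπ i).symm
      rw [permEmb_apply, permAut_fieldNode]
    · have h1 := hπc i j hj
      rw [subCoeff, dif_pos hj] at h1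
      rw [h1, permEmb_apply, map_div₀, permAut_fieldCoeff, permAut_fieldMoment]

/-- The function field of the parameter space is generated by the nodes and the normalized
coefficients. -/
theorem adjoin_fieldPoint_ratios [Nonempty (BigPart lam)] (hsum : ∑ i, lam i = n) :
    IntermediateField.adjoin K {z | ∃ j j', z = fieldPoint K n lam j / fieldPoint K n lam j'} =
      IntermediateField.adjoin K (normalizedParams K lam) := by
  have h0 : fieldMoment K lam 0 ≠ 0 := fieldMoment_zero_ne_zero
  apply le_antisymm
  · rw [IntermediateField.adjoin_le_iff]
    set S := IntermediateField.adjoin K (normalizedParams K lam)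
    have key : ∀ j, fieldPoint K n lam j / fieldMoment K lam 0 ∈ S := by
      intro j
      rw [fieldPoint_eq, mul_div_assoc, div_eq_inv_mul, ← blockCoeff_mul_left]
      have hx : fieldNode K lam j.1 ∈ S := IntermediateField.subset_adjoin _ _ (Or.inl ⟨_, rfl⟩)
      refine S.mul_mem (pow_mem hx _) (blockCoeff_mem S hx fun i hi => ?_)
      rw [← div_eq_inv_mul]
      exact IntermediateField.subset_adjoin _ _ (Or.inr ⟨_, i, lt_of_le_of_lt hi j.2.2.2, rfl⟩)
    rintro _ ⟨j, j', rfl⟩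
    rw [← div_div_div_cancel_right₀ h0]
    exact S.div_mem (key j) (key j')
  · rw [IntermediateField.adjoin_le_iff]
    set S := IntermediateField.adjoin K
      {z | ∃ j j', z = fieldPoint K n lam j / fieldPoint K n lam j'}
    have hS : ∀ j j', fieldPoint K n lam j / fieldPoint K n lam j' ∈ S := fun j j' =>
      IntermediateField.subset_adjoin _ _ ⟨j, j', rfl⟩
    have hc0 : ∀ i : BigPart lam, fieldCoeff K lam i 0 ≠ 0 := fun i =>
      fieldCoeff_ne_zero i (order_pos i)
    have hx : ∀ i, fieldNode K lam i ∈ S := by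
      intro i
      have := hS ⟨i, (1, 0)⟩ ⟨i, (0, 0)⟩
      rwa [fieldPoint_zero, fieldPoint_one, mul_div_cancel_right₀ _ (hc0 i)] at this
    obtain ⟨i₀⟩ := ‹Nonempty (BigPart lam)›
    have hc : ∀ i, ∀ j < order lam i,
        (fieldCoeff K lam i₀ 0)⁻¹ * fieldCoeff K lam i j ∈ S := by
      intro i j hj
      refine mem_of_blockCoeff_mem (n := n) (m := lam i - 2) (K := K)
        (c := fun j => (fieldCoeff K lam i₀ 0)⁻¹ * fieldCoeff K lam i j) S
        ((Nat.sub_le _ _).trans (le_of_sum_eq hsum i)) (hx i) (fun b hb => ?_) j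
        (Nat.lt_succ_iff.1 hj)
      have := hS ⟨i, (0, ⟨b, Nat.lt_succ_iff.2 hb⟩)⟩ ⟨i₀, (0, 0)⟩
      rw [fieldPoint_zero, fieldPoint_eq, div_eq_inv_mul] at this
      rw [blockCoeff_mul_left]
      simpa using this
    have hg : (fieldCoeff K lam i₀ 0)⁻¹ * fieldMoment K lam 0 ∈ S := by
      rw [fieldMoment_eq, moment_zero _ _ _ order_pos, Finset.mul_sum]
      exact S.sum_mem fun i _ => hc i 0 (order_pos i)
    rintro z (⟨i, rfl⟩ | ⟨i, j, hj, rfl⟩)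
    · exact hx i
    · rw [← mul_div_mul_left _ _ (inv_ne_zero (hc0 i₀))]
      exact S.div_mem (hc i j hj) hg

theorem momentField_le [Nonempty (BigPart lam)] :
    momentField K n lam ≤ IntermediateField.adjoin K (normalizedParams K lam) := by
  have h0 : fieldMoment K lam 0 ≠ 0 := fieldMoment_zero_ne_zero
  rw [momentField, IntermediateField.adjoin_le_iff]
  set S := IntermediateField.adjoin K (normalizedParams K lam)
  have key : ∀ k, fieldMoment K lam k / fieldMoment K lam 0 ∈ S := by
    intro k
    rw [← moment_normalized]
    refine S.sum_mem fun i _ => S.sum_mem fun j hj => S.mul_mem ?_ (S.mul_mem (natCast_mem S _)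
      (pow_mem ?_ _))
    · exact IntermediateField.subset_adjoin _ _ (Or.inr ⟨i, j, Finset.mem_range.1 hj, rfl⟩)
    · exact IntermediateField.subset_adjoin _ _ (Or.inl ⟨i, rfl⟩)
  rintro _ ⟨k, l, rfl⟩
  rw [← div_div_div_cancel_right₀ h0]
  exact S.div_mem (key k) (key l)

/-- The function field of the cone over the parameter space embeds into the field of parameters,
by evaluation at the generic point. -/
theorem exists_coneField_algHom (hsum : ∑ i, lam i = n) :
    ∃ ι : ConeField (paramSpace K n lam) →ₐ[K] ParamField K lam,
      ∀ F, ι (toConeField (paramSpace K n lam) F) =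
        algebraMap _ _ (aeval (genericPoint K n lam) F) := by
  let ψ : CoordRing (paramSpace K n lam) →ₐ[K] ParamField K lam :=
    Ideal.Quotient.liftₐ (coneIdeal (paramSpace K n lam))
      ((Algebra.algHom K (MvPolynomial (ParamIndex lam) K) (ParamField K lam)).comp
        (aeval (genericPoint K n lam))) fun F hF => by
          rw [AlgHom.comp_apply, (mem_coneIdeal_paramSpace hsum).1 hF, map_zero]
  have hψ : ∀ F, ψ (Ideal.Quotient.mk _ F) = algebraMap _ _ (aeval (genericPoint K n lam) F) :=
    fun F => rfl
  have hinj : Function.Injective ψ := by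
    rw [injective_iff_map_eq_zero]
    intro a ha
    obtain ⟨F, rfl⟩ := Ideal.Quotient.mk_surjective a
    rw [hψ] at ha
    rw [Ideal.Quotient.eq_zero_iff_mem, mem_coneIdeal_paramSpace hsum]
    exact IsFractionRing.injective (MvPolynomial (ParamIndex lam) K) (ParamField K lam)
      (ha.trans (map_zero _).symm)
  refine ⟨IsFractionRing.liftAlgHom hinj, fun F => ?_⟩
  rw [toConeField, IsFractionRing.liftAlgHom_apply, IsFractionRing.lift_algebraMap]
  exact hψ F

/-- The degree of the rational map is the number of permutations of the summands that preserve the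
orders. Without parts `λ_i ≠ 1` both sides are `1`. -/
theorem ratDegree_paramMap_eq_card (hpos : ∀ i, 1 ≤ lam i) (hsum : ∑ i, lam i = n) :
    ratDegree (paramSpace K n lam) (paramMap K n lam) =
      Nat.card {π : Equiv.Perm (BigPart lam) // ∀ i, order lam (π i) = order lam i} := by
  obtain ⟨ι, hι⟩ := exists_coneField_algHom (K := K) hsum
  have hF : (ratioField (paramSpace K n lam) (paramMap K n lam)).map ι = momentField K n lam := by
    rw [ratioField, IntermediateField.adjoin_map, momentField]
    congr 1
    ext z
    constructor
    · rintro ⟨_, ⟨k, l, rfl⟩, rfl⟩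
      refine ⟨k, l, ?_⟩
      rw [map_div₀, hι, hι, aeval_genericPoint_paramMap hpos hsum,
        aeval_genericPoint_paramMap hpos hsum]
      rfl
    · rintro ⟨k, l, rfl⟩
      refine ⟨_, ⟨k, l, rfl⟩, ?_⟩
      rw [map_div₀, hι, hι, aeval_genericPoint_paramMap hpos hsum,
        aeval_genericPoint_paramMap hpos hsum]
      rfl
  have hL : (functionField (paramSpace K n lam)).map ι = IntermediateField.adjoin K
      {z | ∃ j j', z = fieldPoint K n lam j / fieldPoint K n lam j'} := by
    rw [functionField, ratioField, IntermediateField.adjoin_map]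
    congr 1
    ext z
    constructor
    · rintro ⟨_, ⟨k, l, rfl⟩, rfl⟩
      refine ⟨k, l, ?_⟩
      rw [map_div₀, hι, hι, aeval_X, aeval_X]
      rfl
    · rintro ⟨k, l, rfl⟩
      refine ⟨_, ⟨k, l, rfl⟩, ?_⟩
      rw [map_div₀, hι, hι, aeval_X, aeval_X]
      rfl
  rw [ratDegree, ← IntermediateField.relfinrank_map_map _ _ ι, hF, hL]
  rcases isEmpty_or_nonempty (BigPart lam) with he | hne
  · have h1 : {z | ∃ j j', z = fieldPoint K n lam j / fieldPoint K n lam j'} = ∅ := by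
      ext z
      simp only [Set.mem_empty_iff_false, iff_false]
      rintro ⟨j, -⟩
      exact IsEmpty.false j.1
    rw [h1, IntermediateField.adjoin_empty, IntermediateField.relfinrank_eq_one_iff.2 bot_le]
    have : Subsingleton {π : Equiv.Perm (BigPart lam) // ∀ i, order lam (π i) = order lam i} :=
      inferInstance
    exact (Nat.card_eq_one_iff_unique.2 ⟨this, ⟨⟨1, fun i => rfl⟩⟩⟩).symm
  · rw [adjoin_fieldPoint_ratios hsum,
      IntermediateField.relfinrank_eq_finrank_of_le momentField_le,
      IntermediateField.extendScalars_adjoin momentField_le, finrank_normalizedField hpos hsum]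

end Degree

/-! ### The dimension and the fibres of the parametrization -/

theorem mk_mem_zariskiClosure {K σ : Type*} [Field K] {X : Set (ℙ K (σ → K))} {v : σ → K}
    (hv : v ≠ 0) : Projectivization.mk K v hv ∈ zariskiClosure X ↔
      ∀ F ∈ coneIdeal X, eval v F = 0 := by
  obtain ⟨a, ha0, ha⟩ := mk_rep_smul _ (rfl : Projectivization.mk K v hv = _)
  constructor
  · intro h F hF
    rw [ha, ← eval_dilate]
    exact h _ (dilate_mem_coneIdeal hF a)
  · intro h F hF
    have h1 := h _ (dilate_mem_coneIdeal hF a⁻¹)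
    rwa [eval_dilate, ha, smul_smul, inv_mul_cancel₀ ha0, one_smul] at h1

/-- The projective hypersurface cut out by all homogeneous components of a polynomial. -/
def hypersurface {K σ : Type*} [Field K] (A : MvPolynomial σ K) : Set (ℙ K (σ → K)) :=
  {q | ∀ (v : σ → K) (hv : v ≠ 0), Projectivization.mk K v hv = q → eval v A = 0}

theorem zariskiClosure_hypersurface {K σ : Type*} [Field K] (A : MvPolynomial σ K) :
    zariskiClosure (hypersurface A) = hypersurface A := by
  refine Set.Subset.antisymm (fun p hp v hv hvp => ?_) (subset_zariskiClosure _)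
  obtain ⟨a, ha0, ha⟩ := mk_rep_smul p hvp
  obtain ⟨k, hk⟩ := Function.ne_iff.1 p.rep_nonzero
  -- the factor `X k` takes care of the origin, which belongs to every cone
  have hF : dilate a A * X k ∈ coneIdeal (hypersurface A) := by
    refine mem_coneIdeal.2 fun w hw => ?_
    by_cases h0 : w = 0
    · simp [h0]
    · rw [map_mul, eval_dilate, hw h0 _ (smul_ne_zero ha0 h0) (mk_smul_eq h0 ha0), zero_mul]
  have h1 := hp _ hF
  rw [map_mul, eval_dilate, ← ha, eval_X] at h1
  exact (mul_eq_zero.1 h1).resolve_right hk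

section MomentAlgebra

variable (K : Type*) [Field K] (n : ℕ) {d : ℕ} (lam : Fin d → ℕ)

/-- The substitution of the generic moments for the coordinates of `ℙⁿ`. -/
def momentHom : MvPolynomial (Fin (n + 1)) K →ₐ[K] MvPolynomial (ParamIndex lam) K :=
  aeval fun k : Fin (n + 1) => genericMoment K lam k

variable {K n lam}

theorem eval_momentHom (F : MvPolynomial (Fin (n + 1)) K) (z : ParamIndex lam → K) :
    eval z (momentHom K n lam F) = eval (fun k : Fin (n + 1) => eval z (genericMoment K lam k)) F :=
  eval_aeval _ _ _

variable [CharZero K]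

theorem isAlgebraic_momentHom_range (hpos : ∀ i, 1 ≤ lam i) (hsum : ∑ i, lam i = n) :
    Algebra.IsAlgebraic (momentHom K n lam).range (MvPolynomial (ParamIndex lam) K) := by
  have h1 : Algebra.IsAlgebraic (momentHom K n lam).range (ParamField K lam) := by
    have : FaithfulSMul (momentHom K n lam).range (ParamField K lam) := by
      rw [faithfulSMul_iff_algebraMap_injective]
      exact (IsFractionRing.injective (MvPolynomial (ParamIndex lam) K) (ParamField K lam)).comp
        Subtype.val_injective
    refine isAlgebraic_of_moment_mem hpos hsum fun k hk => ?_
    refine ⟨⟨genericMoment K lam k, X ⟨k, by omega⟩, ?_⟩, rfl⟩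
    exact aeval_X _ _
  refine ⟨fun p => ?_⟩
  rw [← isAlgebraic_algebraMap_iff
    (IsFractionRing.injective (MvPolynomial (ParamIndex lam) K) (ParamField K lam))]
  exact h1.isAlgebraic _

/-- The homogeneous coordinate ring is generated by the moments, over which all the parameters are
algebraic. Their number is the sum of the parts `λ_i ≠ 1`. -/
theorem hasProjDim_of_mem_coneIdeal_iff (hpos : ∀ i, 1 ≤ lam i) (hsum : ∑ i, lam i = n)
    {Y : Set (ℙ K (Fin (n + 1) → K))} (hY : ∀ F, F ∈ coneIdeal Y ↔ momentHom K n lam F = 0) :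
    HasProjDim Y ((n : ℤ) - (Finset.univ.filter fun i => lam i = 1).card - 1) := by
  have hs := sum_order_add_card hpos hsum
  refine ⟨∑ i : BigPart lam, (order lam i + 1), ?_, by omega⟩
  have hcard : Fintype.card (BigPart lam) + ∑ i : BigPart lam, Fintype.card (Fin (order lam i)) =
      ∑ i : BigPart lam, (order lam i + 1) := by
    rw [Finset.sum_add_distrib, Finset.sum_const, Finset.card_univ, smul_eq_mul, mul_one, add_comm]
    simp only [Fintype.card_fin]
  have hker : coneIdeal Y = RingHom.ker (momentHom K n lam) := by
    ext F
    rw [hY, RingHom.mem_ker]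
  have e : CoordRing Y ≃ₐ[K] (momentHom K n lam).range :=
    (Ideal.quotientEquivAlgOfEq K hker).trans (Ideal.quotientKerEquivRange _)
  have := isAlgebraic_momentHom_range (K := K) hpos hsum
  have h1 := trdeg_add_eq K (momentHom K n lam).range (A := MvPolynomial (ParamIndex lam) K)
  rw [e.trdeg_eq, ← add_zero (Algebra.trdeg K _), ← trdeg_eq_zero
    (R := (momentHom K n lam).range) (A := MvPolynomial (ParamIndex lam) K), h1,
    MvPolynomial.trdeg_of_isDomain, Cardinal.mk_fintype, Fintype.card_sum, Fintype.card_sigma,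
    hcard, Cardinal.lift_natCast]

/-- Every coordinate of the generic point of the parameter space is algebraic over the moments.
The leading coefficient of an algebraic equation does not vanish identically. -/
theorem exists_relation (hpos : ∀ i, 1 ≤ lam i) (hsum : ∑ i, lam i = n) (j : JIndex n lam) :
    ∃ (R : Polynomial (MvPolynomial (Fin (n + 1)) K)) (A : MvPolynomial (Fin (n + 1)) K),
      momentHom K n lam A ≠ 0 ∧ (∀ v, eval v A ≠ 0 → R.map (eval v) ≠ 0) ∧
      ∀ v ∈ cone (paramSpace K n lam),
        (R.map (eval fun k => eval v (paramMap K n lam k))).eval (v j) = 0 := by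
  obtain ⟨Q, hQ0, hQ⟩ := (isAlgebraic_momentHom_range (K := K) hpos hsum).isAlgebraic
    (genericPoint K n lam j)
  obtain ⟨R, hR⟩ := Polynomial.map_surjective (momentHom K n lam).rangeRestrict.toRingHom
    (momentHom K n lam).rangeRestrict_surjective Q
  refine ⟨R, R.coeff Q.natDegree, fun h0 => ?_, fun v hv h0 => hv ?_, fun v hv => ?_⟩
  · apply hQ0
    rw [← Polynomial.leadingCoeff_eq_zero, Polynomial.leadingCoeff, ← hR, Polynomial.coeff_map, hR]
    exact Subtype.ext h0
  · rw [← Polynomial.coeff_map, h0, Polynomial.coeff_zero]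
  · let E : MvPolynomial (JIndex n lam) K := R.eval₂ (aeval (paramMap K n lam) :
      MvPolynomial (Fin (n + 1)) K →ₐ[K] _).toRingHom (X j)
    have hE : E ∈ coneIdeal (paramSpace K n lam) := by
      rw [mem_coneIdeal_paramSpace hsum]
      have h1 : aeval (genericPoint K n lam) E = R.eval₂
          (((aeval (genericPoint K n lam) : MvPolynomial (JIndex n lam) K →ₐ[K] _)).toRingHom.comp
          (aeval (paramMap K n lam) : MvPolynomial (Fin (n + 1)) K →ₐ[K] _).toRingHom)
          (genericPoint K n lam j) := by
        have := Polynomial.hom_eval₂ R (aeval (paramMap K n lam) :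
          MvPolynomial (Fin (n + 1)) K →ₐ[K] _).toRingHom
          (aeval (genericPoint K n lam) : MvPolynomial (JIndex n lam) K →ₐ[K] _).toRingHom (X j)
        refine this.trans ?_
        congr 1
        exact aeval_X _ _
      have h2 :
          ((aeval (genericPoint K n lam) : MvPolynomial (JIndex n lam) K →ₐ[K] _)).toRingHom.comp
          (aeval (paramMap K n lam) : MvPolynomial (Fin (n + 1)) K →ₐ[K] _).toRingHom =
          (momentHom K n lam).toRingHom :=
        RingHom.ext fun F => aeval_comp_paramMap hpos hsum F
      rw [h1, h2, ← hQ, ← hR, Polynomial.aeval_def, Polynomial.eval₂_map]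
      rfl
    have h3 := mem_coneIdeal.1 hE v hv
    rw [Polynomial.eval_map]
    rw [Polynomial.hom_eval₂, eval_X] at h3
    refine Eq.trans ?_ h3
    congr 1
    exact RingHom.ext fun F => (eval_aeval _ _ _).symm

/-- The parametrization has finite fibres over the complement of a hypersurface: outside the zeros
of the leading coefficients, the algebraic equations have finitely many solutions. -/
theorem exists_finite_ratFibre (hpos : ∀ i, 1 ≤ lam i) (hsum : ∑ i, lam i = n)
    {Y : Set (ℙ K (Fin (n + 1) → K))}
    (hY : Y = zariskiClosure (ratImage (paramSpace K n lam) (paramMap K n lam))) :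
    ∃ Z : Set (ℙ K (Fin (n + 1) → K)), zariskiClosure Z = Z ∧ zariskiClosure (Y \ Z) = Y ∧
      ∀ g ∈ Y \ Z, (ratFibre (paramSpace K n lam) (paramMap K n lam) g).Finite := by
  choose R A hA hR hRv using exists_relation (K := K) hpos hsum
  have hAprod : momentHom K n lam (∏ j, A j) ≠ 0 := by
    rw [map_prod, Finset.prod_ne_zero_iff]
    exact fun j _ => hA j
  have hI : ∀ F, F ∈ coneIdeal Y ↔ momentHom K n lam F = 0 := fun F => by
    rw [hY, coneIdeal_zariskiClosure]
    exact mem_coneIdeal_ratImage hpos hsum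
  have hYY : zariskiClosure Y = Y := by
    conv_lhs => rw [hY]
    conv_rhs => rw [hY]
    exact zariskiClosure_eq_of_coneIdeal_eq (coneIdeal_zariskiClosure _)
  refine ⟨hypersurface (∏ j, A j), zariskiClosure_hypersurface _, ?_, fun q hq => ?_⟩
  · conv_rhs => rw [← hYY]
    refine zariskiClosure_eq_of_coneIdeal_eq (le_antisymm (fun F hF => ?_)
      (coneIdeal_anti Set.sdiff_subset))
    rw [hI]
    refine eq_zero_of_eval_ne_zero hAprod fun z hz => ?_
    rw [eval_momentHom] at hz ⊢
    refine mem_coneIdeal.1 hF _ fun h0 => ⟨?_, fun h => hz (h _ h0 rfl)⟩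
    rw [← hYY, mk_mem_zariskiClosure]
    intro G hG
    rw [← eval_momentHom, (hI G).1 hG, map_zero]
  · obtain ⟨-, hqZ⟩ := hq
    simp only [hypersurface, Set.mem_ofPred_eq, not_forall] at hqZ
    obtain ⟨v, hv, hvq, hvA⟩ := hqZ
    rw [map_prod, ← Ne, Finset.prod_ne_zero_iff] at hvA
    have hS : {u : JIndex n lam → K | u ≠ 0 ∧
        ∀ j, u j ∈ ((R j).map (eval v)).rootSet K}.Finite :=
      (Set.Finite.pi fun j => Polynomial.rootSet_finite ((R j).map (eval v)) K).subset
        fun u hu j _ => hu.2 j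
    have := hS.to_subtype
    refine (Set.finite_range fun u : {u : JIndex n lam → K | u ≠ 0 ∧
        ∀ j, u j ∈ ((R j).map (eval v)).rootSet K} =>
          Projectivization.mk K u.1 u.2.1).subset ?_
    rintro p ⟨hp, hne, hpq⟩
    obtain ⟨a, ha⟩ := (Projectivization.mk_eq_mk_iff' K _ _ hv hne).1 (hvq.trans hpq.symm)
    have ha0 : a ≠ 0 := by
      rintro rfl
      exact hv (by rw [← ha, zero_smul])
    have hav : (fun k => eval (a • p.rep) (paramMap K n lam k)) = v := by
      rw [← ha]
      funext k
      exact eval_paramMap_smul _ _ _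
    refine ⟨⟨a • p.rep, smul_ne_zero ha0 p.rep_nonzero, fun j => ?_⟩, ?_⟩
    · rw [Polynomial.mem_rootSet]
      refine ⟨hR j v (hvA j (Finset.mem_univ j)), ?_⟩
      have h1 := hRv j (a • p.rep) (smul_mem_cone (rep_mem_cone.2 hp) a)
      rwa [hav] at h1
    · change Projectivization.mk K (a • p.rep) _ = p
      rw [mk_smul_eq p.rep_nonzero ha0, p.mk_rep]

end MomentAlgebra

/-! ### Dehomogenization and the generic product -/

section Dehomogenize

variable {K : Type*} [Field K]

/-- The dehomogenization of the binary form with coordinate vector `a`. -/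
def toPoly (n : ℕ) (a : Fin (n + 1) → K) : Polynomial K :=
  ∑ k : Fin (n + 1), Polynomial.monomial (k : ℕ) ((n.choose k : K) * a k)

theorem natDegree_toPoly_le (n : ℕ) (a : Fin (n + 1) → K) : (toPoly n a).natDegree ≤ n :=
  Polynomial.natDegree_sum_le_of_forall_le _ _ fun k _ =>
    (Polynomial.natDegree_monomial_le _).trans (by omega)

theorem coeff_toPoly (n : ℕ) (a : Fin (n + 1) → K) (k : Fin (n + 1)) :
    (toPoly n a).coeff k = (n.choose k : K) * a k := by
  rw [toPoly, Polynomial.finsetSum_coeff, Finset.sum_eq_single k]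
  · rw [Polynomial.coeff_monomial_same]
  · intro b _ hb
    exact Polynomial.coeff_monomial_of_ne _ fun h => hb (Fin.ext h.symm)
  · simp

theorem eval_toPoly (n : ℕ) (a : Fin (n + 1) → K) (t : K) :
    (toPoly n a).eval t = ∑ k : Fin (n + 1), (n.choose k : K) * a k * t ^ (k : ℕ) := by
  simp [toPoly, Polynomial.eval_finsetSum, Polynomial.eval_monomial]

theorem pairing_eq_contraction (n : ℕ) (a b : Fin (n + 1) → K) :
    pairing n a b = contraction b (toPoly n a) := by
  rw [contraction_apply, pairing]
  simp only [coeff_toPoly]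

theorem binaryForm_isHomogeneous (n : ℕ) (a : Fin (n + 1) → K) :
    (binaryForm n a).IsHomogeneous n := by
  refine IsHomogeneous.sum _ _ _ fun k _ => ?_
  have h := ((isHomogeneous_C (Fin 2) ((n.choose k : K) * a k)).mul
    ((isHomogeneous_X K (0 : Fin 2)).pow (k : ℕ))).mul
    ((isHomogeneous_X K (1 : Fin 2)).pow (n - k : ℕ))
  convert h using 1
  omega

theorem aeval_binaryForm (n : ℕ) (a : Fin (n + 1) → K) :
    aeval ![Polynomial.X, 1] (binaryForm n a) = toPoly n a := by
  simp [binaryForm, toPoly, map_sum, ← Polynomial.C_mul_X_pow_eq_monomial, algHom_C]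

/-- A form is determined by its degree and its dehomogenization. -/
theorem binaryForm_eq_iff {n : ℕ} {a : Fin (n + 1) → K} {q : MvPolynomial (Fin 2) K}
    (hq : q.IsHomogeneous n) :
    binaryForm n a = q ↔ toPoly n a = aeval ![Polynomial.X, 1] q := by
  constructor
  · rintro rfl
    exact (aeval_binaryForm n a).symm
  · intro h
    rw [← Polynomial.homogenize_eq_of_isHomogeneous hq h.symm]
    exact (Polynomial.homogenize_eq_of_isHomogeneous (binaryForm_isHomogeneous n a)
      (aeval_binaryForm n a)).symm

variable [CharZero K]

theorem choose_ne_zero {n : ℕ} (k : Fin (n + 1)) : (n.choose k : K) ≠ 0 :=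
  Nat.cast_ne_zero.2 (Nat.choose_pos (by omega)).ne'

theorem toPoly_coeff {n : ℕ} {p : Polynomial K} (hp : p.natDegree ≤ n) :
    toPoly n (fun k => (n.choose k : K)⁻¹ * p.coeff k) = p := by
  ext k
  by_cases hk : k ≤ n
  · have := coeff_toPoly n (fun k => (n.choose k : K)⁻¹ * p.coeff k) ⟨k, by omega⟩
    rw [mul_inv_cancel_left₀ (choose_ne_zero _)] at this
    exact this
  · have h1 : p.natDegree < k := by omega
    rw [Polynomial.coeff_eq_zero_of_natDegree_lt h1]
    exact Polynomial.coeff_eq_zero_of_natDegree_lt ((natDegree_toPoly_le n _).trans_lt (by omega))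

end Dehomogenize

section Locus

variable (K : Type*) [Field K] (n : ℕ) {d : ℕ} (lam : Fin d → ℕ)

/-- The generic scalar multiple of a product of powers of linear forms, dehomogenized. -/
def genericProduct : Polynomial (MvPolynomial (Option (Fin d)) K) :=
  Polynomial.C (X none) * ∏ i, (Polynomial.X - Polynomial.C (X (some i))) ^ lam i

/-- The coordinates of the generic product. -/
def productCoord (k : Fin (n + 1)) : MvPolynomial (Option (Fin d)) K :=
  C (n.choose k : K)⁻¹ * (genericProduct K lam).coeff k

variable {K n lam}

theorem eval_productCoord (z : Option (Fin d) → K) (k : Fin (n + 1)) :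
    eval z (productCoord K n lam k) = (n.choose k : K)⁻¹ * (Polynomial.C (z none) *
      ∏ i, (Polynomial.X - Polynomial.C (z (some i))) ^ lam i).coeff k := by
  have h : (genericProduct K lam).map (eval z) = Polynomial.C (z none) *
      ∏ i, (Polynomial.X - Polynomial.C (z (some i))) ^ lam i := by
    simp [genericProduct, Polynomial.map_prod]
  rw [productCoord, map_mul, eval_C, ← h, Polynomial.coeff_map]

theorem natDegree_product_le {R : Type*} [CommRing R] [Nontrivial R] (hsum : ∑ i, lam i = n)
    (a : R) (x : Fin d → R) :
    (Polynomial.C a * ∏ i, (Polynomial.X - Polynomial.C (x i)) ^ lam i).natDegree ≤ n :=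
  (Polynomial.natDegree_C_mul_le _ _).trans ((natDegree_prod_X_sub_C_pow x lam).trans hsum).le

variable [CharZero K]

theorem toPoly_eval_productCoord (hsum : ∑ i, lam i = n) (z : Option (Fin d) → K) :
    toPoly n (fun k => eval z (productCoord K n lam k)) = Polynomial.C (z none) *
      ∏ i, (Polynomial.X - Polynomial.C (z (some i))) ^ lam i := by
  simp only [eval_productCoord]
  exact toPoly_coeff (natDegree_product_le hsum _ _)

theorem sum_productCoord (hsum : ∑ i, lam i = n) (t : K) :
    ∑ k : Fin (n + 1), C ((n.choose k : K) * t ^ (k : ℕ)) * productCoord K n lam k =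
      X none * ∏ i, (C t - X (some i)) ^ lam i := by
  apply MvPolynomial.funext
  intro z
  have h := congrArg (Polynomial.eval t) (toPoly_eval_productCoord (K := K) hsum z)
  rw [eval_toPoly] at h
  simp only [map_sum, map_mul, eval_C, eval_X, map_prod, map_pow, map_sub]
  simp only [Polynomial.eval_mul, Polynomial.eval_C, Polynomial.eval_prod, Polynomial.eval_pow,
    Polynomial.eval_sub, Polynomial.eval_X] at h
  rw [← h]
  exact Finset.sum_congr rfl fun k _ => by ring

/-- The polynomial `∏ (X - x i) ^ (λ_i - 1)`. -/
def cofactor (lam : Fin d → ℕ) (x : Fin d → K) : Polynomial K :=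
  ∏ i, (Polynomial.X - Polynomial.C (x i)) ^ (lam i - 1)

/-- The partial derivatives of the generic product are, up to scalars, the multiples of
`∏ (X - x i) ^ (λ_i - 1)` by the nodal polynomials. -/
theorem toPoly_pderiv_productCoord (hpos : ∀ i, 1 ≤ lam i) (hsum : ∑ i, lam i = n)
    (z : Option (Fin d) → K) (o : Option (Fin d)) :
    toPoly n (fun k => eval z (pderiv o (productCoord K n lam k))) =
      Polynomial.C (o.elim 1 fun i => -(z none * lam i)) *
        (cofactor lam (fun i => z (some i)) * nodal (fun i => z (some i)) o) := by
  apply Polynomial.funext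
  intro t
  have h1 := congrArg (fun p => eval z (pderiv o p)) (sum_productCoord (K := K) hsum t)
  simp only [map_sum, pderiv_C_mul] at h1
  rw [eval_toPoly]
  have h2 : ∑ k : Fin (n + 1), (n.choose k : K) * eval z (pderiv o (productCoord K n lam k)) *
      t ^ (k : ℕ) = eval z (pderiv o (X none * ∏ i, (C t - X (some i)) ^ lam i)) := by
    rw [← h1]
    exact Finset.sum_congr rfl fun k _ => by rw [map_mul, eval_C]; ring
  have hprod : ∀ s : Finset (Fin d),
      (∀ j ∈ s, pderiv o (X (some j) : MvPolynomial (Option (Fin d)) K) = 0) →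
      pderiv o (∏ j ∈ s, (C t - X (some j) : MvPolynomial (Option (Fin d)) K) ^ lam j) = 0 := by
    intro s hs
    refine Finset.prod_induction _ (fun p => pderiv o p = 0) ?_ ?_ ?_
    · intro p q hp hq
      rw [Derivation.leibniz, hp, hq, smul_zero, smul_zero, add_zero]
    · exact pderiv_one
    · intro j hj
      rw [Derivation.leibniz_pow, map_sub, pderiv_C, hs j hj, sub_zero, smul_zero, smul_zero]
  rw [h2]
  rcases o with _ | i
  · rw [Derivation.leibniz, hprod _ fun j _ => pderiv_X_of_ne (by simp), pderiv_X_self]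
    simp only [smul_eq_mul, mul_zero, zero_add, mul_one, map_prod, map_pow, map_sub, eval_C,
      eval_X, cofactor, nodal, Option.elim, Polynomial.eval_mul, Polynomial.eval_C,
      Polynomial.eval_prod, Polynomial.eval_pow, Polynomial.eval_sub, Polynomial.eval_X, one_mul,
      ← Finset.prod_mul_distrib]
    exact Finset.prod_congr rfl fun i _ => by rw [← pow_succ, Nat.sub_add_cancel (hpos i)]
  · rw [← Finset.mul_prod_erase Finset.univ _ (Finset.mem_univ i), Derivation.leibniz,
      pderiv_X_of_ne (by simp), smul_zero, add_zero, Derivation.leibniz,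
      hprod _ fun j hj => pderiv_X_of_ne (by simpa using (Finset.ne_of_mem_erase hj)),
      Derivation.leibniz_pow, map_sub, pderiv_C, pderiv_X_self, cofactor,
      ← Finset.mul_prod_erase Finset.univ _ (Finset.mem_univ i)]
    simp only [smul_eq_mul, mul_zero, zero_add, zero_sub, map_mul, map_prod, map_pow, map_sub,
      eval_C, eval_X, nodal, Option.elim, Polynomial.eval_mul, Polynomial.eval_C,
      Polynomial.eval_prod, Polynomial.eval_pow, Polynomial.eval_sub, Polynomial.eval_X,
      nsmul_eq_mul, map_natCast, map_neg, map_one, Polynomial.eval_neg, Polynomial.eval_natCast]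
    have h4 : ∏ j ∈ Finset.univ.erase i, (t - z (some j)) ^ lam j =
        (∏ j ∈ Finset.univ.erase i, (t - z (some j)) ^ (lam j - 1)) *
          ∏ j ∈ Finset.univ.erase i, (t - z (some j)) := by
      rw [← Finset.prod_mul_distrib]
      exact Finset.prod_congr rfl fun j _ => by rw [← pow_succ, Nat.sub_add_cancel (hpos j)]
    rw [h4]
    ring

end Locus

/-! ### The multiple root locus -/

section MultipleRootLocus

variable {K : Type*} [Field K] {n d : ℕ} {lam : Fin d → ℕ}

theorem prod_linearForm_isHomogeneous (hsum : ∑ i, lam i = n) (α β : Fin d → K) :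
    (∏ i, (C (α i) * X 0 + C (β i) * X 1 : MvPolynomial (Fin 2) K) ^ lam i).IsHomogeneous n := by
  rw [← hsum]
  refine IsHomogeneous.prod _ _ _ fun i _ => ?_
  have h : (C (α i) * X 0 + C (β i) * X 1 : MvPolynomial (Fin 2) K).IsHomogeneous 1 := by
    refine IsHomogeneous.add ?_ ?_
    · simpa using (isHomogeneous_C (Fin 2) (α i)).mul (isHomogeneous_X K (0 : Fin 2))
    · simpa using (isHomogeneous_C (Fin 2) (β i)).mul (isHomogeneous_X K (1 : Fin 2))
  simpa using h.pow (lam i)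

theorem binaryForm_eq_prod_iff (hsum : ∑ i, lam i = n) (α β : Fin d → K) (a : Fin (n + 1) → K) :
    binaryForm n a = ∏ i, (C (α i) * X 0 + C (β i) * X 1) ^ lam i ↔
      toPoly n a = ∏ i, (Polynomial.C (α i) * Polynomial.X + Polynomial.C (β i)) ^ lam i := by
  rw [binaryForm_eq_iff (prod_linearForm_isHomogeneous hsum α β)]
  simp [map_prod, algHom_C]

variable [CharZero K]

/-- The coordinate vector of the polynomial `z none * ∏ (X - z (some i)) ^ λ_i`. -/
def productVec (n : ℕ) (lam : Fin d → ℕ) (z : Option (Fin d) → K) : Fin (n + 1) → K :=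
  fun k => eval z (productCoord K n lam k)

theorem productVec_eq_smul (z : Option (Fin d) → K) :
    productVec n lam z =
      z none • productVec n lam fun o => o.elim 1 fun i => z (some i) := by
  funext k
  simp [productVec, eval_productCoord, Polynomial.coeff_C_mul]
  ring

/-- A polynomial vanishes on the multiple root locus if and only if it vanishes on the generic
product. Products with linear forms divisible by `y` are limits of the products
`∏ (x - z_i y) ^ λ_i`. -/
theorem mem_coneIdeal_multipleRootLocus (hsum : ∑ i, lam i = n)
    {F : MvPolynomial (Fin (n + 1)) K} :
    F ∈ coneIdeal (multipleRootLocus K n lam) ↔ aeval (productCoord K n lam) F = 0 := by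
  rw [multipleRootLocus, coneIdeal_zariskiClosure, mem_coneIdeal]
  constructor
  · intro h
    apply MvPolynomial.funext
    intro z
    rw [eval_aeval, map_zero]
    suffices h1 : eval (productVec n lam z) F = 0 from h1
    rw [productVec_eq_smul]
    refine h _ (smul_mem_cone ?_ _)
    refine fun hv => ⟨_, hv, 1, fun i => -z (some i), rfl, ?_⟩
    rw [binaryForm_eq_prod_iff hsum]
    refine (toPoly_eval_productCoord hsum _).trans ?_
    simp [sub_eq_add_neg]
  · intro hF v hv
    have hz : ∀ z, eval (productVec n lam z) F = 0 := by
      intro z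
      have := eval_aeval (productCoord K n lam) z F
      rw [hF, map_zero] at this
      exact this.symm
    by_cases h0 : v = 0
    · have := hz 0
      rw [productVec_eq_smul, Pi.zero_apply, zero_smul] at this
      rw [h0, this]
    obtain ⟨a, ha, α, β, hva, hab⟩ := hv h0
    rw [Projectivization.mk_eq_mk_iff'] at hva
    obtain ⟨μ, rfl⟩ := hva
    rw [binaryForm_eq_prod_iff hsum] at hab
    -- the coordinates of `μ ∏ (α_i X + β_i) ^ λ_i` for indeterminate `α_i`
    let P : Polynomial (MvPolynomial (Fin d) K) := Polynomial.C (C μ) *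
      ∏ i, (Polynomial.C (X i) * Polynomial.X + Polynomial.C (C (β i))) ^ lam i
    let W : Fin (n + 1) → MvPolynomial (Fin d) K := fun k =>
      C (n.choose k : K)⁻¹ * P.coeff k
    have hW : ∀ (α' : Fin d → K) (b : Fin (n + 1) → K),
        toPoly n b = Polynomial.C μ *
          ∏ i, (Polynomial.C (α' i) * Polynomial.X + Polynomial.C (β i)) ^ lam i →
        (fun k => eval α' (W k)) = b := by
      intro α' b hb
      funext k
      have h1 : P.map (eval α') = toPoly n b := by
        rw [hb]
        simp [P, Polynomial.map_prod]
      have h2 := coeff_toPoly n b k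
      rw [← h1, Polynomial.coeff_map] at h2
      simp only [W, map_mul, eval_C, h2]
      rw [inv_mul_cancel_left₀ (choose_ne_zero k)]
    have hG : (∏ i, X i : MvPolynomial (Fin d) K) ≠ 0 :=
      Finset.prod_ne_zero_iff.2 fun i _ => X_ne_zero i
    -- if no `α_i` vanishes, then the product has the roots `-β_i / α_i`
    have hFW : aeval W F = 0 := by
      refine eq_zero_of_eval_ne_zero hG fun α' hα' => ?_
      simp only [map_prod, eval_X] at hα'
      have hα'0 := fun i => Finset.prod_ne_zero_iff.1 hα' i (Finset.mem_univ i)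
      rw [eval_aeval, hW α' (productVec n lam fun o => o.elim (μ * ∏ i, α' i ^ lam i)
        fun i => -β i / α' i)]
      · exact hz _
      · refine (toPoly_eval_productCoord hsum _).trans ?_
        simp only [Option.elim, map_mul, map_prod, mul_assoc, ← Finset.prod_mul_distrib]
        congr 1
        refine Finset.prod_congr rfl fun i _ => ?_
        rw [map_pow, ← mul_pow, mul_sub, ← map_mul, mul_div_cancel₀ _ (hα'0 i), map_neg,
          sub_neg_eq_add]
    rw [← hW α (μ • a), ← eval_aeval, hFW, map_zero]
    rw [← hab]
    ext k
    simp [toPoly, Polynomial.finsetSum_coeff, Polynomial.coeff_monomial, Finset.mul_sum,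
      mul_left_comm]

theorem eval_productVec_eq_zero (hsum : ∑ i, lam i = n) {F : MvPolynomial (Fin (n + 1)) K}
    (hF : F ∈ coneIdeal (multipleRootLocus K n lam)) (z : Option (Fin d) → K) :
    eval (productVec n lam z) F = 0 := by
  have := eval_aeval (productCoord K n lam) z F
  rw [(mem_coneIdeal_multipleRootLocus hsum).1 hF, map_zero] at this
  exact this.symm

theorem coneIdeal_multipleRootLocus_eq_ker (hsum : ∑ i, lam i = n) :
    coneIdeal (multipleRootLocus K n lam) = RingHom.ker (aeval (productCoord K n lam) :
      MvPolynomial (Fin (n + 1)) K →ₐ[K] MvPolynomial (Option (Fin d)) K) := by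
  ext F
  rw [mem_coneIdeal_multipleRootLocus hsum, RingHom.mem_ker]

theorem coneIdeal_multipleRootLocus_isPrime (hsum : ∑ i, lam i = n) :
    (coneIdeal (multipleRootLocus K n lam)).IsPrime := by
  rw [coneIdeal_multipleRootLocus_eq_ker hsum]
  exact RingHom.ker_isPrime _

/-- The coordinate ring embeds into a polynomial ring in `d + 1` variables. -/
theorem trdeg_multipleRootLocus_le (hsum : ∑ i, lam i = n) :
    Algebra.trdeg K (CoordRing (multipleRootLocus K n lam)) ≤ (d + 1 : ℕ) := by
  have e : CoordRing (multipleRootLocus K n lam) ≃ₐ[K] _ :=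
    (Ideal.quotientEquivAlgOfEq K (coneIdeal_multipleRootLocus_eq_ker hsum)).trans
      (Ideal.quotientKerEquivRange _)
  rw [e.trdeg_eq]
  refine (trdeg_le_of_injective (Subalgebra.val _) Subtype.val_injective).trans ?_
  rw [MvPolynomial.trdeg_of_isDomain, Cardinal.mk_fintype, Fintype.card_option, Fintype.card_fin,
    Cardinal.lift_natCast]

/-- The partial derivatives of the generic product span the tangent space of the multiple root
locus at a general point. -/
def productTangent (n : ℕ) (lam : Fin d → ℕ) (z : Option (Fin d) → K) (o : Option (Fin d)) :
    Fin (n + 1) → K :=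
  fun k => eval z (pderiv o (productCoord K n lam k))

theorem productTangent_mem (hsum : ∑ i, lam i = n) {z : Option (Fin d) → K}
    (hz : productVec n lam z ≠ 0) (o : Option (Fin d)) :
    productTangent n lam z o ∈
      tangentSpace (multipleRootLocus K n lam) (Projectivization.mk K _ hz) := by
  rw [mem_tangentSpace_mk]
  intro F hF
  have h1 := derivation_aeval (pderiv o) (productCoord K n lam) F
  rw [(mem_coneIdeal_multipleRootLocus hsum).1 hF, map_zero] at h1
  have h2 := congrArg (eval z) h1.symm
  simp only [map_sum, smul_eq_mul, map_mul, eval_aeval, map_zero] at h2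
  rw [← h2]
  exact Finset.sum_congr rfl fun k _ => mul_comm _ _

theorem productTangent_linearIndependent (hpos : ∀ i, 1 ≤ lam i) (hsum : ∑ i, lam i = n)
    {z : Option (Fin d) → K} (h0 : z none ≠ 0)
    (hz : Function.Injective fun i => z (some i)) :
    LinearIndependent K (productTangent n lam z) := by
  rw [Fintype.linearIndependent_iff]
  intro g hg
  have hm : cofactor lam (fun i => z (some i)) ≠ 0 :=
    (Polynomial.monic_prod_of_monic _ _ fun i _ => (Polynomial.monic_X_sub_C _).pow _).ne_zero
  let T : (Fin (n + 1) → K) →ₗ[K] Polynomial K :=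
    { toFun := toPoly n
      map_add' := fun a b => by simp [toPoly, mul_add, Finset.sum_add_distrib]
      map_smul' := fun c a => by
        simp [toPoly, Finset.smul_sum, Polynomial.smul_monomial, mul_left_comm] }
  have hT : ∀ o, T (productTangent n lam z o) =
      Polynomial.C (o.elim 1 fun i => -(z none * lam i)) *
        (cofactor lam (fun i => z (some i)) * nodal (fun i => z (some i)) o) :=
    fun o => toPoly_pderiv_productCoord hpos hsum z o
  have h1 := congrArg T hg
  rw [map_sum, map_zero] at h1
  have h2 : cofactor lam (fun i => z (some i)) *
      ∑ o, (g o * o.elim 1 fun i => -(z none * lam i)) • nodal (fun i => z (some i)) o = 0 := by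
    rw [← h1, Finset.mul_sum]
    refine Finset.sum_congr rfl fun o _ => ?_
    rw [map_smul, hT, Polynomial.smul_eq_C_mul, Polynomial.smul_eq_C_mul, map_mul]
    ring
  have h3 := Fintype.linearIndependent_iff.1 (nodal_linearIndependent hz) _
    ((mul_eq_zero.1 h2).resolve_left hm)
  intro o
  refine (mul_eq_zero.1 (h3 o)).resolve_right ?_
  rcases o with _ | i
  · exact one_ne_zero
  · exact neg_ne_zero.2 (mul_ne_zero h0 (Nat.cast_ne_zero.2 (by have := hpos i; omega)))

/-- A general point of the multiple root locus is smooth, and its tangent space is spanned by the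
partial derivatives of the generic product. -/
theorem exists_smooth (hpos : ∀ i, 1 ≤ lam i) (hsum : ∑ i, lam i = n) :
    ∃ U ∉ coneIdeal (multipleRootLocus K n lam), ∀ (z : Option (Fin d) → K)
      (hv : productVec n lam z ≠ 0), eval (productVec n lam z) U ≠ 0 → z none ≠ 0 →
      Function.Injective (fun i => z (some i)) →
      IsSmoothPoint (multipleRootLocus K n lam) (Projectivization.mk K _ hv) ∧
      tangentSpace (multipleRootLocus K n lam) (Projectivization.mk K _ hv) =
        Submodule.span K (Set.range (productTangent n lam z)) := by
  have := coneIdeal_multipleRootLocus_isPrime (K := K) hsum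
  obtain ⟨U, hU, hle⟩ := exists_finrank_tangentSpace_le (multipleRootLocus K n lam)
  refine ⟨U, hU, fun z hv hUz h0 hz => ?_⟩
  have h1 := hle _ hv hUz
  have hspan : Submodule.span K (Set.range (productTangent n lam z)) ≤
      tangentSpace (multipleRootLocus K n lam) (Projectivization.mk K _ hv) := by
    rw [Submodule.span_le]
    rintro _ ⟨o, rfl⟩
    exact productTangent_mem hsum hv o
  have hcard :
      Module.finrank K (Submodule.span K (Set.range (productTangent n lam z))) = d + 1 := by
    rw [finrank_span_eq_card (productTangent_linearIndependent hpos hsum h0 hz),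
      Fintype.card_option, Fintype.card_fin]
  have h2 := trdeg_multipleRootLocus_le (K := K) hsum
  have h3 : Module.finrank K
      (tangentSpace (multipleRootLocus K n lam) (Projectivization.mk K _ hv)) ≤ d + 1 :=
    Nat.cast_le.1 (h1.trans h2)
  -- `d + 1` bounds the dimension from above and the dimension of the tangent space from below
  have h4 := Submodule.eq_of_le_of_finrank_le hspan (h3.trans hcard.ge)
  refine ⟨⟨?_, ?_⟩, h4.symm⟩
  · rw [multipleRootLocus, mk_mem_zariskiClosure]
    intro F hF
    refine eval_productVec_eq_zero hsum ?_ z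
    rwa [multipleRootLocus, coneIdeal_zariskiClosure]
  · refine le_antisymm h1 (h2.trans ?_)
    rw [← h4, hcard]

end MultipleRootLocus

/-! ### The dual variety -/

section DualVariety

variable {K : Type*} [Field K] {n d : ℕ} {lam : Fin d → ℕ}

theorem cofactor_eq_prod_bigPart (hpos : ∀ i, 1 ≤ lam i) (x : Fin d → K) :
    cofactor lam x =
      ∏ i : BigPart lam, (Polynomial.X - Polynomial.C (x i)) ^ order lam i := by
  have h1 : ∀ i : BigPart lam, (Polynomial.X - Polynomial.C (x i)) ^ order lam i =
      (Polynomial.X - Polynomial.C (x i)) ^ (lam i - 1) := by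
    intro i
    have := two_le_of_bigPart hpos i
    congr 1
    simp only [order]
    omega
  rw [Finset.prod_congr rfl fun i _ => h1 i, cofactor,
    ← Finset.prod_subtype (Finset.univ.filter fun i => lam i ≠ 1) (by simp)
      fun i => (Polynomial.X - Polynomial.C (x i)) ^ (lam i - 1)]
  refine (Finset.prod_filter_of_ne (p := fun i => lam i ≠ 1) fun _ _ hi h => hi ?_).symm
  rw [h, Nat.sub_self, pow_zero]

theorem monic_cofactor (x : Fin d → K) : (cofactor lam x).Monic :=
  monic_prod_X_sub_C_pow x (lam · - 1)

theorem natDegree_cofactor_add (hpos : ∀ i, 1 ≤ lam i) (hsum : ∑ i, lam i = n) (x : Fin d → K) :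
    (cofactor lam x).natDegree + d = n := by
  rw [cofactor, natDegree_prod_X_sub_C_pow x (lam · - 1), ← hsum]
  have : ∑ i, lam i = ∑ i, (lam i - 1) + ∑ _i : Fin d, 1 := by
    rw [← Finset.sum_add_distrib]
    exact Finset.sum_congr rfl fun _ _ => (Nat.sub_add_cancel (hpos _)).symm
  simp [this]

theorem eval_genericMoment (x : BigPart lam → K) (c : BigPart lam → ℕ → K) (k : ℕ) :
    eval (paramValue x c) (genericMoment K lam k) = moment (order lam) x c k := by
  have h := aeval_genericMoment (K := K) x c k
  simpa only [aeval_eq_eval] using h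

theorem eval_genericMoment_eq (ζ : ParamIndex lam → K) (k : ℕ) :
    eval ζ (genericMoment K lam k) = moment (order lam) (fun i => ζ (Sum.inl i))
      (fun i j => if h : j < order lam i then ζ (Sum.inr ⟨i, ⟨j, h⟩⟩) else 0) k := by
  rw [← eval_genericMoment]
  congr 2
  funext p
  rcases p with i | ⟨i, j⟩
  · rfl
  · change _ = if h : (j : ℕ) < order lam i then ζ (Sum.inr ⟨i, ⟨j, h⟩⟩) else 0
    rw [dif_pos j.2]

/-- The polynomial that excludes the zero form and coincidences between the roots. -/
def discriminant (K : Type*) [Field K] (d : ℕ) : MvPolynomial (Option (Fin d)) K :=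
  X none * ∏ p ∈ (Finset.univ : Finset (Fin d)).offDiag, (X (some p.1) - X (some p.2))

theorem discriminant_ne_zero : discriminant K d ≠ 0 := by
  refine mul_ne_zero (X_ne_zero _) (Finset.prod_ne_zero_iff.2 fun p hp => ?_)
  rw [sub_ne_zero]
  intro h
  exact (Finset.mem_offDiag.1 hp).2.2 (Option.some_injective _ (X_injective h))

theorem eval_discriminant_ne_zero {z : Option (Fin d) → K} (h : eval z (discriminant K d) ≠ 0) :
    z none ≠ 0 ∧ Function.Injective fun i => z (some i) := by
  rw [discriminant, map_mul, eval_X, map_prod] at h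
  refine ⟨left_ne_zero_of_mul h, fun i j hij => ?_⟩
  by_contra hne
  refine Finset.prod_ne_zero_iff.1 (right_ne_zero_of_mul h) (i, j)
    (Finset.mem_offDiag.2 ⟨Finset.mem_univ _, Finset.mem_univ _, hne⟩) ?_
  simpa [sub_eq_zero] using hij

variable [CharZero K]

/-- A vector that annihilates the tangent directions at `∏ (X - x i) ^ λ_i` annihilates the ideal
generated by `∏ (X - x i) ^ (λ_i - 1)` in degrees at most `n`, and is therefore a vector of
moments. -/
theorem exists_eq_genericMoment (hpos : ∀ i, 1 ≤ lam i) (hsum : ∑ i, lam i = n)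
    {x : Fin d → K} (hx : Function.Injective x) {g : Fin (n + 1) → K}
    (hg : ∀ o, contraction g (cofactor lam x * nodal x o) = 0) :
    ∃ ζ : ParamIndex lam → K, ∀ k : Fin (n + 1), g k = eval ζ (genericMoment K lam k) := by
  have hcd := natDegree_cofactor_add hpos hsum x
  obtain ⟨c, hc⟩ := exists_functional_eq_sum (x := fun i : BigPart lam => x i)
    (hx.comp Subtype.val_injective) (order lam) (n := n) (contraction g) (by
      intro q hq
      rw [← cofactor_eq_prod_bigPart hpos] at hq ⊢
      rcases eq_or_ne q 0 with rfl | hq0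
      · simp
      rw [Polynomial.natDegree_mul (monic_cofactor x).ne_zero hq0] at hq
      exact eq_zero_of_nodal hx ((contraction g).comp (LinearMap.mulLeft K (cofactor lam x))) hg
        (by omega))
  refine ⟨paramValue (fun i => x i) c, fun k => ?_⟩
  have h1 := hc (Polynomial.X ^ (k : ℕ)) (by rw [Polynomial.natDegree_X_pow]; omega)
  rw [sum_derivative_eval_X_pow, contraction_apply, Finset.sum_eq_single k] at h1
  · rw [eval_genericMoment, ← h1, Polynomial.coeff_X_pow_self, one_mul]
  · intro b _ hb
    rw [Polynomial.coeff_X_pow, if_neg fun h => hb (Fin.ext h), zero_mul]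
  · simp

/-- A functional of order `λ_i - 1` at the node `x i` annihilates the tangent directions. -/
theorem contraction_genericMoment (hpos : ∀ i, 1 ≤ lam i) (hsum : ∑ i, lam i = n)
    (x : Fin d → K) (ζ : ParamIndex lam → K) (hζ : ∀ i : BigPart lam, ζ (Sum.inl i) = x i)
    (o : Option (Fin d)) :
    contraction (fun k : Fin (n + 1) => eval ζ (genericMoment K lam k))
      (cofactor lam x * nodal x o) = 0 := by
  have hcd := natDegree_cofactor_add hpos hsum x
  have hn : (nodal x o).natDegree ≤ d := by
    cases o with
    | none =>
      rw [nodal, Polynomial.natDegree_prod_of_monic _ _ fun j _ => Polynomial.monic_X_sub_C _]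
      simp
    | some i =>
      rw [nodal, Polynomial.natDegree_prod_of_monic _ _ fun j _ => Polynomial.monic_X_sub_C _]
      simp
  simp only [eval_genericMoment_eq]
  rw [contraction_moment _ _ _ (Polynomial.natDegree_mul_le.trans (by omega))]
  refine Finset.sum_eq_zero fun i _ => Finset.sum_eq_zero fun j hj => ?_
  have hdvd : (Polynomial.X - Polynomial.C (x i)) ^ order lam i ∣ cofactor lam x * nodal x o := by
    rw [cofactor_eq_prod_bigPart hpos]
    exact (Finset.dvd_prod_of_mem (fun i : BigPart lam =>
      (Polynomial.X - Polynomial.C (x i)) ^ order lam i) (Finset.mem_univ i)).mul_right _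
  rw [hζ, (pow_dvd_iff_derivative_eval _ _ _).1 hdvd j (Finset.mem_range.1 hj), mul_zero]

theorem productVec_ne_zero (hsum : ∑ i, lam i = n) {z : Option (Fin d) → K} (h0 : z none ≠ 0) :
    productVec n lam z ≠ 0 := by
  intro h
  have h1 := toPoly_eval_productCoord (K := K) hsum z
  have h2 : toPoly n (fun k => eval z (productCoord K n lam k)) = 0 := by
    change toPoly n (productVec n lam z) = 0
    rw [h]
    simp [toPoly]
  rw [h2] at h1
  refine mul_ne_zero (Polynomial.C_ne_zero.2 h0) ?_ h1.symm
  exact (monic_prod_X_sub_C_pow (fun i => z (some i)) lam).ne_zero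

theorem pairing_productTangent (hpos : ∀ i, 1 ≤ lam i) (hsum : ∑ i, lam i = n)
    (z : Option (Fin d) → K) (o : Option (Fin d)) (g : Fin (n + 1) → K) :
    pairing n (productTangent n lam z o) g = (o.elim 1 fun i => -(z none * lam i)) *
      contraction g (cofactor lam (fun i => z (some i)) * nodal (fun i => z (some i)) o) := by
  have h := toPoly_pderiv_productCoord hpos hsum z o
  change toPoly n (productTangent n lam z o) = _ at h
  rw [pairing_eq_contraction, h, ← Polynomial.smul_eq_C_mul, map_smul, smul_eq_mul]

theorem sum_productTangent_eq_zero (hsum : ∑ i, lam i = n) {F : MvPolynomial (Fin (n + 1)) K}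
    (hF : F ∈ coneIdeal (multipleRootLocus K n lam)) {z : Option (Fin d) → K} (h0 : z none ≠ 0)
    (o : Option (Fin d)) :
    ∑ k, productTangent n lam z o k * eval (productVec n lam z) (pderiv k F) = 0 :=
  (mem_tangentSpace_mk (productVec_ne_zero hsum h0)).1
    (productTangent_mem hsum (productVec_ne_zero hsum h0) o) F hF

/-- Hyperplanes tangent to the multiple root locus are limits of generalized additive
decompositions: the gradient of an equation of the locus, evaluated at a general point, is a vector
of moments, so that the equations of the image of the rational map, evaluated on the gradient,
vanish on the entire locus. -/
theorem mem_zariskiClosure_ratImage (hpos : ∀ i, 1 ≤ lam i) (hsum : ∑ i, lam i = n)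
    {f g : ℙ K (Fin (n + 1) → K)} (hf : f ∈ multipleRootLocus K n lam)
    (hg : ∀ w ∈ tangentSpace (multipleRootLocus K n lam) f, pairing n w g.rep = 0) :
    g ∈ zariskiClosure (ratImage (paramSpace K n lam) (paramMap K n lam)) := by
  intro H hH
  rw [mem_coneIdeal_ratImage hpos hsum] at hH
  obtain ⟨F, hF, hFg⟩ := exists_gradient_eq (X := multipleRootLocus K n lam) (p := f)
    (u := fun k => (n.choose k : K) * g.rep k) fun w hw => by
      rw [← hg w hw, pairing]
      exact Finset.sum_congr rfl fun k _ => by ring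
  let G : Fin (n + 1) → MvPolynomial (Fin (n + 1)) K :=
    fun k => C (n.choose k : K)⁻¹ * pderiv k F
  -- at a general point the gradient annihilates the tangent directions, hence consists of moments
  have hGH : aeval G H ∈ coneIdeal (multipleRootLocus K n lam) := by
    rw [mem_coneIdeal_multipleRootLocus hsum]
    refine eq_zero_of_eval_ne_zero discriminant_ne_zero fun z hz => ?_
    obtain ⟨h0, hinj⟩ := eval_discriminant_ne_zero hz
    rw [eval_aeval, eval_aeval]
    obtain ⟨ζ, hζ⟩ := exists_eq_genericMoment hpos hsum hinj
      (g := fun k => eval (productVec n lam z) (G k)) fun o => by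
        have h1 := sum_productTangent_eq_zero hsum hF h0 o
        have h2 : pairing n (productTangent n lam z o)
            (fun k => eval (productVec n lam z) (G k)) = 0 := by
          rw [← h1, pairing]
          refine Finset.sum_congr rfl fun k _ => ?_
          simp only [G, map_mul, eval_C]
          have := choose_ne_zero (K := K) k
          field_simp
        rw [pairing_productTangent hpos hsum] at h2
        refine (mul_eq_zero.1 h2).resolve_left ?_
        rcases o with _ | i
        · exact one_ne_zero
        · exact neg_ne_zero.2 (mul_ne_zero h0 (Nat.cast_ne_zero.2 (by have := hpos i; omega)))
    change eval (fun k => eval (productVec n lam z) (G k)) H = 0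
    rw [funext hζ, ← eval_aeval, hH, map_zero]
  have h1 := mem_coneIdeal.1 hGH f.rep (rep_mem_cone.2 hf)
  have h2 : (fun k => eval f.rep (G k)) = g.rep := by
    funext k
    simp only [G, map_mul, eval_C, hFg]
    rw [inv_mul_cancel_left₀ (choose_ne_zero k)]
  rwa [eval_aeval, h2] at h1

/-- A polynomial that vanishes on all tangent hyperplanes vanishes on the generic moments. -/
theorem momentHom_eq_zero (hpos : ∀ i, 1 ≤ lam i) (hsum : ∑ i, lam i = n)
    {F : MvPolynomial (Fin (n + 1)) K}
    (hF : F ∈ coneIdeal (Prod.snd '' {fg : ℙ K (Fin (n + 1) → K) × ℙ K (Fin (n + 1) → K) |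
      IsSmoothPoint (multipleRootLocus K n lam) fg.1 ∧
      ∀ w ∈ tangentSpace (multipleRootLocus K n lam) fg.1, pairing n w fg.2.rep = 0})) :
    momentHom K n lam F = 0 := by
  obtain ⟨U, hU, hsm⟩ := exists_smooth (K := K) hpos hsum
  rw [mem_coneIdeal_multipleRootLocus hsum] at hU
  -- the roots of the product and the coefficients of the moments as independent variables
  let ρ : ParamIndex lam → Option (Fin d) ⊕ (Σ i : BigPart lam, Fin (order lam i)) :=
    Sum.elim (fun i => Sum.inl (some i.1)) Sum.inr
  have hρ : Function.Injective ρ := by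
    rintro (i | i) (j | j) h
    · exact congrArg Sum.inl (Subtype.ext (Option.some_injective _ (Sum.inl_injective h)))
    · exact absurd h Sum.inl_ne_inr
    · exact absurd h Sum.inr_ne_inl
    · exact congrArg Sum.inr (Sum.inr_injective h)
  apply rename_injective ρ hρ
  rw [map_zero]
  have hG : rename (Sum.inl : _ → Option (Fin d) ⊕ (Σ i : BigPart lam, Fin (order lam i)))
      (aeval (productCoord K n lam) U * discriminant K d) ≠ 0 := by
    rw [Ne, map_eq_zero_iff _ (rename_injective _ Sum.inl_injective)]
    exact mul_ne_zero hU discriminant_ne_zero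
  refine eq_zero_of_eval_ne_zero hG fun y hy => ?_
  rw [eval_rename, map_mul] at hy
  obtain ⟨h0, hinj⟩ := eval_discriminant_ne_zero (right_ne_zero_of_mul hy)
  have hUz := left_ne_zero_of_mul hy
  rw [eval_aeval] at hUz
  have hv := productVec_ne_zero hsum h0
  obtain ⟨hs, ht⟩ := hsm _ hv hUz h0 hinj
  rw [eval_rename, eval_momentHom]
  refine mem_coneIdeal.1 hF _ fun hγ => ⟨(Projectivization.mk K _ hv, _), ⟨hs, fun w hw => ?_⟩, rfl⟩
  obtain ⟨a, ha0, ha⟩ := mk_rep_smul _ (rfl : Projectivization.mk K _ hγ = _)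
  rw [ht] at hw
  have h1 : pairing n w (fun k : Fin (n + 1) => eval (y ∘ ρ) (genericMoment K lam k)) = 0 := by
    induction hw using Submodule.span_induction with
    | mem w hw =>
      obtain ⟨o, rfl⟩ := hw
      rw [pairing_productTangent hpos hsum, contraction_genericMoment hpos hsum _ (y ∘ ρ), mul_zero]
      exact fun i => rfl
    | zero => simp [pairing]
    | add u w _ _ hu hw =>
      rw [pairing] at hu hw ⊢
      simp only [Pi.add_apply, mul_add, add_mul, Finset.sum_add_distrib, hu, hw, add_zero]
    | smul c w _ hw =>
      have : pairing n (c • w) (fun k : Fin (n + 1) => eval (y ∘ ρ) (genericMoment K lam k)) =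
          c * pairing n w (fun k : Fin (n + 1) => eval (y ∘ ρ) (genericMoment K lam k)) := by
        rw [pairing, pairing, Finset.mul_sum]
        exact Finset.sum_congr rfl fun k _ => by rw [Pi.smul_apply, smul_eq_mul]; ring
      rw [this, hw, mul_zero]
  have h2 : pairing n w (fun k : Fin (n + 1) => eval (y ∘ ρ) (genericMoment K lam k)) =
      a * pairing n w (Projectivization.mk K _ hγ).rep := by
    conv_lhs => rw [ha]
    rw [pairing, pairing, Finset.mul_sum]
    exact Finset.sum_congr rfl fun k _ => by rw [Pi.smul_apply, smul_eq_mul]; ring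
  exact (mul_eq_zero.1 (h2.symm.trans h1)).resolve_left ha0

/-- The closure in the conormal variety does not matter for the closure of the second projection. -/
theorem zariskiClosure_ratImage_eq (hpos : ∀ i, 1 ≤ lam i) (hsum : ∑ i, lam i = n) :
    zariskiClosure (ratImage (paramSpace K n lam) (paramMap K n lam)) =
      dualVariety n (multipleRootLocus K n lam) := by
  rw [dualVariety, conormalVariety, zariskiClosure_image_snd]
  apply zariskiClosure_eq_of_coneIdeal_eq
  apply le_antisymm
  · refine coneIdeal_le_of_subset_zariskiClosure ?_
    rintro _ ⟨⟨f, g⟩, ⟨hf, hg⟩, rfl⟩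
    exact mem_zariskiClosure_ratImage hpos hsum hf.1 hg
  · intro F hF
    rw [mem_coneIdeal_ratImage hpos hsum]
    exact momentHom_eq_zero hpos hsum hF

theorem mem_coneIdeal_dualVariety (hpos : ∀ i, 1 ≤ lam i) (hsum : ∑ i, lam i = n)
    {F : MvPolynomial (Fin (n + 1)) K} :
    F ∈ coneIdeal (dualVariety n (multipleRootLocus K n lam)) ↔ momentHom K n lam F = 0 := by
  rw [← zariskiClosure_ratImage_eq hpos hsum, coneIdeal_zariskiClosure]
  exact mem_coneIdeal_ratImage hpos hsum

end DualVariety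

/-! ### The decomposition and the number of symmetries -/

section Decomposition

variable {K : Type*} [Field K] {n d : ℕ} {lam : Fin d → ℕ}

/-- Permutations that preserve the parts are the stabilizer of `lam`, a product of symmetric
groups. -/
theorem card_perm_order_eq (hpos : ∀ i, 1 ≤ lam i) (hsum : ∑ i, lam i = n) :
    Nat.card {π : Equiv.Perm (BigPart lam) // ∀ i, order lam (π i) = order lam i} =
      ∏ j ∈ Finset.Icc 2 n, ((Finset.univ.filter fun i => lam i = j).card).factorial := by
  classical
  let f : BigPart lam → ℕ := fun i => lam i
  have h2 := two_le_of_bigPart hpos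
  have e : {π : Equiv.Perm (BigPart lam) // ∀ i, order lam (π i) = order lam i} ≃
      {π : Equiv.Perm (BigPart lam) // f ∘ π = f} := by
    refine Equiv.subtypeEquivRight fun π => ?_
    rw [funext_iff]
    refine forall_congr' fun i => ?_
    have := h2 i
    have := h2 (π i)
    simp only [order, f, Function.comp_apply]
    omega
  rw [Nat.card_congr e, Nat.card_eq_fintype_card, DomMulAct.stabilizer_card']
  have hcard : ∀ j, 2 ≤ j → Fintype.card {a // f a = j} =
      (Finset.univ.filter fun i => lam i = j).card := by
    intro j hj
    rw [← Fintype.card_subtype]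
    exact Fintype.card_congr ⟨fun a => ⟨a.1.1, a.2⟩, fun a => ⟨⟨a.1, by have := a.2; omega⟩, a.2⟩,
      fun _ => rfl, fun _ => rfl⟩
  refine (Finset.prod_congr rfl fun j hj => ?_).trans (Finset.prod_subset ?_ ?_)
  · obtain ⟨i, -, rfl⟩ := Finset.mem_image.1 hj
    rw [hcard _ (h2 i)]
  · intro j hj
    obtain ⟨i, -, rfl⟩ := Finset.mem_image.1 hj
    exact Finset.mem_Icc.2 ⟨h2 i, le_of_sum_eq hsum i⟩
  · intro j hj hj'
    rw [← hcard j (Finset.mem_Icc.1 hj).1, Fintype.card_eq_zero_iff.2 ⟨fun a =>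
      hj' (Finset.mem_image.2 ⟨a.1, Finset.mem_univ _, a.2⟩)⟩, Nat.factorial_zero]

variable [CharZero K]

/-- The generalized additive decomposition. -/
theorem binaryForm_paramMap (hpos : ∀ i, 1 ≤ lam i) (hsum : ∑ i, lam i = n) (s t : BigPart lam → K)
    (c : ∀ i : BigPart lam, Fin (lam i - 2 + 1) → K) :
    binaryForm n (fun k => eval (paramPoint n lam s t c) (paramMap K n lam k)) =
      ∑ i : BigPart lam, (C (s i) * X 0 + C (t i) * X 1) ^ (n - lam i + 2) *
        binaryForm (lam i - 2) (c i) := by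
  have h1 : ∀ k : Fin (n + 1),
      C ((n.choose k : K) * eval (paramPoint n lam s t c) (paramMap K n lam k)) *
        X 0 ^ (k : ℕ) * X 1 ^ (n - k) = ∑ i : BigPart lam, ∑ a : Fin (n - lam i + 2 + 1),
        ∑ b : Fin (lam i - 2 + 1), if (a : ℕ) + b = k then
          (C (((n - lam i + 2).choose a * (lam i - 2).choose b : K) *
            paramPoint n lam s t c ⟨i, (a, b)⟩) * X 0 ^ ((a : ℕ) + b) * X 1 ^ (n - (a + b)) :
            MvPolynomial (Fin 2) K) else 0 := by
    intro k
    have h := aeval_paramMap (K := K) (paramPoint n lam s t c) k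
    rw [aeval_eq_eval] at h
    change eval (paramPoint n lam s t c) (paramMap K n lam k) = _ at h
    rw [h, Algebra.algebraMap_self_apply, mul_inv_cancel_left₀ (choose_ne_zero k)]
    simp only [map_sum, Finset.sum_mul]
    refine Finset.sum_congr rfl fun i _ => Finset.sum_congr rfl fun a _ =>
      Finset.sum_congr rfl fun b _ => ?_
    split_ifs with hk
    · rw [hk]
    · rw [map_zero, zero_mul, zero_mul]
  rw [binaryForm, Finset.sum_congr rfl fun k _ => h1 k, Finset.sum_comm]
  refine Finset.sum_congr rfl fun i _ => ?_
  have hi := two_le_of_bigPart hpos i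
  have hin := le_of_sum_eq hsum i
  rw [Finset.sum_comm, add_pow, binaryForm, Finset.sum_mul_sum,
    ← Fin.sum_univ_eq_sum_range (fun a => ∑ b : Fin (lam i - 2 + 1), _)]
  refine Finset.sum_congr rfl fun a _ => ?_
  rw [Finset.sum_comm]
  refine Finset.sum_congr rfl fun b _ => ?_
  have ha := a.2
  have hb := b.2
  rw [Finset.sum_eq_single ⟨(a : ℕ) + b, by omega⟩]
  · rw [if_pos rfl, show n - ((a : ℕ) + b) = (n - lam i + 2 - a) + (lam i - 2 - b) by omega]
    simp only [paramPoint, map_mul, map_pow, map_natCast, mul_pow, pow_add]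
    ring
  · intro k _ hk
    exact if_neg fun h => hk (Fin.ext h.symm)
  · simp

end Decomposition

end BinaryForms

end

open BinaryForms

theorem theorem2p9 {K : Type*} [Field K] [CharZero K] (n d : ℕ) (lam : Fin d → ℕ)
    (hpos : ∀ i, 1 ≤ lam i) (hanti : Antitone lam) (hsum : ∑ i, lam i = n) :
    -- the dimension of the dual variety
    HasProjDim (dualVariety n (multipleRootLocus K n lam))
        ((n : ℤ) - (Finset.univ.filter fun i => lam i = 1).card - 1) ∧
    -- the rational map on the parameter space is given by the generalized additive decomposition
    (∀ (s t : BigPart lam → K) (c : ∀ i : BigPart lam, Fin (lam i - 2 + 1) → K),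
      binaryForm n (fun k => MvPolynomial.eval (paramPoint n lam s t c) (paramMap K n lam k)) =
        ∑ i : BigPart lam, (MvPolynomial.C (s i) * MvPolynomial.X 0 +
            MvPolynomial.C (t i) * MvPolynomial.X 1) ^ (n - lam i + 2) *
          binaryForm (lam i - 2) (c i)) ∧
    -- it parametrizes the dual variety
    zariskiClosure (ratImage (paramSpace K n lam) (paramMap K n lam)) =
      dualVariety n (multipleRootLocus K n lam) ∧
    -- it is finite-to-one over a dense open subset of the dual variety
    (∃ Z : Set (ℙ K (Fin (n + 1) → K)), zariskiClosure Z = Z ∧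
      zariskiClosure (dualVariety n (multipleRootLocus K n lam) \ Z) =
        dualVariety n (multipleRootLocus K n lam) ∧
      ∀ g ∈ dualVariety n (multipleRootLocus K n lam) \ Z,
        (ratFibre (paramSpace K n lam) (paramMap K n lam) g).Finite) ∧
    -- its degree
    ratDegree (paramSpace K n lam) (paramMap K n lam) =
      ∏ j ∈ Finset.Icc 2 n, ((Finset.univ.filter fun i => lam i = j).card).factorial :=
  ⟨hasProjDim_of_mem_coneIdeal_iff hpos hsum fun _ => mem_coneIdeal_dualVariety hpos hsum,
    binaryForm_paramMap hpos hsum,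
    zariskiClosure_ratImage_eq hpos hsum,
    exists_finite_ratFibre hpos hsum (zariskiClosure_ratImage_eq hpos hsum).symm,
    (ratDegree_paramMap_eq_card hpos hsum).trans (card_perm_order_eq hpos hsum)⟩
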